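/- Fix a field $F$. For integers $a,b,c\ge 0$ let $\omega(a,b,c)$ be the smallest real number such that the product of an $n^a\times n^b$ matrix and an $n^b\times n^c$ matrix can be computed with $n^{\omega(a,b,c)+o(1)}$ arithmetic operations over $F$, and put \[C(n,k)=n^{\omega(\lfloor k/3\rfloor,\lceil (k-1)/3\rceil,\lceil k/3\rceil)} .\] Algorithms are programs for the word RAM with words of $O(\log n)$ bits; they are either all deterministic, or all randomized with success probability at least $2/3$ (the statement holds in both settings, the same setting being used throughout). Graphs are given by adjacency matrices. We say that a problem requires $f(n)^{1-o(1)}$ time if for no constant $\varepsilon>0$ it can be solved in $O(f(n)^{1-\varepsilon})$ time. In the $k$-Clique problem one is given a $k$-partite graph with $n$ vertices in each part and has to decide whether it contains $k$ mutually adjacent vertices. The $k$-Clique Hypothesis states that, for every constant integer $k\ge 3$, solving $k$-Clique requires $C(n,k)^{1-o(1)}$ time. In the $p$-DP problem (respectively, the $p$-DSP problem) on unweighted DAGs one is given an unweighted directed acyclic graph with $n$ vertices, sources $s_1,\dots,s_p$ and targets $t_1,\dots,t_p$, and has to decide whether there are pairwise internally vertex-disjoint paths (respectively, shortest paths) $P_1,\dots,P_p$,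 where $P_i$ leads from $s_i$ to $t_i$. **Statement.** Let $p\ge 5$ be an integer and put \[k_{\mathrm{even}}(p)=2\lfloor\sqrt{p+1}\rfloor-2,\qquad k_{\mathrm{odd}}(p)=2\left\lfloor\frac{\sqrt{4p+5}-1}{2}\right\rfloor-1 .\] Then $k_{\mathrm{even}}(p)$ and $k_{\mathrm{odd}}(p)$ are, respectively, the largest even and the largest odd integer $k$ with $k+\lfloor k^2/4\rfloor\le p$. Moreover, assuming the $k$-Clique Hypothesis, the $p$-DSP problem and the $p$-DP problem on unweighted DAGs both require \[\max\bigl(C(n,k_{\mathrm{even}}(p)),\,C(n,k_{\mathrm{odd}}(p))\bigr)^{1-o(1)}\] time. -/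

import Mathlib

/-! ### The word RAM -/

/-- The arithmetic and bitwise word operations; each of them costs one step. -/
inductive WordOp
  | add | sub | mul | div | mod | and | or | xor | shiftLeft | shiftRight

/-- The value of a word operation (`sub` is truncated at `0`, `div` and `mod` are the Euclidean
ones of `ℕ`). -/
def WordOp.eval : WordOp → ℕ → ℕ → ℕ
  | .add, x, y => x + y
  | .sub, x, y => x - y
  | .mul, x, y => x * y
  | .div, x, y => x / y
  | .mod, x, y => x % y
  | .and, x, y => x &&& y
  | .or, x, y => x ||| y
  | .xor, x, y => x ^^^ y
  | .shiftLeft, x, y => x <<< y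
  | .shiftRight, x, y => x >>> y

/-- Instructions of the RAM. `R` stands for the registers and `M` for the memory. -/
inductive Instr
  /-- `R[a] := v` -/
  | const (a v : ℕ)
  /-- `R[a] := o (R[b], R[c])` -/
  | op (o : WordOp) (a b c : ℕ)
  /-- `R[a] := M[R[b]]` -/
  | load (a b : ℕ)
  /-- `M[R[a]] := R[b]` -/
  | store (a b : ℕ)
  /-- if `R[a] = 0`, continue with instruction number `l` -/
  | jumpIfZero (a l : ℕ)
  /-- `R[a] :=` a fresh uniformly random bit -/
  | coin (a : ℕ)

/-- A RAM program: instruction number `i` is the `i`-th entry of the list. -/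
abbrev Program := List Instr

/-- A configuration of the RAM. -/
structure Config where
  /-- the number of the instruction that is executed next -/
  pc : ℕ
  /-- the registers -/
  reg : ℕ → ℕ
  /-- the memory -/
  mem : ℕ → ℕ

/-- The machine has halted when the program counter points outside of the program. -/
def Config.Halted (P : Program) (c : Config) : Prop := P.length ≤ c.pc

/-- One step of program `P`; `coin` is the random bit that is available in this step. A halted
configuration does not change. -/
def Program.step (P : Program) (c : Config) (coin : Bool) : Config :=
  match P[c.pc]? with
  | none => c
  | some (.const a v) => { c with pc := c.pc + 1, reg := Function.update c.reg a v }
  | some (.op o a x y) =>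
      { c with pc := c.pc + 1, reg := Function.update c.reg a (o.eval (c.reg x) (c.reg y)) }
  | some (.load a b) =>
      { c with pc := c.pc + 1, reg := Function.update c.reg a (c.mem (c.reg b)) }
  | some (.store a b) =>
      { c with pc := c.pc + 1, mem := Function.update c.mem (c.reg a) (c.reg b) }
  | some (.jumpIfZero a l) => { c with pc := if c.reg a = 0 then l else c.pc + 1 }
  | some (.coin a) => { c with pc := c.pc + 1, reg := Function.update c.reg a coin.toNat }

/-- The configuration reached from `c` after `coins.length` steps, `coins` being the random bits
of these steps. -/
def Program.run (P : Program) (c : Config) (coins : List Bool) : Config :=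
  coins.foldl P.step c

/-! ### Decision problems and their time complexity -/

/-- A decision problem whose instances are graded by a size parameter `n`, with a fixed way of
writing an instance into the memory of the RAM. -/
structure DecisionProblem where
  /-- the instances of size parameter `n` -/
  Inst : ℕ → Type
  /-- the contents of the memory at the start of the computation -/
  input : {n : ℕ} → Inst n → ℕ → ℕ
  /-- the yes-instances -/
  IsYes : {n : ℕ} → Inst n → Prop

/-- The initial configuration on the instance `x` of size `n`: the instance is in the memory,
register `0` holds `n`, and the other registers hold `0`. -/
def DecisionProblem.start (Q : DecisionProblem) {n : ℕ} (x : Q.Inst n) : Config where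
  pc := 0
  reg := fun a => if a = 0 then n else 0
  mem := Q.input x

/-- Register `0` of `c` holds the right answer (`1` for yes, `0` for no) on the instance `x`. -/
def DecisionProblem.Correct (Q : DecisionProblem) {n : ℕ} (x : Q.Inst n) (c : Config) : Prop :=
  (Q.IsYes x ∧ c.reg 0 = 1) ∨ (¬ Q.IsYes x ∧ c.reg 0 = 0)

/-- Program `P` solves `Q` in time `T` on a word RAM with words of `O(log n)` bits:
for some constant `b`, on every instance of size `n` and for all outcomes of the random bits,
all words in registers and memory are at most `(n + 2) ^ b` during the first `T n` steps and the
program halts within these steps; and the answer is right with probability at least `2 / 3`. -/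
def Program.Solves (P : Program) (Q : DecisionProblem) (T : ℕ → ℕ) : Prop :=
  ∃ b : ℕ, ∀ (n : ℕ) (x : Q.Inst n),
    (∀ coins : List Bool, coins.length ≤ T n → ∀ i : ℕ,
      (P.run (Q.start x) coins).reg i ≤ (n + 2) ^ b ∧
      (P.run (Q.start x) coins).mem i ≤ (n + 2) ^ b) ∧
    (∀ coins : List Bool, coins.length = T n → (P.run (Q.start x) coins).Halted P) ∧
    2 * 2 ^ T n ≤
      3 * {r : Fin (T n) → Bool | Q.Correct x (P.run (Q.start x) (List.ofFn r))}.ncard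

/-- Whether algorithms may toss coins. -/
inductive AlgMode
  | deterministic | randomized

/-- Deterministic programs contain no coin toss (so that a success probability of at least
`2 / 3` means that the answer is always right). -/
def Program.Allowed (P : Program) : AlgMode → Prop
  | .deterministic => ∀ a : ℕ, Instr.coin a ∉ P
  | .randomized => True

/-- Solving `Q` requires `f(n) ^ (1 - o(1))` time: for no constant `ε > 0` is there an algorithm
that solves `Q` in time `O(f(n) ^ (1 - ε))`. -/
def RequiresTime (mode : AlgMode) (Q : DecisionProblem) (f : ℕ → ℝ) : Prop :=
  ∀ ε : ℝ, 0 < ε → ¬ ∃ (P : Program) (T : ℕ → ℕ), P.Allowed mode ∧ P.Solves Q T ∧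
    (fun n => (T n : ℝ)) =O[Filter.atTop] (fun n => f n ^ (1 - ε))

/-! ### The exponents of matrix multiplication -/

/-- `StraightLine l`: the polynomials in `l` (latest first) are the results of a sequence of
`l.length` additions, subtractions and multiplications, each of which is applied to variables,
constants and earlier results. -/
inductive StraightLine (F : Type*) [Field F] {σ : Type*} : List (MvPolynomial σ F) → Prop
  | nil : StraightLine F []
  | gate {l : List (MvPolynomial σ F)} {f g h : MvPolynomial σ F} :
      StraightLine F l →
      (g ∈ l ∨ (∃ i, g = MvPolynomial.X i) ∨ ∃ c, g = MvPolynomial.C c) →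
      (h ∈ l ∨ (∃ i, h = MvPolynomial.X i) ∨ ∃ c, h = MvPolynomial.C c) →
      (f = g + h ∨ f = g - h ∨ f = g * h) →
      StraightLine F (f :: l)

/-- The product of an `a × b` matrix and a `b × c` matrix, both with indeterminate entries, can be
computed with at most `s` arithmetic operations over `F`. -/
def MatMulInOps (F : Type*) [Field F] (a b c s : ℕ) : Prop :=
  ∃ l : List (MvPolynomial ((Fin a × Fin b) ⊕ (Fin b × Fin c)) F),
    StraightLine F l ∧ l.length ≤ s ∧
    ∀ (i : Fin a) (j : Fin c),
      (∑ k : Fin b, MvPolynomial.X (Sum.inl (i, k)) * MvPolynomial.X (Sum.inr (k, j))) ∈ l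

/-- `ω(a, b, c)` over `F`, for natural numbers `a`, `b`, `c`: the least exponent such that the
product of an `n ^ a × n ^ b` matrix and an `n ^ b × n ^ c` matrix can be computed with
`n ^ (ω(a, b, c) + o(1))` arithmetic operations. -/
noncomputable def matMulExponent (F : Type*) [Field F] (a b c : ℕ) : ℝ :=
  sInf {τ : ℝ | ∃ K : ℝ, ∀ n : ℕ, 1 ≤ n →
    ∃ s : ℕ, (s : ℝ) ≤ K * (n : ℝ) ^ τ ∧ MatMulInOps F (n ^ a) (n ^ b) (n ^ c) s}

/-- `C(n, k) = n ^ ω(⌊k/3⌋, ⌈(k-1)/3⌉, ⌈k/3⌉)`. -/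
noncomputable def cliqueTime (F : Type*) [Field F] (n k : ℕ) : ℝ :=
  (n : ℝ) ^ matMulExponent F (k / 3) ((k - 1) ⌈/⌉ 3) (k ⌈/⌉ 3)

/-! ### The clique problem -/

open Classical in
/-- The row-major adjacency matrix of a relation on `Fin N`, as an array of zeros and ones. -/
noncomputable def matrixCells {N : ℕ} (r : Fin N → Fin N → Prop) (q : ℕ) : ℕ :=
  if ∃ u v : Fin N, q = u * N + v ∧ r u v then 1 else 0

/-- `k`-Clique: given a `k`-partite graph whose parts have `n` vertices each, does it contain `k`
mutually adjacent vertices? Vertex number `a` of part `i` has the index `i * n + a` in the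
adjacency matrix. -/
noncomputable def cliqueProblem (k : ℕ) : DecisionProblem where
  Inst n := {G : SimpleGraph (Fin k × Fin n) // ∀ u v, G.Adj u v → u.1 ≠ v.1}
  input G := matrixCells fun u v => G.1.Adj (finProdFinEquiv.symm u) (finProdFinEquiv.symm v)
  IsYes G := ∃ s : Finset _, G.1.IsNClique k s

/-- The `k`-Clique Hypothesis: for every constant `k ≥ 3`, solving `k`-Clique requires
`C(n, k) ^ (1 - o(1))` time. -/
def KCliqueHypothesis (F : Type*) [Field F] (mode : AlgMode) : Prop :=
  ∀ k : ℕ, 3 ≤ k → RequiresTime mode (cliqueProblem k) fun n => cliqueTime F n k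

/-! ### Disjoint paths in directed acyclic graphs -/

/-- An unweighted DAG on `n` vertices with `p` source and `p` target vertices. -/
structure DagInstance (p n : ℕ) where
  /-- the graph -/
  G : Digraph (Fin n)
  acyclic : ∀ v, ¬ Relation.TransGen G.Adj v v
  /-- the sources -/
  s : Fin p → Fin n
  /-- the targets -/
  t : Fin p → Fin n

/-- The list `l` of vertices is a path from `u` to `v` in `G`. (In an acyclic graph the vertices of
such a list are distinct.) -/
def IsDiPath {V : Type*} (G : Digraph V) (u v : V) (l : List V) : Prop :=
  l.IsChain G.Adj ∧ l.head? = some u ∧ l.getLast? = some v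

/-- The list `l` is a shortest path from `u` to `v` in the unweighted graph `G`. -/
def IsShortestDiPath {V : Type*} (G : Digraph V) (u v : V) (l : List V) : Prop :=
  IsDiPath G u v l ∧ ∀ l', IsDiPath G u v l' → l.length ≤ l'.length

/-- The paths `L i`, from `s i` to `t i`, are internally vertex-disjoint: a vertex that lies on two
of them is an end vertex of both. -/
def InternallyDisjoint {V : Type*} {p : ℕ} (s t : Fin p → V) (L : Fin p → List V) : Prop :=
  ∀ i j, i ≠ j → ∀ v, v ∈ L i → v ∈ L j → (v = s i ∨ v = t i) ∧ (v = s j ∨ v = t j)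

/-- The memory contents for an instance: `p` sources, `p` targets, and the adjacency matrix. -/
noncomputable def DagInstance.cells {p n : ℕ} (x : DagInstance p n) (q : ℕ) : ℕ :=
  if h : q < p then x.s ⟨q, h⟩
  else if h : q - p < p then x.t ⟨q - p, h⟩
  else matrixCells x.G.Adj (q - 2 * p)

/-- `p`-DP on unweighted DAGs: are there internally vertex-disjoint `(sᵢ, tᵢ)`-paths? -/
noncomputable def disjointPathsProblem (p : ℕ) : DecisionProblem where
  Inst n := DagInstance p n
  input x := x.cells
  IsYes x := ∃ L : Fin p → List _,
    (∀ i, IsDiPath x.G (x.s i) (x.t i) (L i)) ∧ InternallyDisjoint x.s x.t L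

/-- `p`-DSP on unweighted DAGs: are there internally vertex-disjoint `(sᵢ, tᵢ)`-shortest paths? -/
noncomputable def disjointShortestPathsProblem (p : ℕ) : DecisionProblem where
  Inst n := DagInstance p n
  input x := x.cells
  IsYes x := ∃ L : Fin p → List _,
    (∀ i, IsShortestDiPath x.G (x.s i) (x.t i) (L i)) ∧ InternallyDisjoint x.s x.t L

/-! ### The two parameters -/

/-- `2 ⌊√(p + 1)⌋ - 2` -/
noncomputable def kEven (p : ℕ) : ℕ := 2 * ⌊√((p : ℝ) + 1)⌋₊ - 2

/-- `2 ⌊(√(4 p + 5) - 1) / 2⌋ - 1` -/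
noncomputable def kOdd (p : ℕ) : ℕ := 2 * ⌊(√(4 * (p : ℝ) + 5) - 1) / 2⌋₊ - 1

-- The proof turns an instance of `k`-Clique into one of the `p`-path problems on only O(n)
-- vertices, whenever k + ⌊k²/4⌋ ≤ p.
--
-- Rows: part i of the clique graph becomes a row of two parallel tracks, `fwd i` and `bwd i`, cut
-- into n blocks of constant length `blockLen k`, one for each vertex of the part. The path of the
-- row follows the first track, changes once to the second and follows that to its end; the change
-- may skip one whole block. Skipping block a leaves this block free on both tracks and stands for
-- choosing vertex a.
--
-- Checks: a pair i < j has a difference d = j - i and a residue r = i mod d. One path, the check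
-- with label d * k + r, tests all consecutive pairs of the progression r, r + d, r + 2d, ... The
-- progressions with at least two terms are those with r < min d (k - d), and there are ⌊k²/4⌋ of
-- them (`sum_min_sub`); surplus paths are idle. In each skipped block the check uses the position
-- of its own label: it crosses from `fwd` to `bwd` there and hops to row i + d along an edge that
-- exists only if the two vertices are adjacent. Different labels keep the checks apart. Conversely,
-- a check that avoids the row paths is confined to the skipped blocks, where the label can only
-- grow; since it starts and ends with its own label, it never changes it (`check_path`), so the
-- chosen vertices form a clique (`exists_clique_of_disjoint`).
--
-- Shortest paths: the paths obtained from a clique are shortest. A row path can save at most one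
-- block (`row_path`), and a check that leaves its label needs at least `blockLen k` track steps to
-- return to it (`check_length`). So a clique gives disjoint shortest paths, these are disjoint
-- paths, and disjoint paths give a clique; one graph serves both problems.
--
-- Running time: writing down the instance would take quadratic time, which may exceed the assumed
-- bound. But each of its memory cells results from O(1) word operations on the clique instance
-- (`isLocal_reductionDag_cells`), so the given algorithm can be simulated with its input computed
-- on demand, at the cost of a constant factor (`exists_solves_of_isLocal`).
--
-- Exponents: the maximum of two powers of n is one of them, so a single k suffices. The hypothesis
-- needs k ≥ 3; the only exception, `kEven p = 2`, is covered by ω(0,1,1) ≤ ω(1,1,1).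

/-! ### Local expressions -/

/-- Expressions that can be evaluated by branch-free code: they have access to the size parameter,
to one argument, and to the memory. -/
inductive LocalExpr
  | const (v : ℕ)
  | size
  | arg
  | op (o : WordOp) (e f : LocalExpr)
  | load (e : LocalExpr)

/-- The value of an expression. -/
def LocalExpr.eval (mem : ℕ → ℕ) (n x : ℕ) : LocalExpr → ℕ
  | .const v => v
  | .size => n
  | .arg => x
  | .op o e f => o.eval (e.eval mem n x) (f.eval mem n x)
  | .load e => mem (e.eval mem n x)

/-- The largest value of a subexpression. -/
def LocalExpr.peak (mem : ℕ → ℕ) (n x : ℕ) : LocalExpr → ℕ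
  | .const v => v
  | .size => n
  | .arg => x
  | .op o e f => max (o.eval (e.eval mem n x) (f.eval mem n x))
      (max (e.peak mem n x) (f.peak mem n x))
  | .load e => max (mem (e.eval mem n x)) (e.peak mem n x)

/-- All operations of the expression have polynomially bounded results. -/
def LocalExpr.Tame : LocalExpr → Prop
  | .op o e f => (∀ x y, o.eval x y ≤ (x + 1) * (y + 1)) ∧ e.Tame ∧ f.Tame
  | .load e => e.Tame
  | _ => True

theorem LocalExpr.eval_le_peak (e : LocalExpr) (mem : ℕ → ℕ) (n x : ℕ) :
    e.eval mem n x ≤ e.peak mem n x := by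
  cases e <;> simp [LocalExpr.eval, LocalExpr.peak]

/-- Bounds of the form (n + 2)^β are closed under tame operations, since adding 1 to such a power
costs at most 1 in the exponent. This keeps on-demand evaluation within words of O(log n) bits. -/
theorem LocalExpr.exists_peak_le (e : LocalExpr) (he : e.Tame) (b : ℕ) :
    ∃ β, ∀ (mem : ℕ → ℕ) (n x : ℕ), (∀ q, mem q ≤ (n + 2) ^ b) → x ≤ (n + 2) ^ b →
      e.peak mem n x ≤ (n + 2) ^ β := by
  induction e with
  | const v =>
    -- The exponent is the constant itself, because v < 2^v.
    refine ⟨v, fun mem n x _ _ => ?_⟩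
    exact (Nat.lt_two_pow_self.le).trans (Nat.pow_le_pow_left (by omega) v)
  | size => exact ⟨1, fun mem n x _ _ => by simp [LocalExpr.peak]⟩
  | arg => exact ⟨b, fun mem n x _ hx => hx⟩
  | op o e f ihe ihf =>
    obtain ⟨ho, h1, h2⟩ := he
    obtain ⟨β, hβ⟩ := ihe h1
    obtain ⟨γ, hγ⟩ := ihf h2
    refine ⟨(β + 1) + (γ + 1), fun mem n x hm hx => ?_⟩
    have a1 := hβ mem n x hm hx
    have a2 := hγ mem n x hm hx
    have b1 := e.eval_le_peak mem n x
    have b2 := f.eval_le_peak mem n x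
    have mono : ∀ {i j : ℕ}, i ≤ j → (n + 2) ^ i ≤ (n + 2) ^ j := fun h =>
      Nat.pow_le_pow_right (by omega) h
    have succ : ∀ i : ℕ, (n + 2) ^ i + 1 ≤ (n + 2) ^ (i + 1) := fun i => by
      have : 1 ≤ (n + 2) ^ i := Nat.one_le_pow _ _ (by omega)
      rw [pow_succ]; nlinarith
    simp only [LocalExpr.peak, max_le_iff]
    refine ⟨(ho _ _).trans ?_, a1.trans (mono (by omega)), a2.trans (mono (by omega))⟩
    rw [pow_add]
    exact Nat.mul_le_mul ((by omega : _ ≤ (n + 2) ^ β + 1).trans (succ β))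
      ((by omega : _ ≤ (n + 2) ^ γ + 1).trans (succ γ))
  | load e ih =>
    obtain ⟨β, hβ⟩ := ih he
    refine ⟨β + b, fun mem n x hm hx => ?_⟩
    simp only [LocalExpr.peak, max_le_iff]
    exact ⟨(hm _).trans (Nat.pow_le_pow_right (by omega) (by omega)),
      (hβ mem n x hm hx).trans (Nat.pow_le_pow_right (by omega) (by omega))⟩

/-- Code that computes the value of the expression in register `dst`, using registers `≥ dst` only;
`rn` and `rx` hold the size parameter and the argument. -/
def LocalExpr.compile (rn rx : ℕ) : LocalExpr → ℕ → List Instr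
  | .const v, dst => [.const dst v]
  | .size, dst => [.const dst 0, .op .add dst rn dst]
  | .arg, dst => [.const dst 0, .op .add dst rx dst]
  | .op o e f, dst =>
      e.compile rn rx dst ++ (f.compile rn rx (dst + 1) ++ [.op o dst dst (dst + 1)])
  | .load e, dst => e.compile rn rx dst ++ [.load dst dst]

theorem LocalExpr.coin_notMem_compile (rn rx : ℕ) (e : LocalExpr) (dst a : ℕ) :
    Instr.coin a ∉ e.compile rn rx dst := by
  induction e generalizing dst <;> simp_all [LocalExpr.compile]

theorem LocalExpr.length_compile (rn rx rx' : ℕ) (e : LocalExpr) (dst : ℕ) :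
    (e.compile rn rx dst).length = (e.compile rn rx' dst).length := by
  induction e generalizing dst <;> simp_all [LocalExpr.compile]

/-- The function is the value of a tame expression. -/
def IsLocal (f : (ℕ → ℕ) → ℕ → ℕ → ℕ) : Prop :=
  ∃ e : LocalExpr, e.Tame ∧ ∀ mem n x, e.eval mem n x = f mem n x

namespace IsLocal

variable {f g h : (ℕ → ℕ) → ℕ → ℕ → ℕ}

theorem const (v : ℕ) : IsLocal fun _ _ _ => v := ⟨.const v, trivial, fun _ _ _ => rfl⟩

theorem size : IsLocal fun _ n _ => n := ⟨.size, trivial, fun _ _ _ => rfl⟩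

theorem arg : IsLocal fun _ _ x => x := ⟨.arg, trivial, fun _ _ _ => rfl⟩

theorem op {o : WordOp} (ho : ∀ x y, o.eval x y ≤ (x + 1) * (y + 1)) (hf : IsLocal f)
    (hg : IsLocal g) : IsLocal fun mem n x => o.eval (f mem n x) (g mem n x) := by
  obtain ⟨e, he, h⟩ := hf
  obtain ⟨e', he', h'⟩ := hg
  exact ⟨.op o e e', ⟨ho, he, he'⟩, fun mem n x => by simp [LocalExpr.eval, h, h']⟩

theorem load (hf : IsLocal f) : IsLocal fun mem n x => mem (f mem n x) := by
  obtain ⟨e, he, h⟩ := hf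
  exact ⟨.load e, he, fun mem n x => by simp [LocalExpr.eval, h]⟩

theorem add (hf : IsLocal f) (hg : IsLocal g) : IsLocal fun mem n x => f mem n x + g mem n x :=
  op (o := .add) (fun x y => by simp only [WordOp.eval]; nlinarith [Nat.zero_le (x * y)]) hf hg

theorem sub (hf : IsLocal f) (hg : IsLocal g) : IsLocal fun mem n x => f mem n x - g mem n x :=
  op (o := .sub) (fun x y => by
    simp only [WordOp.eval]; nlinarith [Nat.zero_le (x * y), Nat.sub_le x y]) hf hg

theorem mul (hf : IsLocal f) (hg : IsLocal g) : IsLocal fun mem n x => f mem n x * g mem n x :=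
  op (o := .mul) (fun x y => by simp only [WordOp.eval]; nlinarith) hf hg

theorem div (hf : IsLocal f) (hg : IsLocal g) : IsLocal fun mem n x => f mem n x / g mem n x :=
  op (o := .div) (fun x y => by
    simp only [WordOp.eval]; nlinarith [Nat.zero_le (x * y), Nat.div_le_self x y]) hf hg

theorem mod (hf : IsLocal f) (hg : IsLocal g) : IsLocal fun mem n x => f mem n x % g mem n x :=
  op (o := .mod) (fun x y => by
    simp only [WordOp.eval]; nlinarith [Nat.zero_le (x * y), Nat.mod_le x y]) hf hg

theorem congr (hf : IsLocal f) (hfg : ∀ mem n x, f mem n x = g mem n x) : IsLocal g := by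
  obtain ⟨e, he, h⟩ := hf
  exact ⟨e, he, fun mem n x => (h mem n x).trans (hfg mem n x)⟩

end IsLocal

open Classical in
/-- The indicator function of the predicate is local. -/
def IsLocalPred (R : (ℕ → ℕ) → ℕ → ℕ → Prop) : Prop :=
  IsLocal fun mem n x => if R mem n x then 1 else 0

namespace IsLocalPred

variable {f g : (ℕ → ℕ) → ℕ → ℕ → ℕ} {R S : (ℕ → ℕ) → ℕ → ℕ → Prop}

theorem congr (hR : IsLocalPred R) (h : ∀ mem n x, R mem n x ↔ S mem n x) : IsLocalPred S :=
  IsLocal.congr hR fun mem n x => by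
    have := h mem n x
    by_cases h1 : R mem n x <;> simp_all

/-- Subtraction is truncated, so (f - g) + (g - f) vanishes exactly when f = g; subtracting from 1
turns this into an indicator. -/
theorem eq (hf : IsLocal f) (hg : IsLocal g) : IsLocalPred fun mem n x => f mem n x = g mem n x :=
  ((IsLocal.const 1).sub ((hf.sub hg).add (hg.sub hf))).congr fun mem n x => by
    split_ifs <;> omega

theorem lt (hf : IsLocal f) (hg : IsLocal g) : IsLocalPred fun mem n x => f mem n x < g mem n x :=
  ((IsLocal.const 1).sub ((IsLocal.const 1).sub (hg.sub hf))).congr fun mem n x => by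
    split_ifs <;> omega

theorem and (hR : IsLocalPred R) (hS : IsLocalPred S) :
    IsLocalPred fun mem n x => R mem n x ∧ S mem n x :=
  (IsLocal.mul hR hS).congr fun mem n x => by
    by_cases h1 : R mem n x <;> by_cases h2 : S mem n x <;> simp [h1, h2]

theorem not (hR : IsLocalPred R) : IsLocalPred fun mem n x => ¬ R mem n x :=
  ((IsLocal.const 1).sub hR).congr fun mem n x => by
    by_cases h1 : R mem n x <;> simp [h1]

theorem or (hR : IsLocalPred R) (hS : IsLocalPred S) :
    IsLocalPred fun mem n x => R mem n x ∨ S mem n x :=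
  (hR.not.and hS.not).not.congr fun mem n x => by tauto

theorem le (hf : IsLocal f) (hg : IsLocal g) : IsLocalPred fun mem n x => f mem n x ≤ g mem n x :=
  (lt hg hf).not.congr fun mem n x => by simp

end IsLocalPred

/-- Selection without branching: both alternatives are computed and weighted by complementary
indicators. -/
theorem IsLocal.ite {f g : (ℕ → ℕ) → ℕ → ℕ → ℕ} {R : (ℕ → ℕ) → ℕ → ℕ → Prop}
    [∀ mem n x, Decidable (R mem n x)] (hR : IsLocalPred R) (hf : IsLocal f) (hg : IsLocal g) :
    IsLocal fun mem n x => if R mem n x then f mem n x else g mem n x :=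
  ((IsLocal.mul hR hf).add (IsLocal.mul hR.not hg)).congr fun mem n x => by
    by_cases h1 : R mem n x <;> simp [h1]

/-! ### Running code -/

/-- All words are at most `K`. -/
def Config.Bounded (K : ℕ) (c : Config) : Prop := ∀ i, c.reg i ≤ K ∧ c.mem i ≤ K

/-- For the next `l` steps from `c` all words are at most `K`, and the configuration reached then
satisfies `Φ`. -/
def Program.Runs (P : Program) (K : ℕ) (c : Config) (l : ℕ) (Φ : Config → Prop) : Prop :=
  (∀ coins : List Bool, coins.length ≤ l → (P.run c coins).Bounded K) ∧
  ∀ coins : List Bool, coins.length = l → Φ (P.run c coins)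

theorem Program.run_append (P : Program) (c : Config) (l l' : List Bool) :
    P.run c (l ++ l') = P.run (P.run c l) l' := List.foldl_append

namespace Program.Runs

variable {P : Program} {K : ℕ} {c : Config} {l l' : ℕ} {Φ Ψ : Config → Prop}

theorem append (h : P.Runs K c l Φ) (h' : ∀ c', Φ c' → c'.Bounded K → P.Runs K c' l' Ψ) :
    P.Runs K c (l + l') Ψ := by
  have key : ∀ coins : List Bool, l ≤ coins.length →
      P.run c coins = P.run (P.run c (coins.take l)) (coins.drop l) ∧
      P.Runs K (P.run c (coins.take l)) l' Ψ := fun coins hl => by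
    refine ⟨by rw [← Program.run_append, List.take_append_drop], ?_⟩
    have hlen : (coins.take l).length = l := by simp [hl]
    exact h' _ (h.2 _ hlen) (h.1 _ hlen.le)
  refine ⟨fun coins hc => ?_, fun coins hc => ?_⟩
  · rcases le_total coins.length l with hl | hl
    · exact h.1 coins hl
    · rw [(key coins hl).1]
      exact (key coins hl).2.1 _ (by simp; omega)
  · rw [(key coins (by omega)).1]
    exact (key coins (by omega)).2.2 _ (by simp; omega)

theorem step (hc : c.Bounded K) (h : ∀ b, (P.step c b).Bounded K ∧ Φ (P.step c b)) :
    P.Runs K c 1 Φ := by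
  refine ⟨fun coins hl => ?_, fun coins hl => ?_⟩
  · match coins, hl with
    | [], _ => exact hc
    | [b], _ => exact (h b).1
  · obtain ⟨b, rfl⟩ := List.length_eq_one_iff.1 hl
    exact (h b).2

theorem mono (h : P.Runs K c l Φ) (h' : ∀ c', Φ c' → Ψ c') : P.Runs K c l Ψ :=
  ⟨h.1, fun coins hl => h' _ (h.2 coins hl)⟩

theorem zero (hc : c.Bounded K) (h : Φ c) : P.Runs K c 0 Φ := by
  refine ⟨fun coins hl => ?_, fun coins hl => ?_⟩
  · obtain rfl : coins = [] := List.length_eq_zero_iff.1 (by omega)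
    exact hc
  · obtain rfl : coins = [] := List.length_eq_zero_iff.1 hl
    exact h

end Program.Runs

/-- The instructions `code` stand in `P` from number `pc` on. -/
def CodeAt (P : Program) (pc : ℕ) (code : List Instr) : Prop :=
  ∃ A B, P = A ++ code ++ B ∧ A.length = pc

namespace CodeAt

variable {P : Program} {pc : ℕ} {u v : List Instr} {i : Instr}

theorem left (h : CodeAt P pc (u ++ v)) : CodeAt P pc u := by
  obtain ⟨A, B, rfl, rfl⟩ := h
  exact ⟨A, v ++ B, by simp, rfl⟩

theorem right (h : CodeAt P pc (u ++ v)) : CodeAt P (pc + u.length) v := by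
  obtain ⟨A, B, rfl, rfl⟩ := h
  exact ⟨A ++ u, B, by simp, by simp⟩

theorem head (h : CodeAt P pc (i :: u)) : P[pc]? = some i := by
  obtain ⟨A, B, rfl, rfl⟩ := h
  simp

theorem tail (h : CodeAt P pc (i :: u)) : CodeAt P (pc + 1) u :=
  right (u := [i]) h

end CodeAt

theorem Config.Bounded.update_reg {K : ℕ} {c : Config} (hc : c.Bounded K) (pc a : ℕ) {v : ℕ}
    (hv : v ≤ K) : Config.Bounded K ⟨pc, Function.update c.reg a v, c.mem⟩ := fun i => by
  refine ⟨?_, (hc i).2⟩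
  by_cases h : i = a
  · subst h; simpa using hv
  · simpa [h] using (hc i).1

theorem Config.Bounded.update_mem {K : ℕ} {c : Config} (hc : c.Bounded K) (pc a : ℕ) {v : ℕ}
    (hv : v ≤ K) : Config.Bounded K ⟨pc, c.reg, Function.update c.mem a v⟩ := fun i => by
  refine ⟨(hc i).1, ?_⟩
  by_cases h : i = a
  · subst h; simpa using hv
  · simpa [h] using (hc i).2

namespace Program

variable {P : Program} {K : ℕ} {c : Config}

theorem runs_const {a v : ℕ} (h : P[c.pc]? = some (.const a v)) (hc : c.Bounded K) (hv : v ≤ K) :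
    P.Runs K c 1 (fun c' => c' = ⟨c.pc + 1, Function.update c.reg a v, c.mem⟩) :=
  Runs.step hc fun b => by
    have : P.step c b = ⟨c.pc + 1, Function.update c.reg a v, c.mem⟩ := by
      simp [Program.step, h]
    rw [this]
    exact ⟨hc.update_reg _ _ hv, rfl⟩

theorem runs_op {o : WordOp} {a x y : ℕ} (h : P[c.pc]? = some (.op o a x y)) (hc : c.Bounded K)
    (hv : o.eval (c.reg x) (c.reg y) ≤ K) :
    P.Runs K c 1 (fun c' =>
      c' = ⟨c.pc + 1, Function.update c.reg a (o.eval (c.reg x) (c.reg y)), c.mem⟩) :=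
  Runs.step hc fun b => by
    have : P.step c b =
        ⟨c.pc + 1, Function.update c.reg a (o.eval (c.reg x) (c.reg y)), c.mem⟩ := by
      simp [Program.step, h]
    rw [this]
    exact ⟨hc.update_reg _ _ hv, rfl⟩

theorem runs_load {a x : ℕ} (h : P[c.pc]? = some (.load a x)) (hc : c.Bounded K) :
    P.Runs K c 1 (fun c' =>
      c' = ⟨c.pc + 1, Function.update c.reg a (c.mem (c.reg x)), c.mem⟩) :=
  Runs.step hc fun b => by
    have : P.step c b = ⟨c.pc + 1, Function.update c.reg a (c.mem (c.reg x)), c.mem⟩ := by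
      simp [Program.step, h]
    rw [this]
    exact ⟨hc.update_reg _ _ (hc _).2, rfl⟩

theorem runs_store {a x : ℕ} (h : P[c.pc]? = some (.store a x)) (hc : c.Bounded K) :
    P.Runs K c 1 (fun c' =>
      c' = ⟨c.pc + 1, c.reg, Function.update c.mem (c.reg a) (c.reg x)⟩) :=
  Runs.step hc fun b => by
    have : P.step c b = ⟨c.pc + 1, c.reg, Function.update c.mem (c.reg a) (c.reg x)⟩ := by
      simp [Program.step, h]
    rw [this]
    exact ⟨hc.update_mem _ _ (hc _).1, rfl⟩

/-- Copying register `x` into register `a`. -/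
theorem runs_move {a x : ℕ} (h : CodeAt P c.pc [.const a 0, .op .add a x a]) (hax : x ≠ a)
    (hc : c.Bounded K) :
    P.Runs K c 2 (fun c' => c' = ⟨c.pc + 2, Function.update c.reg a (c.reg x), c.mem⟩) := by
  refine (runs_const h.head hc (Nat.zero_le _)).append (l' := 1) ?_
  rintro _ rfl hb
  refine (runs_op (o := .add) (a := a) (x := x) (y := a) h.tail.head hb ?_).mono ?_
  · simpa [WordOp.eval, hax] using (hc x).1
  · rintro _ rfl
    simp [WordOp.eval, hax]

/-- The registers below `dst` survive. This lets the first operand wait in `dst` while the second is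
computed from `dst + 1` on. -/
theorem runs_compile {rn rx : ℕ} (e : LocalExpr) (dst : ℕ) (hn : rn < dst) (hx : rx < dst)
    (c : Config) (h : CodeAt P c.pc (e.compile rn rx dst)) (hc : c.Bounded K)
    (hK : e.peak c.mem (c.reg rn) (c.reg rx) ≤ K) :
    P.Runs K c (e.compile rn rx dst).length (fun c' =>
      c'.pc = c.pc + (e.compile rn rx dst).length ∧ c'.mem = c.mem ∧
      c'.reg dst = e.eval c.mem (c.reg rn) (c.reg rx) ∧ ∀ a < dst, c'.reg a = c.reg a) := by
  induction e generalizing dst c with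
  | const v =>
    refine (runs_const h.head hc hK).mono ?_
    rintro _ rfl
    refine ⟨rfl, rfl, by simp [LocalExpr.eval], fun a ha => ?_⟩
    simp [ha.ne]
  | size =>
    refine (runs_move h hn.ne hc).mono ?_
    rintro _ rfl
    refine ⟨rfl, rfl, by simp [LocalExpr.eval], fun a ha => ?_⟩
    simp [ha.ne]
  | arg =>
    refine (runs_move h hx.ne hc).mono ?_
    rintro _ rfl
    refine ⟨rfl, rfl, by simp [LocalExpr.eval], fun a ha => ?_⟩
    simp [ha.ne]
  | op o e f ihe ihf =>
    simp only [LocalExpr.peak, max_le_iff] at hK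
    simp only [LocalExpr.compile] at h ⊢
    rw [List.length_append]
    refine (ihe dst hn hx c h.left hc hK.2.1).append ?_
    rintro c₁ ⟨hpc₁, hm₁, hd₁, hr₁⟩ hb₁
    rw [List.length_append]
    have h' := h.right
    rw [← hpc₁] at h'
    refine (ihf (dst + 1) (by omega) (by omega) c₁ h'.left hb₁ ?_).append ?_
    · rw [hm₁, hr₁ _ hn, hr₁ _ hx]; exact hK.2.2
    rintro c₂ ⟨hpc₂, hm₂, hd₂, hr₂⟩ hb₂
    have h'' := h'.right
    rw [← hpc₂] at h''
    rw [hm₁, hr₁ _ hn, hr₁ _ hx] at hd₂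
    have hd₂' : c₂.reg dst = e.eval c.mem (c.reg rn) (c.reg rx) := by
      rw [hr₂ dst (by omega), hd₁]
    refine (runs_op h''.head hb₂ ?_).mono ?_
    · rw [hd₂, hd₂']; exact hK.1
    · rintro _ rfl
      refine ⟨by simp [hpc₂, hpc₁]; omega, by simp [hm₂, hm₁],
        by simp [hd₂, hd₂', LocalExpr.eval], fun a ha => ?_⟩
      simp [ha.ne, hr₂ a (by omega), hr₁ a ha]
  | load e ih =>
    simp only [LocalExpr.peak, max_le_iff] at hK
    simp only [LocalExpr.compile] at h ⊢
    rw [List.length_append]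
    refine (ih dst hn hx c h.left hc hK.2).append ?_
    rintro c₁ ⟨hpc₁, hm₁, hd₁, hr₁⟩ hb₁
    have h' := h.right
    rw [← hpc₁] at h'
    refine (runs_load h'.head hb₁).mono ?_
    rintro _ rfl
    refine ⟨by simp [hpc₁]; omega, by simp [hm₁], by simp [hd₁, hm₁, LocalExpr.eval],
      fun a ha => ?_⟩
    simp [ha.ne, hr₁ a ha]

end Program

/-! ### Simulating a program on an input that is computed on demand -/

/-- All registers of the instruction have numbers below `m`. -/
def Instr.RegsBelow (m : ℕ) : Instr → Prop
  | .const a _ => a < m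
  | .op _ a b c => a < m ∧ b < m ∧ c < m
  | .load a b => a < m ∧ b < m
  | .store a b => a < m ∧ b < m
  | .jumpIfZero a _ => a < m
  | .coin a => a < m

theorem Instr.RegsBelow.mono {m m' : ℕ} (h : m ≤ m') {i : Instr} (hi : i.RegsBelow m) :
    i.RegsBelow m' := by
  cases i <;> simp only [Instr.RegsBelow] at hi ⊢ <;> omega

/-- A program mentions finitely many registers, so those from some `m` on are free as working space
of the simulation. -/
theorem Program.exists_regsBelow (P : Program) : ∃ m, 1 ≤ m ∧ ∀ i ∈ P, i.RegsBelow m := by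
  induction P with
  | nil => exact ⟨1, le_rfl, by simp⟩
  | cons i P ih =>
    obtain ⟨m, hm, h⟩ := ih
    obtain ⟨m', h'⟩ : ∃ m', i.RegsBelow m' := by
      cases i with
      | const a v => exact ⟨a + 1, Nat.lt_succ_self a⟩
      | op o a b c => exact ⟨a + b + c + 1, by simp only [Instr.RegsBelow]; omega⟩
      | load a b => exact ⟨a + b + 1, by simp only [Instr.RegsBelow]; omega⟩
      | store a b => exact ⟨a + b + 1, by simp only [Instr.RegsBelow]; omega⟩
      | jumpIfZero a l => exact ⟨a + 1, Nat.lt_succ_self a⟩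
      | coin a => exact ⟨a + 1, Nat.lt_succ_self a⟩
    refine ⟨max m m', by omega, fun j hj => ?_⟩
    rcases List.mem_cons.1 hj with rfl | hj
    · exact h'.mono (le_max_right _ _)
    · exact (h j hj).mono (le_max_left _ _)

/-- The branch-free part of the simulation of an instruction: register `m` holds the size parameter,
`el` computes the contents of a virtual memory cell, and `ea` its address. -/
def lazyBody (m : ℕ) (el ea : LocalExpr) : Instr → List Instr
  | .const a v => [.const a v]
  | .op o a b c => [.op o a b c]
  | .load a b => el.compile m b (m + 1) ++ [.const a 0, .op .add a (m + 1) a]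
  | .store a b => ea.compile m a (m + 1) ++ [.store (m + 1) b, .const (m + 2) 1,
      .op .add (m + 1) (m + 1) (m + 2), .store (m + 1) (m + 2)]
  | .jumpIfZero _ _ => []
  | .coin _ => []

/-- The length to which branch-free parts are padded. -/
def lazyBodyLength (m : ℕ) (el ea : LocalExpr) : ℕ :=
  -- The summand 4 accounts for the four instructions that a simulated `store` appends to the
  -- address computation.
  (el.compile m 0 (m + 1)).length + (ea.compile m 0 (m + 1)).length + 4

theorem length_lazyBody_le (m : ℕ) (el ea : LocalExpr) (i : Instr) :
    (lazyBody m el ea i).length ≤ lazyBodyLength m el ea := by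
  cases i <;> simp [lazyBody, lazyBodyLength]
  · rw [LocalExpr.length_compile m _ 0]; omega
  · rw [LocalExpr.length_compile m _ 0 ea]; omega

/-- The first instruction of the simulation of an instruction. -/
def lazyHead (m : ℕ) : Instr → Instr
  | .coin a => .coin a
  | _ => .const (m + 1) 0

/-- The last instruction of the simulation of an instruction. -/
def lazyTail (m start len : ℕ) : Instr → Instr
  | .jumpIfZero a l => .jumpIfZero a (start + len * l)
  | _ => .const (m + 1) 0

/-- The simulation of an instruction. -/
def lazyBlock (m start : ℕ) (el ea : LocalExpr) (i : Instr) : List Instr :=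
  lazyHead m i :: (lazyBody m el ea i ++
    (List.replicate (lazyBodyLength m el ea - (lazyBody m el ea i).length) (.const (m + 1) 0) ++
      [lazyTail m start (lazyBodyLength m el ea + 2) i]))

theorem length_lazyBlock (m start : ℕ) (el ea : LocalExpr) (i : Instr) :
    (lazyBlock m start el ea i).length = lazyBodyLength m el ea + 2 := by
  have := length_lazyBody_le m el ea i
  simp [lazyBlock]
  omega

/-- The start of the simulation: register `m` receives the size parameter, register `0` the size
parameter of the virtual instance. -/
def lazyPreamble (m : ℕ) (eN : LocalExpr) : List Instr :=
  [.const m 0, .op .add m 0 m] ++ (eN.compile m m (m + 1) ++ [.const 0 0, .op .add 0 (m + 1) 0])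

/-- The simulation of a program. -/
def lazyProgram (m : ℕ) (eN el ea : LocalExpr) (P : Program) : Program :=
  lazyPreamble m eN ++ P.flatMap (lazyBlock m (lazyPreamble m eN).length el ea)

theorem length_flatMap_of_const {α β : Type*} (f : α → List β) (len : ℕ)
    (hf : ∀ x, (f x).length = len) (l : List α) : (l.flatMap f).length = len * l.length := by
  induction l with
  | nil => simp
  | cons x l ih => simp [ih, hf, mul_add]; ring

theorem codeAt_lazyProgram {m : ℕ} {eN el ea : LocalExpr} {P : Program} {pc : ℕ} {i : Instr}
    (h : P[pc]? = some i) :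
    CodeAt (lazyProgram m eN el ea P)
      ((lazyPreamble m eN).length + (lazyBodyLength m el ea + 2) * pc)
      (lazyBlock m (lazyPreamble m eN).length el ea i) := by
  obtain ⟨hpc, rfl⟩ := List.getElem?_eq_some_iff.1 h
  refine ⟨lazyPreamble m eN ++ (P.take pc).flatMap (lazyBlock m (lazyPreamble m eN).length el ea),
    (P.drop (pc + 1)).flatMap (lazyBlock m (lazyPreamble m eN).length el ea), ?_, ?_⟩
  · have : P = P.take pc ++ P[pc] :: P.drop (pc + 1) := by simp
    have key : P.flatMap (lazyBlock m (lazyPreamble m eN).length el ea) = _ :=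
      congrArg (List.flatMap (lazyBlock m (lazyPreamble m eN).length el ea)) this
    rw [List.flatMap_append, List.flatMap_cons] at key
    rw [lazyProgram, key]
    simp only [List.append_assoc]
  · rw [List.length_append, length_flatMap_of_const _ _ (length_lazyBlock m _ el ea)]
    simp [hpc.le]

theorem length_lazyProgram (m : ℕ) (eN el ea : LocalExpr) (P : Program) :
    (lazyProgram m eN el ea P).length =
      (lazyPreamble m eN).length + (lazyBodyLength m el ea + 2) * P.length := by
  rw [lazyProgram, List.length_append, length_flatMap_of_const _ _ (length_lazyBlock m _ el ea)]

theorem coin_notMem_lazyProgram {m : ℕ} {eN el ea : LocalExpr} {P : Program} {a : ℕ}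
    (h : Instr.coin a ∉ P) : Instr.coin a ∉ lazyProgram m eN el ea P := by
  intro hmem
  simp only [lazyProgram, lazyPreamble, List.mem_append, List.mem_flatMap, lazyBlock,
    List.mem_cons, List.mem_replicate] at hmem
  have hc := fun e rx dst => LocalExpr.coin_notMem_compile m rx e dst a
  rcases hmem with (h1 | h1 | h1) | ⟨i, hi, h1⟩
  · simp at h1
  · exact hc _ _ _ h1
  · simp at h1
  · cases i <;> simp [lazyHead, lazyTail, lazyBody, hc] at h1
    subst h1
    exact h hi

-- The invariant of the simulation

/-- The registers and the memory of `c` represent those of the virtual configuration `v`. -/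
structure Mirror (m n off V : ℕ) (inp inp' : ℕ → ℕ) (v c : Config) : Prop where
  reg : ∀ a < m, c.reg a = v.reg a
  size : c.reg m = n
  input : ∀ q < off, c.mem q = inp q
  -- Virtual cell x owns two real cells beyond the input: a value, and a flag telling whether the
  -- cell has been written. An unwritten cell still has its initial contents, which are recomputed
  -- at each access.
  virt : ∀ x, (c.mem (off + 2 * x + 1) = 0 ∧ v.mem x = inp' x) ∨
    (c.mem (off + 2 * x + 1) = 1 ∧ v.mem x = c.mem (off + 2 * x))
  mem_le : ∀ q, c.mem q ≤ V

/-- The expressions `el` and `ea` compute contents and address of virtual memory cells, with values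
at most `K` as long as the memory is bounded by `V`. -/
structure LazyAccess (n off V K : ℕ) (inp inp' : ℕ → ℕ) (el ea : LocalExpr) : Prop where
  one_le : 1 ≤ V
  le : V ≤ K
  eval_el : ∀ mem : ℕ → ℕ, (∀ q < off, mem q = inp q) → ∀ x,
    el.eval mem n x = if mem (off + 2 * x + 1) = 0 then inp' x else mem (off + 2 * x)
  eval_ea : ∀ mem x, ea.eval mem n x = off + 2 * x
  peak_el : ∀ mem x, (∀ q, mem q ≤ V) → x ≤ V → el.peak mem n x ≤ K
  peak_ea : ∀ mem x, (∀ q, mem q ≤ V) → x ≤ V → ea.peak mem n x + 1 ≤ K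

section

variable {m n off V K : ℕ} {inp inp' : ℕ → ℕ} {el ea : LocalExpr} {P P' : Program}
  {v c : Config} {i : Instr}

theorem Mirror.scratch (h : Mirror m n off V inp inp' v c) (pc a w : ℕ) (ha : m < a) :
    Mirror m n off V inp inp' v ⟨pc, Function.update c.reg a w, c.mem⟩ where
  reg b hb := by simp [(hb.trans ha).ne, h.reg b hb]
  size := by simp [ha.ne, h.size]
  input := h.input
  virt := h.virt
  mem_le := h.mem_le

theorem Mirror.update (h : Mirror m n off V inp inp' v c) (pc pc' a w : ℕ) (ha : a < m) :
    Mirror m n off V inp inp' ⟨pc', Function.update v.reg a w, v.mem⟩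
      ⟨pc, Function.update c.reg a w, c.mem⟩ where
  reg b hb := by
    rcases eq_or_ne b a with rfl | hba
    · simp
    · simp [hba, h.reg b hb]
  size := by simp [ha.ne', h.size]
  input := h.input
  virt := h.virt
  mem_le := h.mem_le

theorem Mirror.of_eq {c' v' : Config} (h : Mirror m n off V inp inp' v c)
    (hm : c'.mem = c.mem) (hr : ∀ a ≤ m, c'.reg a = c.reg a) (hm' : v'.mem = v.mem)
    (hr' : v'.reg = v.reg) : Mirror m n off V inp inp' v' c' where
  reg a ha := by rw [hr a ha.le, hr', h.reg a ha]
  size := by rw [hr m le_rfl, h.size]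
  input := by rw [hm]; exact h.input
  virt := by rw [hm, hm']; exact h.virt
  mem_le := by rw [hm]; exact h.mem_le

theorem Mirror.store (h : Mirror m n off V inp inp' v c) (hV : 1 ≤ V) (pc pc' x w : ℕ)
    (hw : w ≤ V) (reg : ℕ → ℕ) (hreg : ∀ a ≤ m, reg a = c.reg a) :
    Mirror m n off V inp inp' ⟨pc', v.reg, Function.update v.mem x w⟩
      ⟨pc, reg, Function.update (Function.update c.mem (off + 2 * x) w) (off + 2 * x + 1) 1⟩ where
  reg a ha := by simp [hreg a ha.le, h.reg a ha]
  size := by simp [hreg m le_rfl, h.size]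
  input q hq := by
    simp only [Function.update_apply]
    rw [if_neg (by omega), if_neg (by omega), h.input q hq]
  virt y := by
    simp only [Function.update_apply]
    rcases eq_or_ne y x with rfl | hyx
    · right; simp
    · have := h.virt y
      rw [if_neg (by omega), if_neg (by omega), if_neg hyx, if_neg (by omega), if_neg (by omega)]
      exact this
  mem_le q := by
    simp only [Function.update_apply]
    split_ifs
    · exact hV
    · exact hw
    · exact h.mem_le q

/-- For `const` and `op` the size of the new word is read off from `hvb'`, the boundedness of the
next virtual configuration. Jumps do nothing here; the last instruction of the block performs them.
-/
theorem runs_lazyBody (hx : LazyAccess n off V K inp inp' el ea) (hi : i.RegsBelow m)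
    (hv : P[v.pc]? = some i) (hcoin : ∀ a, i ≠ .coin a) (hvb : v.Bounded V) (b : Bool)
    (hvb' : (P.step v b).Bounded V) (hcode : CodeAt P' c.pc (lazyBody m el ea i))
    (hM : Mirror m n off V inp inp' v c) (hc : c.Bounded K) :
    P'.Runs K c (lazyBody m el ea i).length (fun c' =>
      c'.pc = c.pc + (lazyBody m el ea i).length ∧
      Mirror m n off V inp inp' (P.step v b) c') := by
  cases i with
  | const a w =>
    have hs : P.step v b = ⟨v.pc + 1, Function.update v.reg a w, v.mem⟩ := by
      simp [Program.step, hv]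
    have hw : w ≤ V := by
      have := (hvb' a).1
      rw [hs] at this
      simpa using this
    refine (Program.runs_const hcode.head hc (hw.trans hx.le)).mono ?_
    rintro _ rfl
    rw [hs]
    exact ⟨rfl, hM.update _ _ _ _ hi⟩
  | op o a y z =>
    obtain ⟨ha, hy, hz⟩ := hi
    have hs : P.step v b = ⟨v.pc + 1, Function.update v.reg a (o.eval (v.reg y) (v.reg z)),
        v.mem⟩ := by
      simp [Program.step, hv]
    have hw : o.eval (v.reg y) (v.reg z) ≤ V := by
      have := (hvb' a).1
      rw [hs] at this
      simpa using this
    refine (Program.runs_op hcode.head hc ?_).mono ?_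
    · rw [hM.reg y hy, hM.reg z hz]; exact hw.trans hx.le
    rintro _ rfl
    rw [hs, hM.reg y hy, hM.reg z hz]
    exact ⟨rfl, hM.update _ _ _ _ ha⟩
  | load a y =>
    obtain ⟨ha, hy⟩ := hi
    have hs : P.step v b = ⟨v.pc + 1, Function.update v.reg a (v.mem (v.reg y)), v.mem⟩ := by
      simp [Program.step, hv]
    have hval : el.eval c.mem (c.reg m) (c.reg y) = v.mem (v.reg y) := by
      rw [hM.size, hx.eval_el _ hM.input, hM.reg y hy]
      rcases hM.virt (v.reg y) with ⟨h0, h1⟩ | ⟨h0, h1⟩ <;> simp [h0, h1]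
    simp only [lazyBody] at hcode ⊢
    rw [List.length_append]
    refine (Program.runs_compile el (m + 1) (by omega) (by omega) c hcode.left hc ?_).append ?_
    · rw [hM.size, hM.reg y hy]
      exact hx.peak_el _ _ hM.mem_le (hvb y).1
    rintro c₁ ⟨hpc, hm, hd, hr⟩ hb₁
    have hcode' := hcode.right
    rw [← hpc] at hcode'
    refine (Program.runs_move hcode' (by omega) hb₁).mono ?_
    rintro _ rfl
    refine ⟨by simp [hpc]; omega, ?_⟩
    rw [hs, hd, hval]
    exact (hM.of_eq hm (fun a ha => hr a (by omega)) rfl rfl).update _ _ _ _ ha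
  | store a y =>
    obtain ⟨ha, hy⟩ := hi
    have hs : P.step v b = ⟨v.pc + 1, v.reg, Function.update v.mem (v.reg a) (v.reg y)⟩ := by
      simp [Program.step, hv]
    have hpk : ea.peak c.mem (c.reg m) (c.reg a) + 1 ≤ K := by
      rw [hM.size, hM.reg a ha]
      exact hx.peak_ea _ _ hM.mem_le (hvb a).1
    have hval : ea.eval c.mem (c.reg m) (c.reg a) = off + 2 * v.reg a := by
      rw [hM.size, hx.eval_ea, hM.reg a ha]
    have hle : off + 2 * v.reg a + 1 ≤ K := by
      have := ea.eval_le_peak c.mem (c.reg m) (c.reg a)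
      omega
    simp only [lazyBody] at hcode ⊢
    rw [List.length_append]
    refine (Program.runs_compile ea (m + 1) (by omega) (by omega) c hcode.left hc
      (by omega)).append ?_
    rintro c₁ ⟨hpc, hm, hd, hr⟩ hb₁
    have hcode' := hcode.right
    rw [← hpc] at hcode'
    refine (Program.runs_store hcode'.head hb₁).append (l' := 3) ?_
    rintro _ rfl hb₂
    refine (Program.runs_const (a := m + 2) hcode'.tail.head hb₂ (hx.one_le.trans hx.le)).append
      (l' := 2) ?_
    rintro _ rfl hb₃
    refine (Program.runs_op (o := .add) (a := m + 1) (x := m + 1) (y := m + 2)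
      hcode'.tail.tail.head hb₃ ?_).append (l' := 1) ?_
    · simpa [WordOp.eval, hd, hval] using hle
    rintro _ rfl hb₄
    refine (Program.runs_store (a := m + 1) (x := m + 2) hcode'.tail.tail.tail.head hb₄).mono ?_
    rintro _ rfl
    refine ⟨by simp [hpc]; omega, ?_⟩
    have hry : c₁.reg y = v.reg y := by rw [hr y (by omega), hM.reg y hy]
    rw [hs]
    have := hM.store (c := c) hx.one_le (c₁.pc + 1 + 1 + 1 + 1) (v.pc + 1) (v.reg a) (v.reg y)
      (hvb y).1 (Function.update (Function.update c₁.reg (m + 2) 1) (m + 1) (off + 2 * v.reg a + 1))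
      (fun a ha => by
        rw [Function.update_of_ne (by omega), Function.update_of_ne (by omega), hr a (by omega)])
    simpa [WordOp.eval, hd, hval, hm, hry] using this
  | jumpIfZero a l =>
    refine Program.Runs.zero hc ⟨rfl, hM.of_eq rfl (fun _ _ => rfl) ?_ ?_⟩ <;>
      simp [Program.step, hv]
  | coin a => exact absurd rfl (hcoin a)

theorem runs_replicate (k : ℕ) (hcode : CodeAt P' c.pc (List.replicate k (.const (m + 1) 0)))
    (hM : Mirror m n off V inp inp' v c) (hc : c.Bounded K) :
    P'.Runs K c k (fun c' => c'.pc = c.pc + k ∧ Mirror m n off V inp inp' v c') := by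
  induction k generalizing c with
  | zero => exact Program.Runs.zero hc ⟨rfl, hM⟩
  | succ k ih =>
    rw [List.replicate_succ] at hcode
    rw [add_comm k 1]
    refine (Program.runs_const hcode.head hc (Nat.zero_le _)).append ?_
    rintro _ rfl hb
    refine (ih hcode.tail (hM.scratch _ _ _ (by omega)) hb).mono ?_
    rintro c' ⟨h1, h2⟩
    exact ⟨by simp [h1]; omega, h2⟩

/-- A block simulates one step, whose random bit is the first one of the block. -/
theorem run_lazyBlock (hx : LazyAccess n off V K inp inp' el ea) (start : ℕ) (hi : i.RegsBelow m)
    (hv : P[v.pc]? = some i) (hvb : v.Bounded V) (b : Bool) (hvb' : (P.step v b).Bounded V)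
    (hpc : c.pc = start + (lazyBodyLength m el ea + 2) * v.pc)
    (hcode : CodeAt P' c.pc (lazyBlock m start el ea i))
    (hM : Mirror m n off V inp inp' v c) (hc : c.Bounded K) :
    P'.Runs K (P'.step c b) (lazyBodyLength m el ea + 1) (fun c' =>
      c'.pc = start + (lazyBodyLength m el ea + 2) * (P.step v b).pc ∧
      Mirror m n off V inp inp' (P.step v b) c') := by
  have hlen := length_lazyBody_le m el ea i
  simp only [lazyBlock] at hcode
  -- Body and padding together take `lazyBodyLength` steps whatever the instruction. Equal block
  -- lengths make jump targets computable and put the coins at fixed times.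
  have hbody : ∀ c₁ : Config, c₁.pc = c.pc + 1 → c₁.Bounded K →
      Mirror m n off V inp inp' v c₁ → (∀ a, i ≠ .coin a) →
      P'.Runs K c₁ (lazyBodyLength m el ea) (fun c' => c'.pc = c.pc + 1 + lazyBodyLength m el ea ∧
        Mirror m n off V inp inp' (P.step v b) c') := fun c₁ hpc₁ hb₁ hM₁ hcoin => by
    have h1 := hcode.tail
    rw [← hpc₁] at h1
    have := (runs_lazyBody hx hi hv hcoin hvb b hvb' h1.left hM₁ hb₁).append
      (l' := lazyBodyLength m el ea - (lazyBody m el ea i).length)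
      (Ψ := fun c' => c'.pc = c.pc + 1 + lazyBodyLength m el ea ∧
        Mirror m n off V inp inp' (P.step v b) c') ?_
    · rwa [Nat.add_sub_cancel' hlen] at this
    rintro c₂ ⟨hpc₂, hM₂⟩ hb₂
    have h2 := h1.right
    rw [← hpc₂] at h2
    refine (runs_replicate _ h2.left hM₂ hb₂).mono ?_
    rintro c₃ ⟨hpc₃, hM₃⟩
    exact ⟨by omega, hM₃⟩
  have htail : CodeAt P' (c.pc + 1 + lazyBodyLength m el ea)
      [lazyTail m start (lazyBodyLength m el ea + 2) i] := by
    have := hcode.tail.right.right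
    rw [List.length_replicate] at this
    convert this using 1
    omega
  -- For all instructions but coins and jumps, the first and the last instruction of the block only
  -- write to a scratch register.
  have hnop : (∀ a, i ≠ .coin a) → (∀ a l, i ≠ .jumpIfZero a l) →
      (P.step v b).pc = v.pc + 1 →
      P'.Runs K (P'.step c b) (lazyBodyLength m el ea + 1) (fun c' =>
        c'.pc = start + (lazyBodyLength m el ea + 2) * (P.step v b).pc ∧
        Mirror m n off V inp inp' (P.step v b) c') := fun hcoin hjump hspc => by
    have hhead : lazyHead m i = .const (m + 1) 0 := by
      cases i <;> simp [lazyHead] at hcoin ⊢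
    have htl : lazyTail m start (lazyBodyLength m el ea + 2) i = .const (m + 1) 0 := by
      cases i <;> simp [lazyTail] at hjump ⊢
    have hs : P'.step c b = ⟨c.pc + 1, Function.update c.reg (m + 1) 0, c.mem⟩ := by
      have := hcode.head
      rw [hhead] at this
      simp [Program.step, this]
    rw [hs]
    refine (hbody _ rfl (hc.update_reg _ _ (Nat.zero_le _)) (hM.scratch _ _ _ (by omega))
      hcoin).append ?_
    rintro c₂ ⟨hpc₂, hM₂⟩ hb₂
    rw [htl, ← hpc₂] at htail
    refine (Program.runs_const htail.head hb₂ (Nat.zero_le _)).mono ?_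
    rintro _ rfl
    refine ⟨?_, hM₂.scratch _ _ _ (by omega)⟩
    simp only [hpc₂, hpc, hspc]
    ring
  cases i with
  | const a w => exact hnop (by simp) (by simp) (by simp [Program.step, hv])
  | op o a y z => exact hnop (by simp) (by simp) (by simp [Program.step, hv])
  | load a y => exact hnop (by simp) (by simp) (by simp [Program.step, hv])
  | store a y => exact hnop (by simp) (by simp) (by simp [Program.step, hv])
  | jumpIfZero a l =>
    have hs : P'.step c b = ⟨c.pc + 1, Function.update c.reg (m + 1) 0, c.mem⟩ := by
      have := hcode.head
      simp only [lazyHead] at this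
      simp [Program.step, this]
    rw [hs]
    refine (hbody _ rfl (hc.update_reg _ _ (Nat.zero_le _)) (hM.scratch _ _ _ (by omega))
      (by simp)).append ?_
    rintro c₂ ⟨hpc₂, hM₂⟩ hb₂
    rw [← hpc₂] at htail
    have hs' : ∀ b', P'.step c₂ b' = { c₂ with
        pc := if c₂.reg a = 0 then start + (lazyBodyLength m el ea + 2) * l else c₂.pc + 1 } := by
      intro b'
      have := htail.head
      simp only [lazyTail] at this
      simp [Program.step, this]
    have hsv : P.step v b = { v with pc := if v.reg a = 0 then l else v.pc + 1 } := by
      simp [Program.step, hv]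
    refine Program.Runs.step hb₂ fun b' => ?_
    rw [hs']
    refine ⟨hb₂, ?_, hM₂.of_eq rfl (fun _ _ => rfl) rfl rfl⟩
    have hra : c₂.reg a = v.reg a := by
      rw [hM₂.reg a hi, hsv]
    simp only [hsv, hra]
    split_ifs
    · rfl
    · rw [hpc₂, hpc]; ring
  | coin a =>
    have hs : P'.step c b = ⟨c.pc + 1, Function.update c.reg a b.toNat, c.mem⟩ := by
      have := hcode.head
      simp only [lazyHead] at this
      simp [Program.step, this]
    have hsv : P.step v b = ⟨v.pc + 1, Function.update v.reg a b.toNat, v.mem⟩ := by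
      simp [Program.step, hv]
    have hbit : b.toNat ≤ K := (Bool.toNat_le b).trans (hx.one_le.trans hx.le)
    rw [hs, hsv]
    simp only [lazyBody, List.nil_append, List.length_nil, Nat.sub_zero, lazyTail] at hcode htail
    refine (runs_replicate (lazyBodyLength m el ea) (m := m) hcode.tail.left
      (hM.update (c.pc + 1) (v.pc + 1) a b.toNat hi) (hc.update_reg _ _ hbit)).append ?_
    rintro c₂ ⟨hpc₂, hM₂⟩ hb₂
    rw [← hpc₂] at htail
    refine (Program.runs_const htail.head hb₂ (Nat.zero_le _)).mono ?_
    rintro _ rfl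
    refine ⟨?_, hM₂.scratch _ _ _ (by omega)⟩
    simp only [hpc₂, hpc]
    ring

end

-- Whole runs and their random bits

/-- The entries number `0`, `B`, `2 * B`, ..., `(t - 1) * B` of a list. -/
def everyNth (B : ℕ) : ℕ → List Bool → List Bool
  | 0, _ => []
  | t + 1, cs => cs.headD false :: everyNth B t (cs.drop B)

theorem length_everyNth (B t : ℕ) (cs : List Bool) : (everyNth B t cs).length = t := by
  induction t generalizing cs <;> simp_all [everyNth]

/-- The explicit positions k + B * i exhibit the sampled bits as an injective reindexing of all
bits, as `ncard_comp_mem` requires. -/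
theorem everyNth_drop_eq_ofFn (B t k : ℕ) (cs : List Bool) :
    everyNth B t (cs.drop k) = List.ofFn fun i : Fin t => cs.getD (k + B * i) false := by
  induction t generalizing k with
  | zero => simp [everyNth]
  | succ t ih =>
    rw [everyNth, List.drop_drop, ih, List.ofFn_succ]
    congr 1
    · simp [List.headD_eq_head?_getD, List.head?_drop]
    · congr 1
      ext i
      congr 1
      simp only [Fin.val_succ]
      ring

theorem Program.run_of_getElem?_eq_none {P : Program} {c : Config} (h : P[c.pc]? = none)
    (cs : List Bool) : P.run c cs = c := by
  induction cs with
  | nil => rfl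
  | cons b cs ih =>
    have : P.step c b = c := by simp [Program.step, h]
    rw [Program.run, List.foldl_cons, this]
    exact ih

/-- Induction on the number of virtual steps: one block per step, and the virtual run sees just the
first random bit of each block. -/
theorem run_lazyProgram {m n off V K : ℕ} {inp inp' : ℕ → ℕ} {eN el ea : LocalExpr} {P : Program}
    (hx : LazyAccess n off V K inp inp' el ea) (hreg : ∀ i ∈ P, i.RegsBelow m) (T : ℕ)
    (v c : Config)
    (hpc : c.pc = (lazyPreamble m eN).length + (lazyBodyLength m el ea + 2) * v.pc)
    (hM : Mirror m n off V inp inp' v c) (hc : c.Bounded K)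
    (hv : ∀ cs : List Bool, cs.length ≤ T → (P.run v cs).Bounded V) (coins : List Bool) :
    (coins.length ≤ (lazyBodyLength m el ea + 2) * T →
      ((lazyProgram m eN el ea P).run c coins).Bounded K) ∧
    (coins.length = (lazyBodyLength m el ea + 2) * T →
      ((lazyProgram m eN el ea P).run c coins).pc = (lazyPreamble m eN).length +
        (lazyBodyLength m el ea + 2) *
          (P.run v (everyNth (lazyBodyLength m el ea + 2) T coins)).pc ∧
      Mirror m n off V inp inp' (P.run v (everyNth (lazyBodyLength m el ea + 2) T coins))
        ((lazyProgram m eN el ea P).run c coins)) := by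
  induction T generalizing v c coins with
  | zero =>
    have : coins.length ≤ 0 → coins = [] := fun h => List.length_eq_zero_iff.1 (by omega)
    refine ⟨fun h => ?_, fun h => ?_⟩
    · rw [this (by simpa using h)]; exact hc
    · rw [this (by simpa using h.le)]; exact ⟨hpc, hM⟩
  | succ T ih =>
    rcases hi : P[v.pc]? with _ | i
    · have hhalt : (lazyProgram m eN el ea P)[c.pc]? = none := by
        rw [List.getElem?_eq_none_iff] at hi ⊢
        rw [hpc, length_lazyProgram]
        exact Nat.add_le_add_left (Nat.mul_le_mul_left _ hi) _
      simp only [Program.run_of_getElem?_eq_none hhalt, Program.run_of_getElem?_eq_none hi]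
      exact ⟨fun _ => hc, fun _ => ⟨hpc, hM⟩⟩
    · cases coins with
      | nil => exact ⟨fun _ => hc, fun h => by simp at h⟩
      | cons b rest =>
        have hcode := codeAt_lazyProgram (m := m) (eN := eN) (el := el) (ea := ea) hi
        rw [← hpc] at hcode
        have hblock := run_lazyBlock hx _ (hreg i (List.mem_of_getElem? hi)) hi
          (hv [] (by simp)) b (hv [b] (by simp)) hpc hcode hM hc
        have hrun : ∀ l, (lazyProgram m eN el ea P).run c (b :: l) =
          (lazyProgram m eN el ea P).run ((lazyProgram m eN el ea P).step c b) l := fun _ => rfl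
        have hrest : lazyBodyLength m el ea + 1 ≤ rest.length →
            (rest.take (lazyBodyLength m el ea + 1)).length = lazyBodyLength m el ea + 1 :=
          fun h => by simp [h]
        have hsplit : ∀ c', (lazyProgram m eN el ea P).run c' rest =
            (lazyProgram m eN el ea P).run ((lazyProgram m eN el ea P).run c'
              (rest.take (lazyBodyLength m el ea + 1))) (rest.drop (lazyBodyLength m el ea + 1)) :=
          fun c' => by rw [← Program.run_append, List.take_append_drop]
        have hnext := fun h => ih (P.step v b) _ (hblock.2 _ (hrest h)).1 (hblock.2 _ (hrest h)).2
          (hblock.1 _ (hrest h).le) (fun cs hcs => hv (b :: cs) (by simpa using hcs))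
          (rest.drop (lazyBodyLength m el ea + 1))
        have hmul : (lazyBodyLength m el ea + 2) * (T + 1) =
          (lazyBodyLength m el ea + 2) * T + (lazyBodyLength m el ea + 2) := by ring
        rw [hmul, List.length_cons, hrun]
        refine ⟨fun h => ?_, fun h => ?_⟩
        · rcases le_total rest.length (lazyBodyLength m el ea + 1) with hl | hl
          · exact hblock.1 _ hl
          · rw [hsplit]
            exact (hnext hl).1 (by simp; omega)
        · rw [hsplit]
          exact (hnext (by omega)).2 (by simp; omega)

/-- The T' - T bits outside the range of `ι` are arbitrary and contribute a factor 2 each. Hence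
unused random bits do not change probabilities. -/
theorem ncard_comp_mem {T T' : ℕ} (ι : Fin T → Fin T') (hι : Function.Injective ι)
    (S : Set (Fin T → Bool)) : {r : Fin T' → Bool | r ∘ ι ∈ S}.ncard = 2 ^ (T' - T) * S.ncard := by
  classical
  let e : (Fin T' → Bool) ≃ (Fin T → Bool) × ({j // ¬ j ∈ Set.range ι} → Bool) :=
    (Equiv.piEquivPiSubtypeProd (fun j => j ∈ Set.range ι) fun _ => Bool).trans
      (Equiv.prodCongr ((Equiv.ofInjective ι hι).arrowCongr (Equiv.refl Bool)).symm (Equiv.refl _))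
  have he : ∀ r, (e r).1 = r ∘ ι := fun r => by
    ext i
    simp [e, Equiv.piEquivPiSubtypeProd]
  have hpre : {r : Fin T' → Bool | r ∘ ι ∈ S} = e ⁻¹' (S ×ˢ Set.univ) := by
    ext r
    simp [he]
  rw [hpre, Set.ncard_preimage_of_injective_subset_range e.injective (by simp), Set.ncard_prod,
    Set.ncard_univ, Nat.card_eq_fintype_card, Fintype.card_fun, Fintype.card_bool,
    Fintype.card_subtype_compl, Fintype.card_fin, mul_comm]
  congr 3
  rw [← Set.toFinset_card, Set.toFinset_range, Finset.card_image_of_injective _ hι]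
  simp

/-- The simulated program expects its own size parameter in register `0`; the original one has to be
saved in register `m`, as the cell expressions need it. -/
theorem runs_lazyPreamble {m n K : ℕ} {eN el ea : LocalExpr} {P : Program} {c : Config}
    (hm : 1 ≤ m) (hpc : c.pc = 0) (hc : c.Bounded K) (hn : c.reg 0 = n)
    (hpeak : eN.peak c.mem n n ≤ K) :
    (lazyProgram m eN el ea P).Runs K c (lazyPreamble m eN).length (fun c' =>
      c'.pc = (lazyPreamble m eN).length ∧ c'.mem = c.mem ∧ c'.reg 0 = eN.eval c.mem n n ∧
      c'.reg m = n ∧ ∀ a, a ≠ 0 → a < m → c'.reg a = c.reg a) := by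
  have hcode : CodeAt (lazyProgram m eN el ea P) c.pc (lazyPreamble m eN) :=
    ⟨[], _, rfl, by simp [hpc]⟩
  simp only [lazyPreamble] at hcode ⊢
  rw [List.length_append]
  refine (Program.runs_move hcode.left (by omega) hc).append ?_
  rintro _ rfl hb₁
  rw [List.length_append]
  have h1 := hcode.right
  refine (Program.runs_compile eN (m + 1) (by omega) (by omega) _ h1.left hb₁ ?_).append ?_
  · simpa [hn] using hpeak
  rintro c₂ ⟨hpc₂, hm₂, hd₂, hr₂⟩ hb₂
  have h2 := h1.right
  replace h2 : CodeAt (lazyProgram m eN el ea P) c₂.pc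
      [.const 0 0, .op .add 0 (m + 1) 0] := by rw [hpc₂]; exact h2
  refine (Program.runs_move h2 (by omega) hb₂).mono ?_
  rintro _ rfl
  refine ⟨by simp [hpc₂, hpc]; omega, hm₂, ?_, ?_, fun a ha ham => ?_⟩
  · simp [hd₂, hn]
  · dsimp only
    rw [Function.update_of_ne (by omega), hr₂ m (by omega)]
    simp [hn]
  · dsimp only
    rw [Function.update_of_ne ha, hr₂ a (by omega)]
    simp [ham.ne]

/-- If instances of `Q` can be turned into instances of `Q'` whose memory cells are given by a local
function, then an algorithm for `Q'` yields one for `Q`, with a constant factor in the time. -/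
theorem exists_solves_of_isLocal {Q Q' : DecisionProblem} {N off : ℕ → ℕ}
    {f : (ℕ → ℕ) → ℕ → ℕ → ℕ} (hN : IsLocal fun _ n _ => N n) (hoff : IsLocal fun _ n _ => off n)
    (hf : IsLocal f) (g : ∀ {n}, Q.Inst n → Q'.Inst (N n))
    (hyes : ∀ {n} (x : Q.Inst n), Q'.IsYes (g x) ↔ Q.IsYes x)
    (hone : ∀ {n} (x : Q.Inst n) q, Q.input x q ≤ 1)
    (hzero : ∀ {n} (x : Q.Inst n) q, off n ≤ q → Q.input x q = 0)
    (hcells : ∀ {n} (x : Q.Inst n) mem, (∀ q < off n, mem q = Q.input x q) →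
      ∀ q, f mem n q = Q'.input (g x) q)
    {mode : AlgMode} {P : Program} {T : ℕ → ℕ} (hP : P.Allowed mode) (hT : P.Solves Q' T) :
    ∃ (P' : Program) (A B : ℕ), P'.Allowed mode ∧ P'.Solves Q fun n => A + B * T (N n) := by
  obtain ⟨eN, htN, heN⟩ := hN
  obtain ⟨el, htl, hel⟩ : IsLocal fun mem n x =>
      if mem (off n + 2 * x + 1) = 0 then f mem n x else mem (off n + 2 * x) :=
    have haddr := hoff.add ((IsLocal.const 2).mul .arg)
    (IsLocal.ite (IsLocalPred.eq (haddr.add (.const 1)).load (.const 0)) hf haddr.load).congr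
      fun mem n x => by congr
  obtain ⟨ea, hta, hea⟩ : IsLocal fun mem n x => off n + 2 * x :=
    hoff.add ((IsLocal.const 2).mul .arg)
  obtain ⟨m, hm, hreg⟩ := P.exists_regsBelow
  obtain ⟨b, hb⟩ := hT
  obtain ⟨βN, hβN⟩ := eN.exists_peak_le htN 1
  -- Virtual words are at most (N n + 2)^b and N n + 2 ≤ (n + 2)^(βN + 2), whence the exponent (βN +
  -- 2) * b; the additional 1 makes room for n itself.
  obtain ⟨βl, hβl⟩ := el.exists_peak_le htl ((βN + 2) * b + 1)
  obtain ⟨βa, hβa⟩ := ea.exists_peak_le hta ((βN + 2) * b + 1)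
  refine ⟨lazyProgram m eN el ea P, (lazyPreamble m eN).length, lazyBodyLength m el ea + 2, ?_,
    (βN + 2) * b + 1 + βN + βl + βa + 1, fun n x => ?_⟩
  · cases mode with
    | deterministic => exact fun a => coin_notMem_lazyProgram (hP a)
    | randomized => trivial
  have mono : ∀ {i j : ℕ}, i ≤ j → (n + 2) ^ i ≤ (n + 2) ^ j := fun h =>
    Nat.pow_le_pow_right (by omega) h
  have hpos : ∀ i : ℕ, 1 ≤ (n + 2) ^ i := fun i => Nat.one_le_pow _ _ (by omega)
  set V := (n + 2) ^ ((βN + 2) * b + 1) with hV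
  set K := (n + 2) ^ ((βN + 2) * b + 1 + βN + βl + βa + 1) with hK
  have hVK : V ≤ K := mono (by omega)
  have hNle : N n ≤ (n + 2) ^ βN := by
    have h1 := hβN (fun _ => 0) n 0 (by simp) (by simp)
    have h2 := eN.eval_le_peak (fun _ => 0) n 0
    rw [heN] at h2
    exact h2.trans h1
  have hvirt : (N n + 2) ^ b ≤ V := by
    have : N n + 2 ≤ (n + 2) ^ (βN + 2) := by
      have h1 := hpos βN
      have h2 : 4 ≤ (n + 2) ^ 2 := Nat.pow_le_pow_left (by omega : 2 ≤ n + 2) 2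
      rw [pow_add]
      nlinarith
    calc (N n + 2) ^ b ≤ ((n + 2) ^ (βN + 2)) ^ b := Nat.pow_le_pow_left this b
      _ = (n + 2) ^ ((βN + 2) * b) := (pow_mul _ _ _).symm
      _ ≤ V := mono (by omega)
  have hx : LazyAccess n (off n) V K (Q.input x) (Q'.input (g x)) el ea := by
    refine ⟨hpos _, hVK, fun mem hmem y => ?_, fun mem y => hea mem n y, fun mem y hmem hy => ?_,
      fun mem y hmem hy => ?_⟩
    · refine (hel mem n y).trans ?_
      simp only [hcells x mem hmem]
    · exact (hβl mem n y hmem hy).trans (mono (by omega))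
    · have h1 := hβa mem n y hmem hy
      have h2 : (n + 2) ^ βa + 1 ≤ (n + 2) ^ (βa + 1) := by
        have := hpos βa
        rw [pow_succ]
        nlinarith
      have h3 : (n + 2) ^ (βa + 1) ≤ K := mono (by omega)
      omega
  obtain ⟨hb1, hb2, hb3⟩ := hb (N n) (g x)
  have hnV : n ≤ V := (by rw [pow_one]; omega : n ≤ (n + 2) ^ 1).trans (mono (by omega))
  have hc0 : (Q.start x).Bounded K := fun i => by
    refine ⟨?_, (hone x i).trans (hpos _)⟩
    simp only [DecisionProblem.start]
    split_ifs
    · exact hnV.trans hVK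
    · exact Nat.zero_le _
  have hpre := runs_lazyPreamble (el := el) (ea := ea) (P := P) (c := Q.start x) (n := n) hm rfl hc0
    rfl ((hβN (Q.start x).mem n n (fun q => (hone x q).trans (hpos _)) (by rw [pow_one]; omega)).trans
      (mono (by omega)))
  have hmain : ∀ coins : List Bool, (lazyPreamble m eN).length ≤ coins.length →
      (coins.length ≤ (lazyPreamble m eN).length + (lazyBodyLength m el ea + 2) * T (N n) →
        ((lazyProgram m eN el ea P).run (Q.start x) coins).Bounded K) ∧
      (coins.length = (lazyPreamble m eN).length + (lazyBodyLength m el ea + 2) * T (N n) →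
        ((lazyProgram m eN el ea P).run (Q.start x) coins).pc = (lazyPreamble m eN).length +
          (lazyBodyLength m el ea + 2) *
            (P.run (Q'.start (g x)) (everyNth (lazyBodyLength m el ea + 2) (T (N n))
              (coins.drop (lazyPreamble m eN).length))).pc ∧
        Mirror m n (off n) V (Q.input x) (Q'.input (g x))
          (P.run (Q'.start (g x)) (everyNth (lazyBodyLength m el ea + 2) (T (N n))
              (coins.drop (lazyPreamble m eN).length)))
          ((lazyProgram m eN el ea P).run (Q.start x) coins)) := fun coins hlen => by
    have htake : (coins.take (lazyPreamble m eN).length).length = (lazyPreamble m eN).length := by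
      simp [hlen]
    obtain ⟨hpc, hmem, h0, hsize, hother⟩ := hpre.2 _ htake
    have hM : Mirror m n (off n) V (Q.input x) (Q'.input (g x)) (Q'.start (g x))
        ((lazyProgram m eN el ea P).run (Q.start x)
          (coins.take (lazyPreamble m eN).length)) := by
      refine ⟨fun a ha => ?_, hsize, fun q _ => by rw [hmem]; rfl, fun y => Or.inl ⟨?_, rfl⟩,
        fun q => ?_⟩
      · rcases eq_or_ne a 0 with rfl | ha0
        · rw [h0, heN]; rfl
        · rw [hother a ha0 ha]
          simp [DecisionProblem.start, ha0]
      -- All flags start at 0, because the input vanishes from `off n` on.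
      · rw [hmem]
        exact hzero x _ (by omega)
      · rw [hmem]
        exact (hone x q).trans (hpos _)
    have := run_lazyProgram hx hreg (T (N n)) (eN := eN) (Q'.start (g x)) _
      (by rw [hpc]; simp [DecisionProblem.start]) hM (hpre.1 _ htake.le)
      (fun cs hcs i => ⟨((hb1 cs hcs i).1).trans hvirt, ((hb1 cs hcs i).2).trans hvirt⟩)
      (coins.drop (lazyPreamble m eN).length)
    rw [← Program.run_append, List.take_append_drop, List.length_drop] at this
    exact ⟨fun h => this.1 (by omega), fun h => this.2 (by omega)⟩
  refine ⟨fun coins hlen => ?_, fun coins hlen => ?_, ?_⟩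
  · rcases le_total (lazyPreamble m eN).length coins.length with h | h
    · exact (hmain coins h).1 hlen
    · exact hpre.1 coins h
  · have h := ((hmain coins (by dsimp only at hlen; omega)).2 hlen).1
    have hh := hb2 _ (length_everyNth (lazyBodyLength m el ea + 2) (T (N n))
      (coins.drop (lazyPreamble m eN).length))
    rw [Config.Halted] at hh ⊢
    rw [h, length_lazyProgram]
    exact Nat.add_le_add_left (Nat.mul_le_mul_left _ hh) _
  · have hlt : ∀ i : Fin (T (N n)), (lazyPreamble m eN).length + (lazyBodyLength m el ea + 2) * i <
        (lazyPreamble m eN).length + (lazyBodyLength m el ea + 2) * T (N n) := fun i => by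
      simp
    -- `ι i` is the time of the first coin of block number i. Outcomes whose restriction along `ι`
    -- is good for the virtual run are good for the simulation.
    let ι : Fin (T (N n)) →
        Fin ((lazyPreamble m eN).length + (lazyBodyLength m el ea + 2) * T (N n)) :=
      fun i => ⟨_, hlt i⟩
    have hι : Function.Injective ι := fun i j hij => by
      have := congrArg Fin.val hij
      simp only [ι] at this
      exact Fin.ext (Nat.eq_of_mul_eq_mul_left (Nat.succ_pos _) (Nat.add_left_cancel this))
    have hsub : {r | r ∘ ι ∈ {r : Fin (T (N n)) → Bool |
          Q'.Correct (g x) (P.run (Q'.start (g x)) (List.ofFn r))}} ⊆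
        {r | Q.Correct x ((lazyProgram m eN el ea P).run (Q.start x) (List.ofFn r))} := by
      intro r hr
      simp only [Set.mem_ofPred_eq] at hr ⊢
      have hmir := ((hmain (List.ofFn r) (by simp)).2 (by simp)).2
      rw [everyNth_drop_eq_ofFn] at hmir
      have hfn : (fun i : Fin (T (N n)) => (List.ofFn r).getD
          ((lazyPreamble m eN).length + (lazyBodyLength m el ea + 2) * i) false) = r ∘ ι := by
        ext i
        rw [List.getD_eq_getElem _ _ (by simp)]
        simp [ι]
      rw [hfn] at hmir
      have h0 := hmir.reg 0 (by omega)
      rw [DecisionProblem.Correct, hyes] at hr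
      rw [DecisionProblem.Correct, h0]
      exact hr
    have hcard := Set.ncard_le_ncard hsub (Set.toFinite _)
    rw [ncard_comp_mem ι hι] at hcard
    have hTle : T (N n) ≤ (lazyPreamble m eN).length + (lazyBodyLength m el ea + 2) * T (N n) := by
      nlinarith
    have hsplit := pow_add 2 (((lazyPreamble m eN).length +
      (lazyBodyLength m el ea + 2) * T (N n)) - T (N n)) (T (N n))
    rw [Nat.sub_add_cancel hTle] at hsplit
    rw [hsplit]
    calc _ = 2 ^ (((lazyPreamble m eN).length +
          (lazyBodyLength m el ea + 2) * T (N n)) - T (N n)) * (2 * 2 ^ T (N n)) := by ring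
      _ ≤ _ := Nat.mul_le_mul_left _ hb3
      _ ≤ _ := by nlinarith

/-! ### Paths -/

theorem IsDiPath.singleton {V : Type*} (G : Digraph V) (u : V) : IsDiPath G u u [u] :=
  ⟨List.isChain_singleton _, rfl, rfl⟩

theorem IsDiPath.cons {V : Type*} {G : Digraph V} {u v w : V} {l : List V} (h : G.Adj u v)
    (hl : IsDiPath G v w l) : IsDiPath G u w (u :: l) := by
  obtain ⟨h1, h2, h3⟩ := hl
  refine ⟨h1.cons fun y hy => ?_, rfl, ?_⟩
  · rw [h2, Option.mem_some_iff] at hy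
    exact hy ▸ h
  · rw [List.getLast?_cons, h3]; rfl

/-- Paths are peeled off at the front with the end fixed. The statements about the graph of the
reduction are accordingly about all paths into a given target. -/
theorem IsDiPath.induction {V : Type*} {G : Digraph V} {w : V} {motive : V → List V → Prop}
    (single : motive w [w])
    (cons : ∀ u v l, G.Adj u v → IsDiPath G v w l → motive v l → motive u (u :: l))
    {u : V} {l : List V} (h : IsDiPath G u w l) : motive u l := by
  induction l generalizing u with
  | nil => simp [IsDiPath] at h
  | cons x l ih =>
    obtain ⟨h1, h2, h3⟩ := h
    obtain rfl : x = u := by simpa using h2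
    cases l with
    | nil =>
      obtain rfl : x = w := by simpa using h3
      exact single
    | cons y l =>
      rw [List.isChain_cons_cons] at h1
      have hp : IsDiPath G y w (y :: l) := ⟨h1.2, rfl, by simpa using h3⟩
      exact cons x y _ h1.1 hp (ih hp)

theorem IsDiPath.head_mem {V : Type*} {G : Digraph V} {u w : V} {l : List V}
    (h : IsDiPath G u w l) : u ∈ l := List.mem_of_head? h.2.1

theorem IsDiPath.append {V : Type*} {G : Digraph V} {u v v' w : V} {l l' : List V}
    (h : IsDiPath G u v l) (hv : G.Adj v v') (h' : IsDiPath G v' w l') :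
    IsDiPath G u w (l ++ l') :=
  IsDiPath.induction (motive := fun u l => IsDiPath G u w (l ++ l'))
    (IsDiPath.cons hv h') (fun _ _ _ hE _ ih => IsDiPath.cons hE ih) h

theorem IsDiPath.map {V W : Type*} {G : Digraph V} {H : Digraph W} {f : V → W}
    (hf : ∀ u v, G.Adj u v → H.Adj (f u) (f v)) {u v : V} {l : List V} (h : IsDiPath G u v l) :
    IsDiPath H (f u) (f v) (l.map f) :=
  IsDiPath.induction (motive := fun u l => IsDiPath H (f u) (f v) (l.map f))
    (IsDiPath.singleton _ _) (fun _ _ _ hE _ ih => IsDiPath.cons (hf _ _ hE) ih) h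

theorem IsDiPath.range' {V : Type*} {G : Digraph V} (f : ℕ → V) (s m : ℕ)
    (h : ∀ x, s ≤ x → x < s + m → G.Adj (f x) (f (x + 1))) :
    IsDiPath G (f s) (f (s + m)) ((List.range' s (m + 1)).map f) := by
  induction m generalizing s with
  | zero => exact IsDiPath.singleton _ _
  | succ m ih =>
    have := ih (s + 1) fun x h1 h2 => h x (by omega) (by omega)
    rw [List.range'_succ, List.map_cons, show s + (m + 1) = s + 1 + m by ring]
    exact IsDiPath.cons (h s le_rfl (by omega)) this

/-! ### The graph of the reduction -/

/-- The vertices: `fwd i` and `bwd i` are the two tracks of row `i`, used before and after the block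
that a row path leaves out; `src o` and `tgt o` are the terminals of the check with label `o`;
`pad j` are isolated. -/
inductive GVertex
  | src (o : ℕ) | fwd (i u : ℕ) | bwd (i u : ℕ) | tgt (o : ℕ) | pad (j : ℕ)

/-- The number of positions per vertex of a part of the given graph. -/
def blockLen (k : ℕ) : ℕ := k * k + 2 * k + 3

/-- The number `d * k + r` is a label if `r`, `r + d`, ... is a maximal arithmetic progression with
difference `d` and at least two terms below `k`. -/
def IsLabel (k o : ℕ) : Prop := o % k < o / k ∧ o % k + o / k < k

/-- The edges. In position `u > 0` of a track, the vertex number `(u - 1) / blockLen k` of the part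
is visited by the check with label `(u - 1) % blockLen k`. -/
def GEdge (k n : ℕ) (A : ℕ → ℕ → ℕ → ℕ → Prop) : GVertex → GVertex → Prop
  | .fwd i u, .fwd j v => i < k ∧ j = i ∧ v = u + 1 ∧ v < n * blockLen k + 2
  | .bwd i u, .bwd j v => i < k ∧ j = i ∧ v = u + 1 ∧ v < n * blockLen k + 2
  -- A plain crossing, or a jump from the last position before a block to the first one after it.
  | .fwd i u, .bwd j v => i < k ∧ j = i ∧ v < n * blockLen k + 2 ∧
      (v = u ∨ (u % blockLen k = 0 ∧ v = u + blockLen k + 1))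
  -- The hop of a check: the label is kept, and its quotient by k is the distance between the rows.
  | .bwd i u, .fwd j v => 1 ≤ u ∧ 1 ≤ v ∧ (v - 1) % blockLen k = (u - 1) % blockLen k ∧
      IsLabel k ((u - 1) % blockLen k) ∧ j = i + (u - 1) % blockLen k / k ∧
      A i ((u - 1) / blockLen k) j ((v - 1) / blockLen k)
  | .src o, .fwd j v => IsLabel k o ∧ j = o % k ∧ 1 ≤ v ∧ v < n * blockLen k + 1 ∧
      (v - 1) % blockLen k = o
  -- Only the last term of the progression, the one with k ≤ i + d, is joined to the target.
  | .bwd i u, .tgt o => IsLabel k o ∧ i < k ∧ 1 ≤ u ∧ u < n * blockLen k + 1 ∧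
      (u - 1) % blockLen k = o ∧ i % (o / k) = o % k ∧ k ≤ i + o / k
  | _, _ => False

/-- The graph of the reduction. -/
def gGraph (k n : ℕ) (A : ℕ → ℕ → ℕ → ℕ → Prop) : Digraph GVertex := ⟨GEdge k n A⟩

section

variable {k n : ℕ} {A : ℕ → ℕ → ℕ → ℕ → Prop}

theorem blockLen_pos (k : ℕ) : 0 < blockLen k := by unfold blockLen; omega

theorem IsLabel.pos {o : ℕ} (h : IsLabel k o) : 0 < k := by
  unfold IsLabel at h; omega

theorem IsLabel.lt_mul {o : ℕ} (h : IsLabel k o) : o < k * k := by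
  have hk := h.pos
  unfold IsLabel at h
  exact (Nat.div_lt_iff_lt_mul hk).1 (by omega)

theorem IsLabel.lt_blockLen {o : ℕ} (h : IsLabel k o) : o < blockLen k := by
  have := h.lt_mul
  unfold blockLen; omega

theorem block_eq {B q u : ℕ} (hB : 0 < B) (hq : q % B = 0) (h1 : q < u) (h2 : u < q + B + 1) :
    (u - 1) / B = q / B ∧ (u - 1) % B = u - 1 - q := by
  obtain ⟨a, rfl⟩ := Nat.dvd_of_mod_eq_zero hq
  have : u - 1 = (u - 1 - B * a) + B * a := by omega
  constructor
  · rw [this, Nat.add_mul_div_left _ _ hB, Nat.mul_div_cancel_left _ hB,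
      Nat.div_eq_of_lt (by omega)]
    omega
  · conv_lhs => rw [this]
    rw [Nat.add_mul_mod_self_left, Nat.mod_eq_of_lt (by omega)]

/-- A row in which a vertex can be reached. -/
def GVertex.row (k : ℕ) : GVertex → ℕ
  | .src _ => 0
  | .fwd i _ => i
  | .bwd i _ => i
  | .tgt _ => k
  | .pad _ => k

/-- A path that starts and ends in the same row can therefore never leave it. -/
theorem GEdge.row_le {z w : GVertex} (h : GEdge k n A z w) : z.row k ≤ w.row k := by
  cases z <;> cases w <;> simp only [GEdge] at h <;> simp only [GVertex.row] <;>
    first | omega | exact h.2.2.2.2.1 ▸ Nat.le_add_right _ _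

theorem IsDiPath.row_le {z w : GVertex} {l : List GVertex}
    (h : IsDiPath (gGraph k n A) z w l) : z.row k ≤ w.row k :=
  IsDiPath.induction (motive := fun z _ => z.row k ≤ w.row k) le_rfl
    (fun _ _ _ hE _ ih => (GEdge.row_le hE).trans ih) h

/-- A path along a row covers an initial segment of the first track and a final segment of the
second one, and leaves out at most one block. -/
theorem row_path {i : ℕ} (hi : i < k) {z : GVertex} {l : List GVertex}
    (h : IsDiPath (gGraph k n A) z (.bwd i (n * blockLen k + 1)) l) :
    (∀ v, z = .bwd i v → v ≤ n * blockLen k + 1 ∧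
      (∀ x, v ≤ x → x ≤ n * blockLen k + 1 → .bwd i x ∈ l) ∧
      n * blockLen k + 2 ≤ v + l.length) ∧
    (∀ u, z = .fwd i u → ∃ q q', u ≤ q ∧
      (q' = q ∨ (q % blockLen k = 0 ∧ q' = q + blockLen k + 1)) ∧ q' ≤ n * blockLen k + 1 ∧
      (∀ x, u ≤ x → x ≤ q → .fwd i x ∈ l) ∧
      (∀ x, q' ≤ x → x ≤ n * blockLen k + 1 → .bwd i x ∈ l) ∧
      n * blockLen k + 2 ≤ u + blockLen k + l.length) := by
  refine IsDiPath.induction (w := GVertex.bwd i (n * blockLen k + 1)) (motive := fun (z : GVertex) (l : List GVertex) =>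
    (∀ v, z = .bwd i v → v ≤ n * blockLen k + 1 ∧
      (∀ x, v ≤ x → x ≤ n * blockLen k + 1 → .bwd i x ∈ l) ∧
      n * blockLen k + 2 ≤ v + l.length) ∧
    (∀ u, z = .fwd i u → ∃ q q', u ≤ q ∧
      (q' = q ∨ (q % blockLen k = 0 ∧ q' = q + blockLen k + 1)) ∧ q' ≤ n * blockLen k + 1 ∧
      (∀ x, u ≤ x → x ≤ q → .fwd i x ∈ l) ∧
      (∀ x, q' ≤ x → x ≤ n * blockLen k + 1 → .bwd i x ∈ l) ∧
      n * blockLen k + 2 ≤ u + blockLen k + l.length)) ?_ ?_ h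
  · refine ⟨fun v hv => ?_, fun u hu => by simp at hu⟩
    simp only [GVertex.bwd.injEq, true_and] at hv
    subst hv
    refine ⟨le_rfl, fun x h1 h2 => ?_, by simp⟩
    obtain rfl : x = n * blockLen k + 1 := by omega
    simp
  · intro z z' l hE hp ih
    have hrow := hp.row_le
    simp only [gGraph] at hE
    simp only [GVertex.row] at hrow
    refine ⟨fun v hv => ?_, fun u hu => ?_⟩
    · subst hv
      cases z' with
      | src o => simp [GEdge] at hE
      | fwd j v' =>
        -- A hop has positive difference, so it would end in a later row.
        simp only [GEdge, IsLabel] at hE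
        simp only at hrow
        omega
      | bwd j v' =>
        simp only [GEdge] at hE
        obtain ⟨-, rfl, rfl, hlt⟩ := hE
        obtain ⟨h1, h2, h3⟩ := ih.1 _ rfl
        refine ⟨by omega, fun x hx1 hx2 => ?_, by simp; omega⟩
        rcases eq_or_lt_of_le hx1 with rfl | hx
        · simp
        · exact List.mem_cons_of_mem _ (h2 x hx hx2)
      | tgt o => simp only at hrow; omega
      | pad j => simp [GEdge] at hE
    · subst hu
      cases z' with
      | src o => simp [GEdge] at hE
      | fwd j v' =>
        simp only [GEdge] at hE
        obtain ⟨-, rfl, rfl, hlt⟩ := hE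
        obtain ⟨q, q', h1, h2, h3, h4, h5, h6⟩ := ih.2 _ rfl
        refine ⟨q, q', by omega, h2, h3, fun x hx1 hx2 => ?_,
          fun x hx1 hx2 => List.mem_cons_of_mem _ (h5 x hx1 hx2), by simp; omega⟩
        rcases eq_or_lt_of_le hx1 with rfl | hx
        · simp
        · exact List.mem_cons_of_mem _ (h4 x hx hx2)
      | bwd j v' =>
        simp only [GEdge] at hE
        -- The path never returns to the first track, so this change is the only place where
        -- vertices can be saved.
        obtain ⟨-, rfl, hlt, hv⟩ := hE
        obtain ⟨h1, h2, h3⟩ := ih.1 _ rfl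
        refine ⟨u, v', le_rfl, hv, h1, fun x hx1 hx2 => ?_,
          fun x hx1 hx2 => List.mem_cons_of_mem _ (h2 x hx1 hx2), by simp; omega⟩
        obtain rfl : x = u := by omega
        simp
      | tgt o => simp [GEdge] at hE
      | pad j => simp [GEdge] at hE

/-- The vertex is not covered by the row paths that leave the first track of row `i` at `q i` and
enter the second one at `q' i`. -/
def GVertex.Free (q q' : ℕ → ℕ) : GVertex → Prop
  | .fwd i u => q i < u
  | .bwd i v => v < q' i
  | _ => True

/-- The vertices `a i`, `a (i + d)`, `a (i + 2 * d)`, ... are consecutively adjacent. -/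
def Linked (k : ℕ) (A : ℕ → ℕ → ℕ → ℕ → Prop) (a : ℕ → ℕ) (d i : ℕ) : Prop :=
  ∀ m, i + (m + 1) * d < k →
    A (i + m * d) (a (i + m * d)) (i + (m + 1) * d) (a (i + (m + 1) * d))

theorem Linked.cons {a : ℕ → ℕ} {d i : ℕ} (h : Linked k A a d (i + d))
    (hi : A i (a i) (i + d) (a (i + d))) : Linked k A a d i := by
  intro m hm
  cases m with
  | zero => simpa using hi
  | succ m =>
    have := h m (by linarith [show i + (m + 1 + 1) * d = i + d + (m + 1) * d by ring])
    rw [show i + (m + 1) * d = i + d + m * d by ring,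
      show i + (m + 1 + 1) * d = i + d + (m + 1) * d by ring]
    exact this

/-- A path of uncovered vertices to the target of a check only visits the blocks that are left out;
its labels do not decrease. -/
theorem check_path (hA : ∀ i a j b, A i a j b → i < k ∧ a < n ∧ j < k ∧ b < n) {q q' : ℕ → ℕ}
    (hq : ∀ i < k, q' i = q i ∨ (q i % blockLen k = 0 ∧ q' i = q i + blockLen k + 1))
    {c : ℕ} {z : GVertex} {l : List GVertex}
    (h : IsDiPath (gGraph k n A) z (.tgt c) l) (hfree : ∀ x ∈ l, x.Free q q') :
    (∀ i u, z = .fwd i u → i < k → u < q' i ∧ (u - 1) % blockLen k ≤ c ∧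
      ((u - 1) % blockLen k = c → Linked k A (fun i => q i / blockLen k) (c / k) i)) ∧
    (∀ i u, z = .bwd i u → i < k → q i < u → (u - 1) % blockLen k ≤ c ∧
      ((u - 1) % blockLen k = c → Linked k A (fun i => q i / blockLen k) (c / k) i)) := by
  have hB := blockLen_pos k
  -- A position free on both tracks exists only if the row path has skipped a block, and then it
  -- lies in that block.
  have hblock : ∀ i < k, ∀ u, q i < u → u < q' i → (u - 1) / blockLen k = q i / blockLen k ∧
      (u - 1) % blockLen k = u - 1 - q i ∧ u < q i + blockLen k + 1 := by
    intro i hi u h1 h2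
    rcases hq i hi with h | ⟨h, h'⟩
    · omega
    · have := block_eq hB h h1 (by omega)
      exact ⟨this.1, this.2, by omega⟩
  revert hfree
  refine IsDiPath.induction (w := GVertex.tgt c) (motive := fun (z : GVertex) (l : List GVertex) =>
    (∀ x ∈ l, x.Free q q') →
    (∀ i u, z = .fwd i u → i < k → u < q' i ∧ (u - 1) % blockLen k ≤ c ∧
      ((u - 1) % blockLen k = c → Linked k A (fun i => q i / blockLen k) (c / k) i)) ∧
    (∀ i u, z = .bwd i u → i < k → q i < u → (u - 1) % blockLen k ≤ c ∧
      ((u - 1) % blockLen k = c → Linked k A (fun i => q i / blockLen k) (c / k) i))) ?_ ?_ h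
  · intro _
    exact ⟨fun i u h => by simp at h, fun i u h => by simp at h⟩
  · intro z z' l hE hp ih hfree
    have hfz : z.Free q q' := hfree z (by simp)
    have hfz' : z'.Free q q' := hfree z' (List.mem_cons_of_mem _ hp.head_mem)
    obtain ⟨ih1, ih2⟩ := ih fun x hx => hfree x (List.mem_cons_of_mem _ hx)
    simp only [gGraph] at hE
    refine ⟨fun i u hz hi => ?_, fun i u hz hi hqu => ?_⟩
    · subst hz
      simp only [GVertex.Free] at hfz
      cases z' with
      | src o => simp [GEdge] at hE
      | fwd j v =>
        simp only [GEdge] at hE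
        obtain ⟨-, rfl, rfl, hlt⟩ := hE
        obtain ⟨h1, h2, -⟩ := ih1 _ _ rfl hi
        -- The label of u + 1 exceeds that of u by one and is still at most c, so the label of u is
        -- not c and the second claim is vacuous.
        have e1 := hblock j hi u hfz (by omega)
        have e2 := hblock j hi (u + 1) (by omega) h1
        exact ⟨by omega, by omega, fun h => by omega⟩
      | bwd j v =>
        simp only [GEdge] at hE
        obtain ⟨-, rfl, hlt, rfl | ⟨h1, rfl⟩⟩ := hE
        · exact ⟨hfz', ih2 _ _ rfl hi hfz⟩
        -- A jump from beyond `q j` would land beyond the free part of the second track.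
        · simp only [GVertex.Free] at hfz'
          have := hq j hi
          omega
      | tgt o => simp [GEdge] at hE
      | pad j => simp [GEdge] at hE
    · subst hz
      simp only [GVertex.Free] at hfz
      cases z' with
      | src o => simp [GEdge] at hE
      | fwd j v =>
        simp only [GEdge] at hE
        obtain ⟨hu, hv, hoff, hlab, rfl, hadj⟩ := hE
        have hj := (hA _ _ _ _ hadj).2.2.1
        obtain ⟨h1, h2, h3⟩ := ih1 _ _ rfl hj
        rw [hoff] at h2 h3
        refine ⟨h2, fun h => ?_⟩
        -- Both ends of the hop lie in skipped blocks, so the edge speaks of the chosen vertices;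
        -- its label being c, the difference is c / k.
        rw [(hblock i hi u hqu hfz).1, (hblock _ hj v hfz' h1).1, h] at hadj
        have := h3 h
        rw [h] at this
        exact this.cons hadj
      | bwd j v =>
        simp only [GEdge] at hE
        obtain ⟨-, rfl, rfl, hlt⟩ := hE
        simp only [GVertex.Free] at hfz'
        obtain ⟨h2, -⟩ := ih2 _ _ rfl hi (by omega)
        have e1 := hblock j hi u hqu (by omega)
        have e2 := hblock j hi (u + 1) (by omega) hfz'
        exact ⟨by omega, fun h => by omega⟩
      | tgt o =>
        have hoc : o = c := by
          have := IsDiPath.induction (w := GVertex.tgt c) (motive := fun (z : GVertex) _ => ∀ o, z = .tgt o → o = c)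
            (fun o h => by simpa using h.symm)
            (fun u v _ h _ _ o hu => by subst hu; simp [gGraph, GEdge] at h) hp
          exact this o rfl
        subst hoc
        simp only [GEdge] at hE
        obtain ⟨hlab, -, hu, -, ho, hmod, hge⟩ := hE
        -- The progression ends here, so nothing is left to link.
        refine ⟨ho.le, fun _ m hm => ?_⟩
        have : o / k ≤ (m + 1) * (o / k) := Nat.le_mul_of_pos_left _ (Nat.succ_pos m)
        omega
      | pad j => simp [GEdge] at hE

/-- The distance to the target of a check: a path that leaves the label of the check has to go
through a whole block before it comes back to it. -/
theorem check_length {c : ℕ} (hc : IsLabel k c) {z : GVertex} {l : List GVertex}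
    (h : IsDiPath (gGraph k n A) z (.tgt c) l) :
    (∀ i u, z = .fwd i u → (∃ t, u + t ≡ c + 1 [MOD blockLen k] ∧ t + 2 ≤ l.length) ∧
      (u ≡ c + 1 [MOD blockLen k] → ∀ m, i + m * (c / k) < k →
        blockLen k ≤ l.length ∨ 2 * m + 3 ≤ l.length)) ∧
    (∀ i u, z = .bwd i u → (∃ t, u + t ≡ c + 1 [MOD blockLen k] ∧ t + 2 ≤ l.length) ∧
      (u ≡ c + 1 [MOD blockLen k] → ∀ m, i + m * (c / k) < k →
        blockLen k ≤ l.length ∨ 2 * m + 2 ≤ l.length)) := by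
  -- Returning to the same residue after at least one track step takes at least `blockLen k` of
  -- them.
  have hwrap : ∀ u t, u ≡ c + 1 [MOD blockLen k] → u + (t + 1) ≡ c + 1 [MOD blockLen k] →
      blockLen k ≤ t + 1 := fun u t h1 h2 => by
    have : u + (t + 1) ≡ u + 0 [MOD blockLen k] := h2.trans h1.symm
    exact Nat.le_of_dvd (Nat.succ_pos t)
      ((Nat.modEq_zero_iff_dvd).1 (Nat.ModEq.add_left_cancel' u this))
  have hoffs : ∀ u, 1 ≤ u → u ≡ (u - 1) % blockLen k + 1 [MOD blockLen k] := fun u hu => by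
    have := (Nat.mod_modEq (u - 1) (blockLen k)).symm.add_right 1
    rwa [Nat.sub_add_cancel hu] at this
  have hlabel : ∀ o, o < blockLen k → o + 1 ≡ c + 1 [MOD blockLen k] → o = c := fun o ho h =>
    Nat.ModEq.eq_of_lt_of_lt (Nat.ModEq.add_right_cancel' 1 h) ho hc.lt_blockLen
  refine IsDiPath.induction (w := GVertex.tgt c) (motive := fun (z : GVertex) (l : List GVertex) =>
    (∀ i u, z = .fwd i u → (∃ t, u + t ≡ c + 1 [MOD blockLen k] ∧ t + 2 ≤ l.length) ∧
      (u ≡ c + 1 [MOD blockLen k] → ∀ m, i + m * (c / k) < k →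
        blockLen k ≤ l.length ∨ 2 * m + 3 ≤ l.length)) ∧
    (∀ i u, z = .bwd i u → (∃ t, u + t ≡ c + 1 [MOD blockLen k] ∧ t + 2 ≤ l.length) ∧
      (u ≡ c + 1 [MOD blockLen k] → ∀ m, i + m * (c / k) < k →
        blockLen k ≤ l.length ∨ 2 * m + 2 ≤ l.length))) ?_ ?_ h
  · exact ⟨fun i u h => by simp at h, fun i u h => by simp at h⟩
  · intro z z' l hE hp ⟨ih1, ih2⟩
    simp only [gGraph] at hE
    -- Modulo `blockLen k` a jump advances the position by 1, just as a step along a track does; t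
    -- is a number of such steps that leads to the residue of the target.
    have hstep : ∀ u v, (v = u + 1 ∨ v = u + blockLen k + 1) →
        (∃ t, v + t ≡ c + 1 [MOD blockLen k] ∧ t + 2 ≤ l.length) →
        (∃ t, u + t ≡ c + 1 [MOD blockLen k] ∧ t + 2 ≤ l.length + 1) ∧
          (u ≡ c + 1 [MOD blockLen k] → blockLen k ≤ l.length + 1) := by
      rintro u v huv ⟨t, ht, hl⟩
      have ht' : u + (t + 1) ≡ c + 1 [MOD blockLen k] := by
        rcases huv with rfl | rfl
        · rwa [show u + (t + 1) = u + 1 + t by ring]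
        · refine Nat.ModEq.trans ?_ ht
          rw [show u + blockLen k + 1 + t = u + (t + 1) + blockLen k by ring]
          simp [Nat.ModEq]
      refine ⟨⟨t + 1, ht', by omega⟩, fun h => ?_⟩
      have := hwrap u t h ht'
      omega
    refine ⟨fun i u hz => ?_, fun i u hz => ?_⟩
    · subst hz
      rw [List.length_cons]
      cases z' with
      | src o => simp [GEdge] at hE
      | fwd j v =>
        simp only [GEdge] at hE
        have := hstep u v (Or.inl hE.2.2.1) (ih1 _ _ rfl).1
        exact ⟨this.1, fun h m _ => Or.inl (this.2 h)⟩
      | bwd j v =>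
        simp only [GEdge] at hE
        obtain ⟨-, rfl, -, rfl | ⟨-, hv⟩⟩ := hE
        · obtain ⟨⟨t, ht, hl⟩, h2⟩ := ih2 _ _ rfl
          refine ⟨⟨t, ht, by omega⟩, fun h m hm => ?_⟩
          have := h2 h m hm
          omega
        · have := hstep u v (Or.inr hv) (ih2 _ _ rfl).1
          exact ⟨this.1, fun h m _ => Or.inl (this.2 h)⟩
      | tgt o => simp [GEdge] at hE
      | pad j => simp [GEdge] at hE
    · subst hz
      rw [List.length_cons]
      cases z' with
      | src o => simp [GEdge] at hE
      | fwd j v =>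
        simp only [GEdge] at hE
        obtain ⟨hu, hv, hoff, hlab, rfl, -⟩ := hE
        have huv : u ≡ v [MOD blockLen k] := by
          have := hoffs v hv
          rw [hoff] at this
          exact (hoffs u hu).trans this.symm
        obtain ⟨⟨t, ht, hl⟩, h2⟩ := ih1 _ _ rfl
        refine ⟨⟨t, (huv.add_right t).trans ht, by omega⟩, fun h m hm => ?_⟩
        -- The residue of the position determines the label, so this hop belongs to the check c and
        -- moves by c / k rows.
        have hoc := hlabel _ (Nat.mod_lt _ (blockLen_pos k)) ((hoffs u hu).symm.trans h)
        cases m with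
        | zero => right; omega
        | succ m =>
          rw [hoc] at h2
          have := h2 (huv.symm.trans h) m
            (by linarith [show i + (m + 1) * (c / k) = i + c / k + m * (c / k) by ring])
          omega
      | bwd j v =>
        simp only [GEdge] at hE
        have := hstep u v (Or.inl hE.2.2.1) (ih2 _ _ rfl).1
        exact ⟨this.1, fun h m _ => Or.inl (this.2 h)⟩
      | tgt o =>
        have hoc : o = c := by
          have := IsDiPath.induction (w := GVertex.tgt c) (motive := fun (z : GVertex) _ => ∀ o, z = .tgt o → o = c)
            (fun o h => by simpa using h.symm)
            (fun u v _ h _ _ o hu => by subst hu; simp [gGraph, GEdge] at h) hp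
          exact this o rfl
        subst hoc
        simp only [GEdge] at hE
        obtain ⟨hlab, -, hu, -, ho, hmod, hge⟩ := hE
        have hl : 1 ≤ l.length := List.length_pos_of_mem hp.head_mem
        refine ⟨⟨0, ?_, by omega⟩, fun _ m hm => ?_⟩
        · have := hoffs u hu
          rwa [ho] at this
        · cases m with
          | zero => right; omega
          | succ m =>
            have : o / k ≤ (m + 1) * (o / k) := Nat.le_mul_of_pos_left _ (Nat.succ_pos m)
            omega
      | pad j => simp [GEdge] at hE

end

/-! ### Cliques and disjoint paths -/

theorem IsDiPath.exists_cons {V : Type*} {G : Digraph V} {u w : V} {l : List V}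
    (h : IsDiPath G u w l) (huw : u ≠ w) : ∃ v l', l = u :: l' ∧ G.Adj u v ∧ IsDiPath G v w l' :=
  IsDiPath.induction (motive := fun (u : V) (l : List V) => u ≠ w →
      ∃ v l', l = u :: l' ∧ G.Adj u v ∧ IsDiPath G v w l')
    (fun h => absurd rfl h) (fun _ v l hE hp _ _ => ⟨v, l, rfl, hE, hp⟩) h huw

/-- The vertices that occur in the graph of the reduction. -/
def GVertex.Valid (k n p : ℕ) : GVertex → Prop
  | .src o => o < k * k
  | .fwd i u => i < k ∧ u < n * blockLen k + 2
  | .bwd i u => i < k ∧ u < n * blockLen k + 2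
  | .tgt o => o < k * k
  | .pad j => j < p

/-- The paths that are asked for: along a row, for a check, or from a vertex to itself. -/
inductive PathTask
  | row (i : ℕ) | check (o : ℕ) | idle (j : ℕ)

/-- The source of a path. -/
def PathTask.source : PathTask → GVertex
  | .row i => .fwd i 0
  | .check o => .src o
  | .idle j => .pad j

/-- The target of a path. -/
def PathTask.target (k n : ℕ) : PathTask → GVertex
  | .row i => .bwd i (n * blockLen k + 1)
  | .check o => .tgt o
  | .idle j => .pad j

/-- The tasks that occur in the reduction. -/
def PathTask.Valid (k p : ℕ) : PathTask → Prop
  | .row i => i < k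
  | .check o => IsLabel k o
  | .idle j => j < p

/-- The vertices of the path for a task that corresponds to the choice of vertex `a i` in part `i`,
for all `i`. -/
def PathTask.Owns (k : ℕ) (a : ℕ → ℕ) : PathTask → GVertex → Prop
  | .row i, .fwd j u => j = i ∧ u < a i * blockLen k + 1
  | .row i, .bwd j u => j = i ∧ (a i + 1) * blockLen k + 1 ≤ u
  | .check o, .fwd j u => u = a j * blockLen k + 1 + o
  | .check o, .bwd j u => u = a j * blockLen k + 1 + o
  | .check o, .src o' => o' = o
  | .check o, .tgt o' => o' = o
  | .idle j, .pad j' => j' = j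
  | _, _ => False

section

variable {k n p : ℕ} {A : ℕ → ℕ → ℕ → ℕ → Prop}

theorem GEdge.valid (hA : ∀ i a j b, A i a j b → i < k ∧ a < n ∧ j < k ∧ b < n) {z w : GVertex}
    (h : GEdge k n A z w) : z.Valid k n p ∧ w.Valid k n p := by
  have hdiv : ∀ u, (u - 1) / blockLen k < n → u < n * blockLen k + 2 := fun u hu => by
    rw [Nat.div_lt_iff_lt_mul (blockLen_pos k)] at hu
    omega
  cases z <;> cases w <;> simp only [GEdge] at h <;> simp only [GVertex.Valid]
  case src.fwd =>
    have h1 := h.1.lt_mul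
    obtain ⟨⟨h2, h3⟩, rfl, h4, h5, h6⟩ := h
    omega
  case fwd.fwd => omega
  case fwd.bwd =>
    have := blockLen_pos k
    omega
  case bwd.fwd =>
    obtain ⟨-, -, -, -, rfl, h⟩ := h
    obtain ⟨h1, h2, h3, h4⟩ := hA _ _ _ _ h
    exact ⟨⟨h1, hdiv _ h2⟩, h3, hdiv _ h4⟩
  case bwd.bwd => omega
  case bwd.tgt =>
    have h1 := h.1.lt_mul
    omega

theorem IsDiPath.forall_valid (hA : ∀ i a j b, A i a j b → i < k ∧ a < n ∧ j < k ∧ b < n)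
    {z w : GVertex} {l : List GVertex} (h : IsDiPath (gGraph k n A) z w l)
    (hw : w.Valid k n p) : ∀ x ∈ l, x.Valid k n p :=
  IsDiPath.induction (motive := fun _ (l : List GVertex) => ∀ x ∈ l, x.Valid k n p)
    (by simpa using hw) (fun u v l hE _ ih x hx => by
      rcases List.mem_cons.1 hx with rfl | hx
      · exact (GEdge.valid hA hE).1
      · exact ih x hx) h

/-- Different tasks share no terminals, so internally disjoint paths for them are completely
disjoint. -/
theorem PathTask.eq_of_mem_ends {s t : PathTask} {v : GVertex}
    (hs : v = s.source ∨ v = s.target k n) (ht : v = t.source ∨ v = t.target k n) : s = t := by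
  cases s <;> cases t <;> simp only [PathTask.source, PathTask.target] at hs ht <;>
    rcases hs with rfl | rfl <;> simp_all

/-- Row i leaves block `a i` free on both tracks, and inside it each check keeps to the position
given by its own label, which is less than `blockLen k`. -/
theorem PathTask.eq_of_owns {s t : PathTask} {a : ℕ → ℕ} {v : GVertex} (hs : s.Valid k p)
    (ht : t.Valid k p) (hsv : s.Owns k a v) (htv : t.Owns k a v) : s = t := by
  have hlt : ∀ o, IsLabel k o → o < blockLen k := fun o h => h.lt_blockLen
  have hmul : ∀ i, (a i + 1) * blockLen k = a i * blockLen k + blockLen k := fun i => by ring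
  cases s <;> cases t <;> cases v <;> simp only [PathTask.Owns, hmul] at hsv htv <;>
    simp only [PathTask.Valid] at hs ht
  case row.row.fwd => simp_all
  case row.row.bwd => simp_all
  case row.check.fwd => obtain ⟨rfl, h⟩ := hsv; omega
  case row.check.bwd o _ _ => obtain ⟨rfl, h⟩ := hsv; have := hlt o ht; omega
  case check.row.fwd => obtain ⟨rfl, h⟩ := htv; omega
  case check.row.bwd o _ _ _ => obtain ⟨rfl, h⟩ := htv; have := hlt o hs; omega
  case check.check.fwd => congr 1; omega
  case check.check.bwd => congr 1; omega
  case check.check.src => congr 1; omega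
  case check.check.tgt => congr 1; omega
  case idle.idle.pad => congr 1; omega

/-- The vertex chosen in part i is the number of the block where its row path changes tracks. The
pair i < j is tested by the check with difference j - i and residue i mod (j - i). -/
theorem exists_clique_of_disjoint
    (hA : ∀ i a j b, A i a j b → i < k ∧ a < n ∧ j < k ∧ b < n) {τ : Fin p → PathTask}
    (hrow : ∀ i < k, ∃ j, τ j = .row i) (hcheck : ∀ o, IsLabel k o → ∃ j, τ j = .check o)
    (hinj : Function.Injective τ) {L : Fin p → List GVertex}
    (hL : ∀ j, IsDiPath (gGraph k n A) (τ j).source ((τ j).target k n) (L j))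
    (hdisj : InternallyDisjoint (fun j => (τ j).source) (fun j => (τ j).target k n) L) :
    ∃ a : ℕ → ℕ, ∀ i j, i < j → j < k → A i (a i) j (a j) := by
  have hdis : ∀ i j v, v ∈ L i → v ∈ L j → i = j := fun i j v hi hj => by
    by_contra hij
    obtain ⟨h1, h2⟩ := hdisj i j hij v hi hj
    exact hij (hinj (PathTask.eq_of_mem_ends h1 h2))
  have hex : ∀ i, ∃ q q', i < k →
      (q' = q ∨ (q % blockLen k = 0 ∧ q' = q + blockLen k + 1)) ∧
      ∃ j, τ j = .row i ∧ (∀ x ≤ q, .fwd i x ∈ L j) ∧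
        ∀ x, q' ≤ x → x ≤ n * blockLen k + 1 → .bwd i x ∈ L j := fun i => by
    by_cases hi : i < k
    · obtain ⟨j, hj⟩ := hrow i hi
      have hp := hL j
      rw [hj] at hp
      obtain ⟨q, q', -, h1, -, h2, h3, -⟩ := (row_path hi hp).2 0 rfl
      exact ⟨q, q', fun _ => ⟨h1, j, hj, fun x hx => h2 x (Nat.zero_le x) hx, h3⟩⟩
    -- Irrelevant values outside the rows, so that `choose` yields total functions.
    · exact ⟨0, 0, fun h => absurd h hi⟩
  choose q q' hq using hex
  refine ⟨fun i => q i / blockLen k, fun i j hij hjk => ?_⟩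
  have hd : 0 < j - i := by omega
  have hr : i % (j - i) < j - i := Nat.mod_lt _ hd
  have hri : i % (j - i) ≤ i := Nat.mod_le _ _
  have hdiv : ((j - i) * k + i % (j - i)) / k = j - i := by
    rw [mul_comm, Nat.mul_add_div (by omega), Nat.div_eq_of_lt (by omega), add_zero]
  have hmod : ((j - i) * k + i % (j - i)) % k = i % (j - i) := by
    rw [mul_comm, Nat.mul_add_mod, Nat.mod_eq_of_lt (by omega)]
  have hlab : IsLabel k ((j - i) * k + i % (j - i)) := by
    rw [IsLabel, hdiv, hmod]
    exact ⟨hr, by omega⟩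
  obtain ⟨c, hc⟩ := hcheck _ hlab
  have hp := hL c
  rw [hc] at hp
  have hval := hp.forall_valid (p := p) hA hlab.lt_mul
  have hfree : ∀ x ∈ L c, x.Free q q' := fun x hx => by
    cases x with
    | fwd i' u =>
      obtain ⟨-, j', hj', h1, -⟩ := hq i' (hval _ hx).1
      by_contra hu
      simp only [GVertex.Free, not_lt] at hu
      have := hdis _ _ _ (h1 u hu) hx
      rw [this, hc] at hj'
      simp at hj'
    | bwd i' u =>
      obtain ⟨-, j', hj', -, h1⟩ := hq i' (hval _ hx).1
      by_contra hu
      simp only [GVertex.Free, not_lt] at hu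
      have hlt := (hval _ hx).2
      have := hdis _ _ _ (h1 u hu (by omega)) hx
      rw [this, hc] at hj'
      simp at hj'
    | src o => trivial
    | tgt o => trivial
    | pad o => trivial
  obtain ⟨z, l, hl, hE, hp'⟩ := hp.exists_cons (by simp [PathTask.source, PathTask.target])
  rw [hl] at hfree
  cases z with
  | src o => simp [gGraph, GEdge, PathTask.source] at hE
  | bwd i u => simp [gGraph, GEdge, PathTask.source] at hE
  | tgt o => simp [gGraph, GEdge, PathTask.source] at hE
  | pad o => simp [gGraph, GEdge, PathTask.source] at hE
  | fwd i' u =>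
    simp only [gGraph, GEdge, PathTask.source] at hE
    obtain ⟨-, rfl, -, -, hu⟩ := hE
    have := ((check_path hA (fun i hi => (hq i hi).1) hp'
      (fun x hx => hfree x (List.mem_cons_of_mem _ hx))).1 _ _ rfl (by rw [hmod]; omega)).2.2 hu
    rw [hdiv, hmod] at this
    -- In its progression, i is the term number i / (j - i), and j is the next one.
    have h1 := this (i / (j - i))
    have e1 : i % (j - i) + i / (j - i) * (j - i) = i := Nat.mod_add_div' _ _
    have e2 : i % (j - i) + (i / (j - i) + 1) * (j - i) = j := by
      rw [add_mul, ← add_assoc, e1]; omega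
    rw [e1, e2] at h1
    exact h1 hjk

theorem cell_lt {a o B : ℕ} (ha : a < n) (ho : o < B) : a * B + 1 + o < n * B + 1 := by
  have : (a + 1) * B ≤ n * B := Nat.mul_le_mul_right _ ha
  rw [add_mul, one_mul] at this
  omega

theorem cell_div_mod {a o B : ℕ} (ho : o < B) :
    (a * B + 1 + o - 1) / B = a ∧ (a * B + 1 + o - 1) % B = o := by
  have : a * B + 1 + o - 1 = o + B * a := by rw [mul_comm]; omega
  rw [this, Nat.add_mul_div_left _ _ (by omega), Nat.add_mul_mod_self_left, Nat.div_eq_of_lt ho,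
    Nat.mod_eq_of_lt ho]
  simp

/-- The path skips block `a i`. It is shortest, since by `row_path` no path along the row can save
more than one block. -/
theorem exists_row_path {a : ℕ → ℕ} {i : ℕ} (hi : i < k) (ha : a i < n) :
    ∃ l, IsShortestDiPath (gGraph k n A) (.fwd i 0) (.bwd i (n * blockLen k + 1)) l ∧
      ∀ x ∈ l, (PathTask.row i).Owns k a x := by
  have hle : (a i + 1) * blockLen k ≤ n * blockLen k := Nat.mul_le_mul_right _ ha
  have hmul : (a i + 1) * blockLen k = a i * blockLen k + blockLen k := by ring
  obtain ⟨m, hm⟩ := Nat.exists_eq_add_of_le hle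
  have h1 : IsDiPath (gGraph k n A) (.fwd i 0) (.fwd i (0 + a i * blockLen k))
      ((List.range' 0 (a i * blockLen k + 1)).map (.fwd i)) :=
    IsDiPath.range' (GVertex.fwd i) 0 (a i * blockLen k) fun x _ hx =>
      ⟨hi, rfl, rfl, by omega⟩
  have h2 : IsDiPath (gGraph k n A) (.bwd i ((a i + 1) * blockLen k + 1))
      (.bwd i ((a i + 1) * blockLen k + 1 + m))
      ((List.range' ((a i + 1) * blockLen k + 1) (m + 1)).map (.bwd i)) :=
    IsDiPath.range' (GVertex.bwd i) _ m fun x _ hx => ⟨hi, rfl, rfl, by omega⟩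
  have hE : (gGraph k n A).Adj (.fwd i (0 + a i * blockLen k))
      (.bwd i ((a i + 1) * blockLen k + 1)) :=
    ⟨hi, rfl, by omega, Or.inr ⟨by simp, by omega⟩⟩
  have h3 := h1.append hE h2
  rw [show (a i + 1) * blockLen k + 1 + m = n * blockLen k + 1 by omega] at h3
  refine ⟨_, ⟨h3, fun l' hl' => ?_⟩, fun x hx => ?_⟩
  · obtain ⟨q, q', -, -, -, -, -, h4⟩ := (row_path hi hl').2 0 rfl
    simp only [List.length_append, List.length_map, List.length_range']
    omega
  · simp only [List.mem_append, List.mem_map, List.mem_range'_1] at hx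
    rcases hx with ⟨u, hu, rfl⟩ | ⟨u, hu, rfl⟩
    · exact ⟨rfl, by omega⟩
    · exact ⟨rfl, by omega⟩

/-- With m further terms after i, the path visits two vertices in each of m + 1 rows and then the
target, hence 2 * m + 3 vertices. -/
theorem exists_check_tail {a : ℕ → ℕ} (ha : ∀ i < k, a i < n)
    (hadj : ∀ i j, i < j → j < k → A i (a i) j (a j)) {o : ℕ} (ho : IsLabel k o) (m i : ℕ)
    (hmod : i % (o / k) = o % k) (hlt : i + m * (o / k) < k) (hle : k ≤ i + (m + 1) * (o / k)) :
    ∃ l, IsDiPath (gGraph k n A) (.fwd i (a i * blockLen k + 1 + o)) (.tgt o) l ∧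
      l.length = 2 * m + 3 ∧ ∀ x ∈ l, (PathTask.check o).Owns k a x := by
  have hik : i < k := by omega
  have hcell := cell_lt (ha i hik) ho.lt_blockLen
  obtain ⟨hdiv, hoff⟩ := cell_div_mod (a := a i) ho.lt_blockLen
  have hcross : (gGraph k n A).Adj (.fwd i (a i * blockLen k + 1 + o))
      (.bwd i (a i * blockLen k + 1 + o)) := ⟨hik, rfl, by omega, Or.inl rfl⟩
  induction m generalizing i with
  | zero =>
    refine ⟨_, IsDiPath.cons hcross (IsDiPath.cons ?_ (IsDiPath.singleton _ _)), rfl, ?_⟩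
    · exact ⟨ho, hik, by omega, hcell, hoff, hmod, by omega⟩
    · simp [PathTask.Owns]
  | succ m ih =>
    have hd : 0 < o / k := by have := ho.1; omega
    have e1 : i + o / k + m * (o / k) = i + (m + 1) * (o / k) := by ring
    have e2 : i + o / k + (m + 1) * (o / k) = i + (m + 1 + 1) * (o / k) := by ring
    have hik' : i + o / k < k := lt_of_le_of_lt (by rw [← e1]; omega) hlt
    have hcell' := cell_lt (ha _ hik') ho.lt_blockLen
    obtain ⟨hdiv', hoff'⟩ := cell_div_mod (a := a (i + o / k)) ho.lt_blockLen
    obtain ⟨l, h1, h2, h3⟩ := ih (i + o / k) (by simpa using hmod) (by rw [e1]; exact hlt)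
      (by rw [e2]; exact hle) hik' hcell' hdiv' hoff' ⟨hik', rfl, by omega, Or.inl rfl⟩
    refine ⟨_, IsDiPath.cons hcross (IsDiPath.cons ?_ h1), by simp [h2]; ring, ?_⟩
    · refine ⟨by omega, by omega, by rw [hoff, hoff'], by rw [hoff]; exact ho, by rw [hoff], ?_⟩
      rw [hdiv, hdiv']
      exact hadj _ _ (by omega) hik'
    · intro x hx
      simp only [List.mem_cons] at hx
      rcases hx with rfl | rfl | hx
      · rfl
      · rfl
      · exact h3 x hx

theorem exists_check_path {a : ℕ → ℕ} (ha : ∀ i < k, a i < n)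
    (hadj : ∀ i j, i < j → j < k → A i (a i) j (a j)) {o : ℕ} (ho : IsLabel k o) :
    ∃ l, IsShortestDiPath (gGraph k n A) (.src o) (.tgt o) l ∧
      ∀ x ∈ l, (PathTask.check o).Owns k a x := by
  obtain ⟨hrd, hrk⟩ := ho
  have hd : 0 < o / k := by omega
  -- The index of the last term: r + m * d < k ≤ r + (m + 1) * d.
  set m := (k - 1 - o % k) / (o / k) with hm
  have hm1 : m * (o / k) ≤ k - 1 - o % k := Nat.div_mul_le_self _ _
  have hm2 : k - 1 - o % k < (m + 1) * (o / k) := by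
    rw [mul_comm]; exact Nat.lt_mul_div_succ _ hd
  have hlt : o % k + m * (o / k) < k := by omega
  obtain ⟨l, h1, h2, h3⟩ := exists_check_tail ha hadj ⟨hrd, hrk⟩ m (o % k)
    (Nat.mod_eq_of_lt hrd) hlt (by omega)
  have hcell := cell_lt (ha (o % k) (by omega)) (IsLabel.lt_blockLen ⟨hrd, hrk⟩)
  obtain ⟨hdiv, hoff⟩ := cell_div_mod (a := a (o % k)) (IsLabel.lt_blockLen ⟨hrd, hrk⟩)
  refine ⟨_, ⟨IsDiPath.cons ?_ h1, fun l' hl' => ?_⟩, fun x hx => ?_⟩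
  · exact ⟨⟨hrd, hrk⟩, rfl, by omega, hcell, hoff⟩
  · obtain ⟨z, l'', rfl, hE, hp⟩ := hl'.exists_cons (by simp)
    cases z with
    | src o => simp [gGraph, GEdge] at hE
    | bwd i u => simp [gGraph, GEdge] at hE
    | tgt o => simp [gGraph, GEdge] at hE
    | pad o => simp [gGraph, GEdge] at hE
    | fwd i u =>
      simp only [gGraph, GEdge] at hE
      obtain ⟨-, rfl, hu, -, huo⟩ := hE
      have hcong : u ≡ o + 1 [MOD blockLen k] := by
        have := (Nat.mod_modEq (u - 1) (blockLen k)).symm.add_right 1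
        rwa [Nat.sub_add_cancel hu, huo] at this
      have hmk : m ≤ m * (o / k) := Nat.le_mul_of_pos_right _ hd
      have := ((check_length ⟨hrd, hrk⟩ hp).1 _ _ rfl).2 hcong m hlt
      simp only [List.length_cons, h2]
      -- Besides the k * k possible labels, a block has 2 * k + 3 further positions; since m < k, a
      -- detour through a whole block is longer than 2 * m + 3.
      unfold blockLen at this
      omega
  · rcases List.mem_cons.1 hx with rfl | hx
    · rfl
    · exact h3 x hx

theorem exists_disjoint_of_clique {a : ℕ → ℕ} (ha : ∀ i < k, a i < n)
    (hadj : ∀ i j, i < j → j < k → A i (a i) j (a j)) {τ : Fin p → PathTask}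
    (hval : ∀ j, (τ j).Valid k p) (hinj : Function.Injective τ) :
    ∃ L : Fin p → List GVertex,
      (∀ j, IsShortestDiPath (gGraph k n A) (τ j).source ((τ j).target k n) (L j)) ∧
      InternallyDisjoint (fun j => (τ j).source) (fun j => (τ j).target k n) L := by
  have hex : ∀ j, ∃ l, IsShortestDiPath (gGraph k n A) (τ j).source ((τ j).target k n) l ∧
      ∀ x ∈ l, (τ j).Owns k a x := fun j => by
    have hv := hval j
    generalize τ j = t at hv
    cases t with
    | row i => exact exists_row_path hv (ha i hv)
    | check o => exact exists_check_path ha hadj hv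
    | idle i =>
      refine ⟨[.pad i], ⟨IsDiPath.singleton _ _, fun l' hl' => ?_⟩, by simp [PathTask.Owns]⟩
      exact List.length_pos_of_mem hl'.head_mem
  choose L hL hown using hex
  refine ⟨L, hL, fun i j hij v hi hj => absurd (hinj ?_) hij⟩
  exact PathTask.eq_of_owns (hval i) (hval j) (hown i v hi) (hown j v hj)

end

-- From k to k + 2: after dropping the zero term and shifting the index, each of the k + 1 remaining
-- terms grows by 1.
open Finset in
theorem sum_min_sub (k : ℕ) : ∑ d ∈ range k, min d (k - d) = k ^ 2 / 4 := by
  induction k using Nat.twoStepInduction with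
  | zero => rfl
  | one => rfl
  | more k ih _ =>
    rw [sum_range_succ']
    have : ∀ d ∈ range (k + 1), min (d + 1) (k + 2 - (d + 1)) = min d (k - d) + 1 := fun d hd => by
      have := mem_range.1 hd
      omega
    rw [sum_congr rfl this, sum_add_distrib, sum_range_succ, ih]
    have : (k + 2) ^ 2 = k ^ 2 + 4 * (k + 1) := by ring
    simp
    omega

/-- A label with difference d and residue r satisfies r < min d (k - d), so `sum_min_sub` bounds the
number of checks. Indices not needed for rows and checks become idle. -/
theorem exists_pathTasks {k p : ℕ} (h : k + k ^ 2 / 4 ≤ p) : ∃ τ : Fin p → PathTask,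
    Function.Injective τ ∧ (∀ j, (τ j).Valid k p) ∧ (∀ i < k, ∃ j, τ j = .row i) ∧
    ∀ o, IsLabel k o → ∃ j, τ j = .check o := by
  classical
  have hcard : ((Finset.range (k * k)).filter (IsLabel k)).card ≤ k ^ 2 / 4 := by
    rw [← sum_min_sub]
    have : ∑ d ∈ Finset.range k, min d (k - d) =
        ((Finset.range k).sigma fun d => Finset.range (min d (k - d))).card := by simp
    rw [this]
    refine Finset.card_le_card_of_injOn (fun o => ⟨o / k, o % k⟩) (fun o ho => ?_)
      fun o _ o' _ hoo => ?_
    · obtain ⟨h1, h2⟩ := (Finset.mem_filter.1 ho).2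
      simp only [Finset.coe_sigma, Set.mem_sigma_iff, Finset.coe_range, Set.mem_Iio]
      omega
    · simp only [Sigma.mk.injEq, heq_eq_eq] at hoo
      rw [← Nat.div_add_mod o k, ← Nat.div_add_mod o' k, hoo.1, hoo.2]
  let X := Fin k ⊕ {o // o ∈ (Finset.range (k * k)).filter (IsLabel k)}
  have hX : Fintype.card X ≤ Fintype.card (Fin p) := by
    simp only [X, Fintype.card_sum, Fintype.card_fin, Fintype.card_coe]
    omega
  obtain ⟨e⟩ := Function.Embedding.nonempty_of_card_le hX
  let task : X → PathTask := Sum.elim (fun i => .row i) fun o => .check o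
  have htask : Function.Injective task := by
    rintro (i | o) (i' | o') h <;> simp [task] at h
    · rw [Fin.ext h]
    · rw [h]
  have hidle : ∀ x j, task x ≠ .idle j := by
    rintro (i | o) j <;> simp [task]
  let τ : Fin p → PathTask := fun j => if h : ∃ x, e x = j then task h.choose else .idle j
  have hτ : ∀ x, τ (e x) = task x := fun x => by
    have hx : ∃ y, e y = e x := ⟨x, rfl⟩
    simp only [τ, dif_pos hx]
    rw [e.injective hx.choose_spec]
  have hτ' : ∀ j, (¬ ∃ x, e x = j) → τ j = .idle j := fun j hj => by simp only [τ, dif_neg hj]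
  refine ⟨τ, fun j j' hj => ?_, fun j => ?_, fun i hi => ⟨e (Sum.inl ⟨i, hi⟩), hτ _⟩,
    fun o ho => ⟨e (Sum.inr ⟨o, by simpa using ⟨ho.lt_mul, ho⟩⟩), hτ _⟩⟩
  · by_cases h1 : ∃ x, e x = j <;> by_cases h2 : ∃ x, e x = j'
    · obtain ⟨x, rfl⟩ := h1
      obtain ⟨y, rfl⟩ := h2
      rw [hτ, hτ] at hj
      rw [htask hj]
    · obtain ⟨x, rfl⟩ := h1
      rw [hτ, hτ' j' h2] at hj
      exact absurd hj (hidle _ _)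
    · obtain ⟨x, rfl⟩ := h2
      rw [hτ, hτ' j h1] at hj
      exact absurd hj.symm (hidle _ _)
    · rw [hτ' j h1, hτ' j' h2] at hj
      simpa [Fin.ext_iff] using hj
  · by_cases h1 : ∃ x, e x = j
    · obtain ⟨x, rfl⟩ := h1
      rw [hτ]
      rcases x with i | o
      · exact i.2
      · exact (Finset.mem_filter.1 o.2).2
    · rw [hτ' j h1]
      exact j.2

/-! ### The instance of the disjoint paths problems -/

/-- A vertex of the given kind. -/
def GVertex.ofTag : ℕ → ℕ → ℕ → GVertex
  | 0, _, u => .src u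
  | 1, i, u => .fwd i u
  | 2, i, u => .bwd i u
  | 3, _, u => .tgt u
  | _, _, u => .pad u

/-- The number of a vertex; this is a topological order. -/
def GVertex.code (k n : ℕ) : GVertex → ℕ
  | .src o => o
  | .fwd i u => k * k + 2 * i * (n * blockLen k + 2) + u
  | .bwd i u => k * k + (2 * i + 1) * (n * blockLen k + 2) + u
  | .tgt o => k * k + 2 * k * (n * blockLen k + 2) + o
  | .pad j => k * k + 2 * k * (n * blockLen k + 2) + k * k + j

/-- The kind of the vertex number `w`. -/
def codeTag (k n w : ℕ) : ℕ :=
  if w < k * k then 0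
  else if w - k * k < 2 * k * (n * blockLen k + 2) then
    1 + (w - k * k) / (n * blockLen k + 2) % 2
  else if w - k * k - 2 * k * (n * blockLen k + 2) < k * k then 3 else 4

/-- The row of the vertex number `w`, if it belongs to a row. -/
def codeRow (k n w : ℕ) : ℕ := (w - k * k) / (n * blockLen k + 2) / 2

/-- The position of the vertex number `w` among those of its kind. -/
def codePos (k n w : ℕ) : ℕ :=
  if w < k * k then w
  else if w - k * k < 2 * k * (n * blockLen k + 2) then (w - k * k) % (n * blockLen k + 2)
  else if w - k * k - 2 * k * (n * blockLen k + 2) < k * k then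
    w - k * k - 2 * k * (n * blockLen k + 2)
  else w - k * k - 2 * k * (n * blockLen k + 2) - k * k

/-- The vertex number `w`. -/
def decodeVertex (k n w : ℕ) : GVertex :=
  GVertex.ofTag (codeTag k n w) (codeRow k n w) (codePos k n w)

/-- The number of vertices. -/
def dagSize (k p n : ℕ) : ℕ := k * k + 2 * k * (n * blockLen k + 2) + k * k + p

section

variable {k n p : ℕ}

/-- This holds for every number w, because all large numbers decode to `pad`. So `decodeVertex` is
injective without any range condition. -/
theorem code_decodeVertex (k n w : ℕ) : (decodeVertex k n w).code k n = w := by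
  unfold decodeVertex codeTag codeRow codePos
  by_cases h1 : w < k * k
  · simp [h1, GVertex.ofTag, GVertex.code]
  by_cases h2 : w - k * k < 2 * k * (n * blockLen k + 2)
  · have e1 := Nat.div_add_mod (w - k * k) (n * blockLen k + 2)
    have e2 := Nat.div_add_mod ((w - k * k) / (n * blockLen k + 2)) 2
    rcases Nat.mod_two_eq_zero_or_one ((w - k * k) / (n * blockLen k + 2)) with h | h
    · simp only [h1, h2, h, if_true, if_false, add_zero, GVertex.ofTag, GVertex.code]
      rw [h, add_zero] at e2
      rw [e2, mul_comm _ (n * blockLen k + 2)]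
      omega
    · simp only [h1, h2, h, if_true, if_false, GVertex.ofTag, GVertex.code]
      rw [h] at e2
      rw [e2, mul_comm _ (n * blockLen k + 2)]
      omega
  by_cases h3 : w - k * k - 2 * k * (n * blockLen k + 2) < k * k
  · simp only [h1, h2, h3, if_true, if_false, GVertex.ofTag, GVertex.code]
    omega
  · simp only [h1, h2, h3, if_false, GVertex.ofTag, GVertex.code]
    omega

theorem decodeVertex_code {z : GVertex} (hz : z.Valid k n p) :
    decodeVertex k n (z.code k n) = z := by
  have track : ∀ i e u, i < k → e < 2 → u < n * blockLen k + 2 →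
      ¬ k * k + (2 * i + e) * (n * blockLen k + 2) + u < k * k ∧
      k * k + (2 * i + e) * (n * blockLen k + 2) + u - k * k < 2 * k * (n * blockLen k + 2) ∧
      (k * k + (2 * i + e) * (n * blockLen k + 2) + u - k * k) / (n * blockLen k + 2) =
        2 * i + e ∧
      (k * k + (2 * i + e) * (n * blockLen k + 2) + u - k * k) % (n * blockLen k + 2) = u := by
    intro i e u hi he hu
    have e1 : k * k + (2 * i + e) * (n * blockLen k + 2) + u - k * k =
        u + (n * blockLen k + 2) * (2 * i + e) := by rw [mul_comm (2 * i + e)]; omega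
    refine ⟨by omega, ?_, ?_, ?_⟩
    · rw [e1]
      have : (n * blockLen k + 2) * (2 * i + e + 1) ≤ (n * blockLen k + 2) * (2 * k) :=
        Nat.mul_le_mul_left _ (by omega)
      rw [mul_add, mul_one] at this
      rw [mul_comm (2 * k)]
      omega
    · rw [e1, Nat.add_mul_div_left _ _ (by omega), Nat.div_eq_of_lt hu, zero_add]
    · rw [e1, Nat.add_mul_mod_self_left, Nat.mod_eq_of_lt hu]
  unfold decodeVertex codeTag codeRow codePos
  cases z with
  | src o =>
    simp only [GVertex.Valid] at hz
    simp [GVertex.code, hz, GVertex.ofTag]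
  | fwd i u =>
    obtain ⟨h1, h2, h3, h4⟩ := track i 0 u hz.1 (by omega) hz.2
    simp only [add_zero] at h1 h2 h3 h4
    simp only [GVertex.code, if_neg h1, if_pos h2, h3, h4]
    simp [GVertex.ofTag]
  | bwd i u =>
    obtain ⟨h1, h2, h3, h4⟩ := track i 1 u hz.1 (by omega) hz.2
    simp only [GVertex.code, if_neg h1, if_pos h2, h3, h4]
    rw [show (2 * i + 1) % 2 = 1 by omega, show (2 * i + 1) / 2 = i by omega]
    rfl
  | tgt o =>
    simp only [GVertex.Valid] at hz
    have e : GVertex.code k n (.tgt o) = k * k + 2 * k * (n * blockLen k + 2) + o := rfl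
    generalize GVertex.code k n (.tgt o) = w at e
    rw [if_neg (by omega), if_neg (by omega), if_pos (by omega), if_neg (by omega),
      if_neg (by omega), if_pos (by omega)]
    simp only [GVertex.ofTag]
    congr 1
    omega
  | pad j =>
    have e : GVertex.code k n (.pad j) =
      k * k + 2 * k * (n * blockLen k + 2) + k * k + j := rfl
    generalize GVertex.code k n (.pad j) = w at e
    rw [if_neg (by omega), if_neg (by omega), if_neg (by omega), if_neg (by omega),
      if_neg (by omega), if_neg (by omega)]
    simp only [GVertex.ofTag]
    congr 1
    omega

theorem decodeVertex_injective (k n : ℕ) : Function.Injective (decodeVertex k n) :=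
  Function.LeftInverse.injective (code_decodeVertex k n)

theorem GVertex.code_lt {z : GVertex} (hz : z.Valid k n p) : z.code k n < dagSize k p n := by
  have track : ∀ i e, i < k → e < 2 →
      (2 * i + e) * (n * blockLen k + 2) + (n * blockLen k + 2) ≤
        2 * k * (n * blockLen k + 2) := fun i e hi he => by
    have : (2 * i + e + 1) * (n * blockLen k + 2) ≤ 2 * k * (n * blockLen k + 2) :=
      Nat.mul_le_mul_right _ (by omega)
    rwa [add_mul _ 1, one_mul] at this
  unfold dagSize
  cases z with
  | src o => simp only [GVertex.Valid] at hz; simp only [GVertex.code]; omega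
  | fwd i u =>
    have := track i 0 hz.1 (by omega)
    have := hz.2
    simp only [GVertex.code, add_zero] at *
    omega
  | bwd i u =>
    have := track i 1 hz.1 (by omega)
    have := hz.2
    simp only [GVertex.code] at *
    omega
  | tgt o => simp only [GVertex.Valid] at hz; simp only [GVertex.code]; omega
  | pad j => simp only [GVertex.Valid] at hz; simp only [GVertex.code]; omega

/-- The order is: sources, `fwd 0`, `bwd 0`, `fwd 1`, `bwd 1`, ..., targets. Crossings lead to the
next track, hops to a later row; acyclicity of the instance follows. -/
theorem GEdge.code_lt {A : ℕ → ℕ → ℕ → ℕ → Prop}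
    (hA : ∀ i a j b, A i a j b → i < k ∧ a < n ∧ j < k ∧ b < n) {z w : GVertex}
    (h : GEdge k n A z w) : z.code k n < w.code k n := by
  obtain ⟨hz, hw⟩ := GEdge.valid (p := 0) hA h
  have mono : ∀ e e', e + 1 ≤ e' →
      e * (n * blockLen k + 2) + (n * blockLen k + 2) ≤ e' * (n * blockLen k + 2) :=
    fun e e' hee => by
      have := Nat.mul_le_mul_right (n * blockLen k + 2) hee
      rwa [add_mul, one_mul] at this
  cases z <;> cases w <;> simp only [GEdge] at h <;> simp only [GVertex.code]
  case src.fwd => simp only [GVertex.Valid] at hz; omega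
  case fwd.fwd => obtain ⟨-, rfl, rfl, -⟩ := h; omega
  case fwd.bwd i u j v =>
    obtain ⟨-, rfl, -, h⟩ := h
    have := mono (2 * j) (2 * j + 1) le_rfl
    omega
  case bwd.fwd i u j v =>
    obtain ⟨-, -, -, hlab, rfl, h⟩ := h
    have h1 := hlab.1
    have := mono (2 * i + 1) (2 * (i + (u - 1) % blockLen k / k)) (by omega)
    have := hz.2
    omega
  case bwd.bwd => obtain ⟨-, rfl, rfl, -⟩ := h; omega
  case bwd.tgt i u o =>
    have := mono (2 * i + 1) (2 * k) (by omega)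
    have := hz.2
    omega

end

/-- The adjacency relation that the adjacency matrix in the memory describes. -/
def MemAdj (k n : ℕ) (mem : ℕ → ℕ) (i a j b : ℕ) : Prop :=
  i < k ∧ a < n ∧ j < k ∧ b < n ∧ mem ((i * n + a) * (k * n) + (j * n + b)) = 1

theorem MemAdj.bounds {k n : ℕ} {mem : ℕ → ℕ} (i a j b : ℕ) (h : MemAdj k n mem i a j b) :
    i < k ∧ a < n ∧ j < k ∧ b < n := ⟨h.1, h.2.1, h.2.2.1, h.2.2.2.1⟩

theorem PathTask.valid_ends {k n p : ℕ} {t : PathTask} (h : t.Valid k p) :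
    t.source.Valid k n p ∧ (t.target k n).Valid k n p := by
  cases t with
  | row i => exact ⟨⟨h, Nat.succ_pos _⟩, h, by omega⟩
  | check o => exact ⟨IsLabel.lt_mul h, IsLabel.lt_mul h⟩
  | idle j => exact ⟨h, h⟩

/-- The instance of the disjoint paths problems for the adjacency matrix in the memory. -/
def reductionDag (k p n : ℕ) (mem : ℕ → ℕ) (τ : Fin p → PathTask)
    (hτ : ∀ j, (τ j).Valid k p) : DagInstance p (dagSize k p n) where
  G := ⟨fun u v => GEdge k n (MemAdj k n mem) (decodeVertex k n u) (decodeVertex k n v)⟩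
  acyclic v hv := by
    have key : ∀ u v : Fin (dagSize k p n), GEdge k n (MemAdj k n mem) (decodeVertex k n u)
        (decodeVertex k n v) → u < v := fun u v h => by
      have := GEdge.code_lt MemAdj.bounds h
      rwa [code_decodeVertex, code_decodeVertex] at this
    have h' : ∀ w, Relation.TransGen (fun u v : Fin (dagSize k p n) =>
        GEdge k n (MemAdj k n mem) (decodeVertex k n u) (decodeVertex k n v)) v w → v < w :=
      fun w hw => by
        induction hw with
        | single h => exact key _ _ h
        | tail _ h ih => exact ih.trans (key _ _ h)
    exact lt_irrefl _ (h' v hv)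
  s j := ⟨(τ j).source.code k n, GVertex.code_lt (PathTask.valid_ends (hτ j)).1⟩
  t j := ⟨((τ j).target k n).code k n, GVertex.code_lt (PathTask.valid_ends (hτ j)).2⟩

theorem IsDiPath.of_map {V W : Type*} {G : Digraph V} {H : Digraph W} {f : V → W}
    (hf : ∀ u v, H.Adj (f u) (f v) → G.Adj u v) (hinj : Function.Injective f) {u v : V} {l : List V}
    (h : IsDiPath H (f u) (f v) (l.map f)) : IsDiPath G u v l := by
  obtain ⟨h1, h2, h3⟩ := h
  refine ⟨List.isChain_of_isChain_map f hf h1, ?_, ?_⟩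
  · rw [List.head?_map] at h2
    exact Option.map_injective hinj h2
  · rw [List.getLast?_map] at h3
    exact Option.map_injective hinj h3

section

variable {k n p : ℕ} {mem : ℕ → ℕ} {τ : Fin p → PathTask} {hτ : ∀ j, (τ j).Valid k p}

theorem exists_clique_of_reductionDag
    (hinj : Function.Injective τ) (hrow : ∀ i < k, ∃ j, τ j = .row i)
    (hcheck : ∀ o, IsLabel k o → ∃ j, τ j = .check o)
    (h : (disjointPathsProblem p).IsYes (reductionDag k p n mem τ hτ)) :
    ∃ a : ℕ → ℕ, ∀ i j, i < j → j < k → MemAdj k n mem i (a i) j (a j) := by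
  obtain ⟨L, hL, hdis⟩ := h
  have hs : ∀ j, decodeVertex k n ((reductionDag k p n mem τ hτ).s j) = (τ j).source := fun j =>
    decodeVertex_code (PathTask.valid_ends (hτ j)).1
  have ht : ∀ j, decodeVertex k n ((reductionDag k p n mem τ hτ).t j) = (τ j).target k n :=
    fun j => decodeVertex_code (PathTask.valid_ends (hτ j)).2
  refine exists_clique_of_disjoint (L := fun j => (L j).map fun u : Fin (dagSize k p n) => decodeVertex k n u)
    MemAdj.bounds hrow hcheck hinj (fun j => ?_) fun i j hij v hi hj => ?_
  · have := (hL j).map (H := gGraph k n (MemAdj k n mem)) (f := fun u : Fin (dagSize k p n) => decodeVertex k n u)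
      fun u v huv => huv
    rwa [hs, ht] at this
  · obtain ⟨u, hu, rfl⟩ := List.mem_map.1 hi
    obtain ⟨u', hu', huu⟩ := List.mem_map.1 hj
    obtain rfl : u' = u := Fin.ext (decodeVertex_injective k n huu)
    simp only [← hs, ← ht]
    obtain ⟨h1, h2⟩ := hdis i j hij _ hu hu'
    have hc : ∀ {x y : Fin (dagSize k p n)}, x = y → decodeVertex k n x = decodeVertex k n y :=
      fun h => by rw [h]
    exact ⟨h1.imp hc hc, h2.imp hc hc⟩

theorem reductionDag_isYes_of_clique (hinj : Function.Injective τ) {a : ℕ → ℕ}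
    (ha : ∀ i < k, a i < n) (hadj : ∀ i j, i < j → j < k → MemAdj k n mem i (a i) j (a j)) :
    (disjointShortestPathsProblem p).IsYes (reductionDag k p n mem τ hτ) := by
  obtain ⟨L, hL, hdis⟩ := exists_disjoint_of_clique ha hadj hτ hinj
  have hs : ∀ j, decodeVertex k n ((reductionDag k p n mem τ hτ).s j) = (τ j).source := fun j =>
    decodeVertex_code (PathTask.valid_ends (hτ j)).1
  have ht : ∀ j, decodeVertex k n ((reductionDag k p n mem τ hτ).t j) = (τ j).target k n :=
    fun j => decodeVertex_code (PathTask.valid_ends (hτ j)).2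
  have hf : Function.Injective fun u : Fin (dagSize k p n) => decodeVertex k n u :=
    (decodeVertex_injective k n).comp Fin.val_injective
  -- All vertices of a path into a valid target are valid, so the path lies in the finite part that
  -- the instance encodes.
  have hlift : ∀ j, ∃ l : List (Fin (dagSize k p n)),
      l.map (fun u : Fin (dagSize k p n) => decodeVertex k n u) = L j := fun j => by
    have : L j ∈ Set.range (List.map fun u : Fin (dagSize k p n) => decodeVertex k n u) := by
      rw [Set.range_list_map]
      intro x hx
      have hx' := (hL j).1.forall_valid MemAdj.bounds (PathTask.valid_ends (hτ j)).2 x hx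
      exact ⟨⟨_, GVertex.code_lt hx'⟩, decodeVertex_code hx'⟩
    exact this
  choose L' hL' using hlift
  refine ⟨L', fun j => ⟨?_, fun l' hl' => ?_⟩, fun i j hij v hi hj => ?_⟩
  · refine IsDiPath.of_map (f := fun u : Fin (dagSize k p n) => decodeVertex k n u) (H := gGraph k n (MemAdj k n mem)) (fun u v huv => huv) hf ?_
    rw [hL', hs, ht]
    exact (hL j).1
  · have h1 := IsDiPath.map (H := gGraph k n (MemAdj k n mem))
      (f := fun u : Fin (dagSize k p n) => decodeVertex k n u) (fun u v huv => huv) hl'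
    rw [hs, ht] at h1
    have h2 := (hL j).2 _ h1
    rwa [← hL', List.length_map, List.length_map] at h2
  · have hi' := List.mem_map_of_mem (f := fun u : Fin (dagSize k p n) => decodeVertex k n u) hi
    have hj' := List.mem_map_of_mem (f := fun u : Fin (dagSize k p n) => decodeVertex k n u) hj
    rw [hL'] at hi' hj'
    obtain ⟨h1, h2⟩ := hdis i j hij _ hi' hj'
    simp only [← hs, ← ht] at h1 h2
    exact ⟨h1.imp (fun h => hf h) fun h => hf h, h2.imp (fun h => hf h) fun h => hf h⟩

end

theorem disjointPathsProblem_isYes_of_shortest {p n : ℕ} {x : DagInstance p n}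
    (h : (disjointShortestPathsProblem p).IsYes x) : (disjointPathsProblem p).IsYes x := by
  obtain ⟨L, hL, hdis⟩ := h
  exact ⟨L, fun j => (hL j).1, hdis⟩

/-! ### Adjacency matrices -/

open Classical in
theorem matrixCells_mul_add {N : ℕ} (r : Fin N → Fin N → Prop) (u v : Fin N) :
    matrixCells r (u * N + v) = if r u v then 1 else 0 := by
  unfold matrixCells
  congr 1
  refine propext ⟨?_, fun h => ⟨u, v, rfl, h⟩⟩
  rintro ⟨u', v', h, hr⟩
  have hN : 0 < N := u.pos
  have h1 := congrArg (· / N) h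
  have h2 := congrArg (· % N) h
  simp only [mul_comm _ N, Nat.mul_add_div hN, Nat.mul_add_mod, Nat.mod_eq_of_lt v.2,
    Nat.mod_eq_of_lt v'.2, Nat.div_eq_of_lt v.2, Nat.div_eq_of_lt v'.2, add_zero] at h1 h2
  rwa [Fin.ext h1, Fin.ext h2]

theorem matrixCells_eq_zero {N : ℕ} (r : Fin N → Fin N → Prop) {q : ℕ} (hq : N * N ≤ q) :
    matrixCells r q = 0 := by
  refine if_neg ?_
  rintro ⟨u, v, rfl, -⟩
  have h1 := u.2
  have h2 := v.2
  have : (u.1 + 1) * N ≤ N * N := Nat.mul_le_mul_right _ h1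
  rw [add_mul, one_mul] at this
  omega

theorem matrixCells_le_one {N : ℕ} (r : Fin N → Fin N → Prop) (q : ℕ) : matrixCells r q ≤ 1 := by
  unfold matrixCells
  split_ifs <;> omega

-- Division with remainder replaces the search for a pair of indices, which makes a cell computable
-- by local code.
open Classical in
theorem matrixCells_eq_ite {N : ℕ} (r : ℕ → ℕ → Prop) (q : ℕ) :
    matrixCells (fun u v : Fin N => r u v) q =
      if q / N < N ∧ r (q / N) (q % N) then 1 else 0 := by
  by_cases h : q / N < N
  · have hN : 0 < N := (Nat.zero_le _).trans_lt h
    have := matrixCells_mul_add (fun u v : Fin N => r u v) ⟨q / N, h⟩ ⟨q % N, Nat.mod_lt _ hN⟩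
    simp only [Nat.div_add_mod'] at this
    simp [this, h]
  · rw [if_neg (fun h' => h h'.1), matrixCells_eq_zero]
    rcases Nat.eq_zero_or_pos N with rfl | hN
    · simp
    · exact (Nat.le_div_iff_mul_le hN).1 (not_lt.1 h)

theorem memAdj_cliqueProblem_input {k n : ℕ} (G : (cliqueProblem k).Inst n) (i j : Fin k)
    (a b : Fin n) :
    MemAdj k n ((cliqueProblem k).input G) i a j b ↔ G.1.Adj (i, a) (j, b) := by
  classical
  have h := matrixCells_mul_add (fun u v => G.1.Adj (finProdFinEquiv.symm u)
    (finProdFinEquiv.symm v)) (finProdFinEquiv (i, a)) (finProdFinEquiv (j, b))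
  simp only [Equiv.symm_apply_apply] at h
  have e : ∀ (i : Fin k) (a : Fin n), ((finProdFinEquiv (i, a) : Fin (k * n)) : ℕ) = i * n + a :=
    fun i a => by simp [finProdFinEquiv]; ring
  rw [e, e] at h
  simp only [MemAdj, Fin.is_lt, true_and, cliqueProblem, h]
  split_ifs <;> simp_all

/-- Vertices of the same part are not adjacent, so a clique of size k has exactly one vertex in each
of the k parts. -/
theorem cliqueProblem_isYes_iff {k n : ℕ} (G : (cliqueProblem k).Inst n) :
    (cliqueProblem k).IsYes G ↔ ∃ a : ℕ → ℕ, (∀ i < k, a i < n) ∧ ∀ i j, i < j → j < k →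
      MemAdj k n ((cliqueProblem k).input G) i (a i) j (a j) := by
  classical
  constructor
  · rintro ⟨s, hs⟩
    have hinj : Set.InjOn Prod.fst (s : Set (Fin k × Fin n)) := fun u hu v hv huv => by
      by_contra hne
      exact G.2 u v (hs.1 hu hv hne) huv
    have himg : s.image Prod.fst = Finset.univ := by
      rw [← Finset.card_eq_iff_eq_univ, Finset.card_image_of_injOn hinj, hs.2, Fintype.card_fin]
    have hex : ∀ i : Fin k, ∃ a : Fin n, (i, a) ∈ s := fun i => by
      have : i ∈ s.image Prod.fst := himg ▸ Finset.mem_univ i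
      obtain ⟨⟨i', a⟩, h, rfl⟩ := Finset.mem_image.1 this
      exact ⟨a, h⟩
    choose a ha using hex
    refine ⟨fun i => if h : i < k then a ⟨i, h⟩ else 0, fun i hi => by simp [hi],
      fun i j hij hj => ?_⟩
    have hi : i < k := hij.trans hj
    simp only [hi, hj, dif_pos]
    refine (memAdj_cliqueProblem_input G ⟨i, hi⟩ ⟨j, hj⟩ _ _).2 (hs.1 (ha _) (ha _) ?_)
    simp [hij.ne]
  · rintro ⟨a, ha, hadj⟩
    have hadj' : ∀ i j : Fin k, i < j → G.1.Adj (i, ⟨a i, ha i i.2⟩) (j, ⟨a j, ha j j.2⟩) :=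
      fun i j hij => (memAdj_cliqueProblem_input G i j ⟨a i, ha i i.2⟩ ⟨a j, ha j j.2⟩).1
        (hadj i j hij j.2)
    refine ⟨Finset.univ.image fun i : Fin k => (i, ⟨a i, ha i i.2⟩), ?_, ?_⟩
    · intro u hu v hv huv
      simp only [Finset.coe_image, Finset.coe_univ, Set.image_univ, Set.mem_range] at hu hv
      obtain ⟨i, rfl⟩ := hu
      obtain ⟨j, rfl⟩ := hv
      have hij : i ≠ j := fun h => huv (by rw [h])
      rcases lt_or_gt_of_ne hij with h | h
      · exact hadj' i j h
      · exact (hadj' j i h).symm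
    · rw [Finset.card_image_of_injective _ fun i j h => (Prod.mk.inj h).1]
      simp

/-! ### The reduction is local -/

section

variable {k p : ℕ} {f g t i u t' j v : (ℕ → ℕ) → ℕ → ℕ → ℕ}

theorem isLocal_rowLen (k : ℕ) : IsLocal fun _ n _ => n * blockLen k + 2 :=
  (IsLocal.size.mul (.const _)).add (.const _)

theorem isLocal_tracksLen (k : ℕ) : IsLocal fun _ n _ => 2 * k * (n * blockLen k + 2) :=
  (IsLocal.const _).mul (isLocal_rowLen k)

theorem isLocal_dagSize (k p : ℕ) : IsLocal fun _ n _ => dagSize k p n :=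
  (((IsLocal.const _).add (isLocal_tracksLen k)).add (.const _)).add (.const _)

theorem isLocal_codeTag (hf : IsLocal f) : IsLocal fun mem n x => codeTag k n (f mem n x) :=
  have h1 := hf.sub (.const (k * k))
  .ite (.lt hf (.const _)) (.const 0) <|
    .ite (.lt h1 (isLocal_tracksLen k))
      ((IsLocal.const 1).add ((h1.div (isLocal_rowLen k)).mod (.const 2))) <|
    .ite (.lt (h1.sub (isLocal_tracksLen k)) (.const _)) (.const 3) (.const 4)

theorem isLocal_codeRow (hf : IsLocal f) : IsLocal fun mem n x => codeRow k n (f mem n x) :=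
  ((hf.sub (.const (k * k))).div (isLocal_rowLen k)).div (.const 2)

theorem isLocal_codePos (hf : IsLocal f) : IsLocal fun mem n x => codePos k n (f mem n x) :=
  have h1 := hf.sub (.const (k * k))
  have h2 := h1.sub (isLocal_tracksLen k)
  .ite (.lt hf (.const _)) hf <|
    .ite (.lt h1 (isLocal_tracksLen k)) (h1.mod (isLocal_rowLen k)) <|
    .ite (.lt h2 (.const _)) h2 (h2.sub (.const _))

theorem isLocalPred_isLabel (hf : IsLocal f) : IsLocalPred fun mem n x => IsLabel k (f mem n x) :=
  .and (.lt (hf.mod (.const k)) (hf.div (.const k)))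
    (.lt ((hf.mod (.const k)).add (hf.div (.const k))) (.const k))

theorem isLocalPred_memAdj (ht : IsLocal t) (hi : IsLocal i) (hu : IsLocal u) (hv : IsLocal v) :
    IsLocalPred fun mem n x =>
      MemAdj k n mem (t mem n x) (i mem n x) (u mem n x) (v mem n x) :=
  .and (.lt ht (.const k)) <| .and (.lt hi .size) <| .and (.lt hu (.const k)) <|
    .and (.lt hv .size) <| .eq (IsLocal.load ((((ht.mul .size).add hi).mul
      ((IsLocal.const k).mul .size)).add ((hu.mul .size).add hv))) (.const 1)

/-- Resolves the case distinction into a disjunction of arithmetic conditions, each of which is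
visibly local. -/
theorem gEdge_ofTag_iff {n : ℕ} {A : ℕ → ℕ → ℕ → ℕ → Prop} (t i u t' j v : ℕ) :
    GEdge k n A (.ofTag t i u) (.ofTag t' j v) ↔
      (t = 1 ∧ t' = 1 ∧ GEdge k n A (.fwd i u) (.fwd j v)) ∨
      (t = 2 ∧ t' = 2 ∧ GEdge k n A (.bwd i u) (.bwd j v)) ∨
      (t = 1 ∧ t' = 2 ∧ GEdge k n A (.fwd i u) (.bwd j v)) ∨
      (t = 2 ∧ t' = 1 ∧ GEdge k n A (.bwd i u) (.fwd j v)) ∨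
      (t = 0 ∧ t' = 1 ∧ GEdge k n A (.src u) (.fwd j v)) ∨
      (t = 2 ∧ t' = 3 ∧ GEdge k n A (.bwd i u) (.tgt v)) := by
  rcases t with _ | _ | _ | _ | t <;> rcases t' with _ | _ | _ | _ | t' <;>
    simp [GVertex.ofTag, GEdge]

theorem isLocalPred_gEdge (ht : IsLocal t) (hi : IsLocal i) (hu : IsLocal u) (ht' : IsLocal t')
    (hj : IsLocal j) (hv : IsLocal v) :
    IsLocalPred fun mem n x => GEdge k n (MemAdj k n mem)
      (.ofTag (t mem n x) (i mem n x) (u mem n x))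
      (.ofTag (t' mem n x) (j mem n x) (v mem n x)) := by
  have c : ∀ m, IsLocal fun _ _ _ => m := IsLocal.const
  have hB := c (blockLen k)
  have hW := isLocal_rowLen k
  have hu1 := hu.sub (c 1)
  have hv1 := hv.sub (c 1)
  have next := IsLocalPred.and (.lt hi (c k)) <| .and (.eq hj hi) <|
    .and (.eq hv (hu.add (c 1))) (.lt hv hW)
  have nB : IsLocal fun _ n _ => n * blockLen k + 1 := (IsLocal.size.mul hB).add (c 1)
  refine IsLocalPred.congr ?_ fun mem n x => (gEdge_ofTag_iff _ _ _ _ _ _).symm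
  refine .or (.and (.eq ht (c 1)) <| .and (.eq ht' (c 1)) next) <|
    .or (.and (.eq ht (c 2)) <| .and (.eq ht' (c 2)) next) <|
    .or (.and (.eq ht (c 1)) <| .and (.eq ht' (c 2)) <| .and (.lt hi (c k)) <|
      .and (.eq hj hi) <| .and (.lt hv hW) <| .or (.eq hv hu) <|
      .and (.eq (hu.mod hB) (c 0)) (.eq hv ((hu.add hB).add (c 1)))) <|
    .or (.and (.eq ht (c 2)) <| .and (.eq ht' (c 1)) <| .and (.le (c 1) hu) <|
      .and (.le (c 1) hv) <| .and (.eq (hv1.mod hB) (hu1.mod hB)) <|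
      .and (isLocalPred_isLabel (hu1.mod hB)) <|
      .and (.eq hj (hi.add ((hu1.mod hB).div (c k)))) <|
      isLocalPred_memAdj hi (hu1.div hB) hj (hv1.div hB)) <|
    .or (.and (.eq ht (c 0)) <| .and (.eq ht' (c 1)) <| .and (isLocalPred_isLabel hu) <|
      .and (.eq hj (hu.mod (c k))) <| .and (.le (c 1) hv) <| .and (.lt hv nB) <|
      .eq (hv1.mod hB) hu) <|
    .and (.eq ht (c 2)) <| .and (.eq ht' (c 3)) <| .and (isLocalPred_isLabel hv) <|
      .and (.lt hi (c k)) <| .and (.le (c 1) hu) <| .and (.lt hu nB) <|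
      .and (.eq (hu1.mod hB) hv) <|
      .and (.eq (hi.mod (hv.div (c k))) (hv.mod (c k))) (.le (c k) (hi.add (hv.div (c k))))

theorem isLocalPred_edge (hf : IsLocal f) (hg : IsLocal g) :
    IsLocalPred fun mem n x => GEdge k n (MemAdj k n mem)
      (decodeVertex k n (f mem n x)) (decodeVertex k n (g mem n x)) :=
  isLocalPred_gEdge (isLocal_codeTag hf) (isLocal_codeRow hf) (isLocal_codePos hf)
    (isLocal_codeTag hg) (isLocal_codeRow hg) (isLocal_codePos hg)

theorem isLocal_code_source (s : PathTask) : IsLocal fun _ n _ => s.source.code k n := by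
  cases s with
  | row i => exact ((IsLocal.const _).add ((IsLocal.const _).mul (isLocal_rowLen k))).add (.const _)
  | check o => exact .const _
  | idle j => exact (((IsLocal.const _).add (isLocal_tracksLen k)).add (.const _)).add (.const _)

theorem isLocal_code_target (s : PathTask) : IsLocal fun _ n _ => (s.target k n).code k n := by
  cases s with
  | row i =>
    exact ((IsLocal.const _).add ((IsLocal.const _).mul (isLocal_rowLen k))).add
      ((IsLocal.size.mul (.const _)).add (.const _))
  | check o => exact ((IsLocal.const _).add (isLocal_tracksLen k)).add (.const _)
  | idle j => exact (((IsLocal.const _).add (isLocal_tracksLen k)).add (.const _)).add (.const _)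

/-- A table of constant length p unrolls into p nested conditionals; it serves to write down the
terminals. -/
theorem IsLocal.table {h : ℕ → ℕ → ℕ} (hh : ∀ j, IsLocal fun _ n _ => h j n) (hf : IsLocal f)
    (p : ℕ) : IsLocal fun mem n x => if f mem n x < p then h (f mem n x) n else 0 := by
  induction p with
  | zero => simpa using IsLocal.const 0
  | succ p ih =>
    refine (IsLocal.ite (IsLocalPred.eq hf (.const p)) (hh p) ih).congr fun mem n x => ?_
    split_ifs <;> first | omega | simp_all

end

/-- The memory contents of the instance of the disjoint paths problems. -/
theorem isLocal_reductionDag_cells {k p : ℕ} (τ : Fin p → PathTask)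
    (hτ : ∀ j, (τ j).Valid k p) :
    IsLocal fun mem n x => (reductionDag k p n mem τ hτ).cells x := by
  classical
  have hN := isLocal_dagSize k p
  have hq := IsLocal.arg.sub (.const (2 * p))
  have hS : ∀ j, IsLocal fun _ n _ =>
      if hj : j < p then (τ ⟨j, hj⟩).source.code k n else 0 := fun j => by
    by_cases hj : j < p
    · simpa [hj] using isLocal_code_source (k := k) (τ ⟨j, hj⟩)
    · simpa [hj] using IsLocal.const 0
  have hT : ∀ j, IsLocal fun _ n _ =>
      if hj : j < p then ((τ ⟨j, hj⟩).target k n).code k n else 0 := fun j => by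
    by_cases hj : j < p
    · simpa [hj] using isLocal_code_target (k := k) (τ ⟨j, hj⟩)
    · simpa [hj] using IsLocal.const 0
  refine (IsLocal.ite (IsLocalPred.lt .arg (.const p)) (IsLocal.table hS .arg p) <|
    IsLocal.ite (IsLocalPred.lt (IsLocal.arg.sub (.const p)) (.const p))
      (IsLocal.table hT (IsLocal.arg.sub (.const p)) p) <|
    IsLocal.ite (IsLocalPred.and (.lt (hq.div hN) hN)
      (isLocalPred_edge (k := k) (hq.div hN) (hq.mod hN))) (.const 1) (.const 0)).congr
    fun mem n x => ?_
  unfold DagInstance.cells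
  by_cases h1 : x < p
  · simp [h1, reductionDag]
  by_cases h2 : x - p < p
  · simp [h1, h2, reductionDag]
  · simp only [h1, h2, if_false, dif_neg, not_false_eq_true]
    exact (matrixCells_eq_ite (N := dagSize k p n) (fun u v => GEdge k n (MemAdj k n mem)
      (decodeVertex k n u) (decodeVertex k n v)) (x - 2 * p)).symm

/-- The instance depends only on the cells of the given matrix, so it is unaffected by what the
simulation writes beyond them. -/
theorem memAdj_congr {k n : ℕ} {mem mem' : ℕ → ℕ}
    (h : ∀ q < (k * n) * (k * n), mem q = mem' q) : MemAdj k n mem = MemAdj k n mem' := by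
  funext i a j b
  simp only [MemAdj, eq_iff_iff]
  refine and_congr_right fun hi => and_congr_right fun ha => and_congr_right fun hj =>
    and_congr_right fun hb => ?_
  have cell : ∀ i a, i < k → a < n → i * n + a + 1 ≤ k * n := fun i a hi ha => by
    have : (i + 1) * n ≤ k * n := Nat.mul_le_mul_right _ hi
    rw [add_mul, one_mul] at this
    omega
  have h1 := Nat.mul_le_mul_right (k * n) (cell i a hi ha)
  rw [add_mul, one_mul] at h1
  have h2 := cell j b hj hb
  rw [h _ (by omega)]

/-- An algorithm for one of the disjoint paths problems yields one for `k`-Clique. -/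
theorem exists_solves_cliqueProblem {k p : ℕ} (hk : 2 ≤ k) (hp : k + k ^ 2 / 4 ≤ p)
    {Q : DecisionProblem}
    (hQ : Q = disjointPathsProblem p ∨ Q = disjointShortestPathsProblem p) {mode : AlgMode}
    {P : Program} {T : ℕ → ℕ} (hP : P.Allowed mode) (hT : P.Solves Q T) :
    ∃ (P' : Program) (a b : ℕ), P'.Allowed mode ∧
      P'.Solves (cliqueProblem k) fun n => a + b * T (dagSize k p n) := by
  obtain ⟨τ, hinj, hval, hrow, hcheck⟩ := exists_pathTasks hp
  have hoff : IsLocal fun _ n _ => (k * n) * (k * n) :=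
    ((IsLocal.const k).mul .size).mul ((IsLocal.const k).mul .size)
  have hcells : ∀ {n : ℕ} (x : (cliqueProblem k).Inst n) (mem : ℕ → ℕ),
      (∀ q < (k * n) * (k * n), mem q = (cliqueProblem k).input x q) → ∀ q,
      (reductionDag k p n mem τ hval).cells q =
        (reductionDag k p n ((cliqueProblem k).input x) τ hval).cells q := fun x mem h q => by
    simp only [DagInstance.cells, reductionDag, memAdj_congr h]
  have hyes : ∀ {n : ℕ} (x : (cliqueProblem k).Inst n),
      ((disjointPathsProblem p).IsYes
        (reductionDag k p n ((cliqueProblem k).input x) τ hval) ↔ (cliqueProblem k).IsYes x) ∧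
      ((disjointShortestPathsProblem p).IsYes
        (reductionDag k p n ((cliqueProblem k).input x) τ hval) ↔
          (cliqueProblem k).IsYes x) := fun {n} x => by
    have h1 : (disjointPathsProblem p).IsYes
        (reductionDag k p n ((cliqueProblem k).input x) τ hval) → (cliqueProblem k).IsYes x :=
      fun h => by
        obtain ⟨a, ha⟩ := exists_clique_of_reductionDag hinj hrow hcheck h
        -- That `a i` is in range follows from an adjacency involving part i; a second part exists
        -- because 2 ≤ k.
        refine (cliqueProblem_isYes_iff x).2 ⟨a, fun i hi => ?_, ha⟩
        rcases Nat.eq_zero_or_pos i with rfl | h0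
        · exact (ha 0 1 one_pos (by omega)).2.1
        · exact (ha 0 i h0 hi).2.2.2.1
    have h2 : (cliqueProblem k).IsYes x → (disjointShortestPathsProblem p).IsYes
        (reductionDag k p n ((cliqueProblem k).input x) τ hval) := fun h => by
      obtain ⟨a, ha, hadj⟩ := (cliqueProblem_isYes_iff x).1 h
      exact reductionDag_isYes_of_clique hinj ha hadj
    exact ⟨⟨h1, fun h => disjointPathsProblem_isYes_of_shortest (h2 h)⟩,
      fun h => h1 (disjointPathsProblem_isYes_of_shortest h), h2⟩
  rcases hQ with rfl | rfl
  · exact exists_solves_of_isLocal (Q' := disjointPathsProblem p) (isLocal_dagSize k p) hoff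
      (isLocal_reductionDag_cells τ hval)
      (fun {n} x => reductionDag k p n ((cliqueProblem k).input x) τ hval)
      (fun x => (hyes x).1) (fun x => matrixCells_le_one _)
      (fun x _ h => matrixCells_eq_zero _ h) hcells hP hT
  · exact exists_solves_of_isLocal (Q' := disjointShortestPathsProblem p) (isLocal_dagSize k p)
      hoff (isLocal_reductionDag_cells τ hval)
      (fun {n} x => reductionDag k p n ((cliqueProblem k).input x) τ hval)
      (fun x => (hyes x).2) (fun x => matrixCells_le_one _)
      (fun x _ h => matrixCells_eq_zero _ h) hcells hP hT

/-! ### Exponents of matrix multiplication -/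

section

variable {F : Type*} [Field F]

theorem StraightLine.map_rename {σ σ' : Type*} (f : σ → σ') {l : List (MvPolynomial σ F)}
    (h : StraightLine F l) : StraightLine F (l.map (MvPolynomial.rename f)) := by
  have arg : ∀ {l : List (MvPolynomial σ F)} {g : MvPolynomial σ F},
      (g ∈ l ∨ (∃ i, g = MvPolynomial.X i) ∨ ∃ c, g = MvPolynomial.C c) →
      (MvPolynomial.rename f g ∈ l.map (MvPolynomial.rename f) ∨
        (∃ i, MvPolynomial.rename f g = MvPolynomial.X i) ∨
        ∃ c, MvPolynomial.rename f g = MvPolynomial.C c) := by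
    rintro l g (h | ⟨i, rfl⟩ | ⟨c, rfl⟩)
    · exact Or.inl (List.mem_map_of_mem h)
    · exact Or.inr (Or.inl ⟨f i, MvPolynomial.rename_X f i⟩)
    · exact Or.inr (Or.inr ⟨c, MvPolynomial.rename_C f c⟩)
  induction h with
  | nil => exact .nil
  | gate _ hg hh hf ih =>
    refine .gate ih (arg hg) (arg hh) ?_
    rcases hf with rfl | rfl | rfl
    · exact Or.inl (map_add _ _ _)
    · exact Or.inr (Or.inl (map_sub _ _ _))
    · exact Or.inr (Or.inr (map_mul _ _ _))

/-- Identifying the variables of all rows of the left factor turns the computation, gate by gate,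
into one for a single row. -/
theorem MatMulInOps.one_row {a b c s : ℕ} (ha : 0 < a) (h : MatMulInOps F a b c s) :
    MatMulInOps F 1 b c s := by
  obtain ⟨l, hl, hs, hmem⟩ := h
  refine ⟨_, hl.map_rename (Sum.map (Prod.map (fun _ => (0 : Fin 1)) id) id), by simpa using hs,
    fun i j => ?_⟩
  have := List.mem_map_of_mem
    (f := MvPolynomial.rename (Sum.map (Prod.map (fun _ : Fin a => (0 : Fin 1)) id) id))
    (hmem ⟨0, ha⟩ j)
  rw [Subsingleton.elim i 0]
  simpa [map_sum, MvPolynomial.rename_X] using this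

theorem StraightLine.exists_sum_mul {σ ι : Type*} (x y : ι → σ) (S : Finset ι)
    {l : List (MvPolynomial σ F)} (hl : StraightLine F l) :
    ∃ l', StraightLine F l' ∧ l ⊆ l' ∧ l'.length = l.length + (2 * S.card + 1) ∧
      ∑ k ∈ S, MvPolynomial.X (x k) * MvPolynomial.X (y k) ∈ l' := by
  classical
  induction S using Finset.induction_on with
  | empty =>
    refine ⟨0 :: l, .gate (g := MvPolynomial.C 0) (h := MvPolynomial.C 0) hl
      (Or.inr (Or.inr ⟨0, rfl⟩)) (Or.inr (Or.inr ⟨0, rfl⟩)) (Or.inl (by simp)), by simp, by simp,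
      by simp⟩
  | insert i S hi ih =>
    obtain ⟨l', h1, h2, h3, h4⟩ := ih
    refine ⟨_, .gate (.gate h1 (Or.inr (Or.inl ⟨x i, rfl⟩)) (Or.inr (Or.inl ⟨y i, rfl⟩))
      (Or.inr (Or.inr rfl))) (Or.inl List.mem_cons_self)
      (Or.inl (List.mem_cons_of_mem _ h4)) (Or.inl rfl),
      fun z hz => List.mem_cons_of_mem _ (List.mem_cons_of_mem _ (h2 hz)), ?_, ?_⟩
    · rw [List.length_cons, List.length_cons, h3, Finset.card_insert_of_notMem hi]
      ring
    · rw [Finset.sum_insert hi]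
      exact List.mem_cons_self

/-- The schoolbook algorithm is needed only to show that admissible exponents exist. -/
theorem matMulInOps_naive (a b c : ℕ) : MatMulInOps F a b c (a * c * (2 * b + 1)) := by
  classical
  have key : ∀ S : Finset (Fin a × Fin c),
      ∃ l : List (MvPolynomial ((Fin a × Fin b) ⊕ (Fin b × Fin c)) F),
        StraightLine F l ∧ l.length = S.card * (2 * b + 1) ∧ ∀ ij ∈ S,
          (∑ k : Fin b, MvPolynomial.X (Sum.inl (ij.1, k)) *
            MvPolynomial.X (Sum.inr (k, ij.2))) ∈ l := fun S => by
    induction S using Finset.induction_on with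
    | empty => exact ⟨[], .nil, by simp, by simp⟩
    | insert ij S hij ih =>
      obtain ⟨l, h1, h2, h3⟩ := ih
      obtain ⟨l', h4, h5, h6, h7⟩ := h1.exists_sum_mul
        (fun k : Fin b => (Sum.inl (ij.1, k) : (Fin a × Fin b) ⊕ (Fin b × Fin c)))
        (fun k => Sum.inr (k, ij.2)) Finset.univ
      refine ⟨l', h4, ?_, fun ij' h => ?_⟩
      · rw [h6, h2, Finset.card_insert_of_notMem hij, Finset.card_univ, Fintype.card_fin]
        ring
      · rcases Finset.mem_insert.1 h with rfl | h
        · exact h7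
        · exact h5 (h3 _ h)
  obtain ⟨l, h1, h2, h3⟩ := key Finset.univ
  exact ⟨l, h1, by rw [h2]; simp, fun i j => h3 (i, j) (Finset.mem_univ _)⟩

/-- Exponents with which an `n ^ a × n ^ b` matrix and an `n ^ b × n ^ c` matrix can be
multiplied are nonnegative. -/
theorem nonneg_of_matMulInOps {a b c : ℕ} {τ K : ℝ} (h : ∀ n : ℕ, 1 ≤ n →
    ∃ s : ℕ, (s : ℝ) ≤ K * (n : ℝ) ^ τ ∧ MatMulInOps F (n ^ a) (n ^ b) (n ^ c) s) : 0 ≤ τ := by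
  by_contra hτ
  -- With a negative exponent fewer than one operation would eventually suffice, although the
  -- product has an entry to compute.
  have hlim : Filter.Tendsto (fun n : ℕ => K * (n : ℝ) ^ τ) Filter.atTop (nhds (K * 0)) := by
    have := (tendsto_rpow_neg_atTop (y := -τ) (by linarith)).comp tendsto_natCast_atTop_atTop
    simp only [neg_neg] at this
    exact this.const_mul K
  rw [mul_zero] at hlim
  obtain ⟨n, hn, hn1⟩ := ((hlim.eventually_lt_const one_pos).and
    (Filter.eventually_ge_atTop 1)).exists
  obtain ⟨s, hs, l, -, hls, hmem⟩ := h n hn1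
  have hl : 0 < l.length := List.length_pos_of_mem
    (hmem ⟨0, Nat.pow_pos hn1⟩ ⟨0, Nat.pow_pos hn1⟩)
  have : (1 : ℝ) ≤ s := by exact_mod_cast hl.trans_le hls
  linarith

theorem matMulExponent_nonneg (a b c : ℕ) : 0 ≤ matMulExponent F a b c :=
  Real.sInf_nonneg fun _ ⟨_, h⟩ => nonneg_of_matMulInOps h

/-- These are the exponents for k = 2 and k = 3. The comparison replaces the clique hypothesis for k
= 2, which is not assumed. -/
theorem matMulExponent_vector_le : matMulExponent F 0 1 1 ≤ matMulExponent F 1 1 1 := by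
  refine csInf_le_csInf ⟨0, fun _ ⟨_, h⟩ => nonneg_of_matMulInOps h⟩ ⟨3, 3, fun n hn => ?_⟩ ?_
  · refine ⟨_, ?_, matMulInOps_naive _ _ _⟩
    have : (1 : ℝ) ≤ n := by exact_mod_cast hn
    have h3 : (n : ℝ) ^ (3 : ℝ) = n ^ 3 := by exact_mod_cast Real.rpow_natCast (n : ℝ) 3
    rw [h3]
    push_cast
    nlinarith [mul_nonneg (sq_nonneg (n : ℝ)) (sub_nonneg.2 this)]
  · rintro τ ⟨K, h⟩
    refine ⟨K, fun n hn => ?_⟩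
    obtain ⟨s, hs, hm⟩ := h n hn
    rw [pow_zero]
    exact ⟨s, hs, hm.one_row (Nat.pow_pos hn)⟩

end

/-! ### The parameters -/

/-- For k = 2g the condition reads (g + 1)² ≤ p + 1. -/
theorem isGreatest_kEven {p : ℕ} : IsGreatest {k : ℕ | Even k ∧ k + k ^ 2 / 4 ≤ p} (kEven p) := by
  have hiff : ∀ h : ℕ, h ≤ ⌊√((p : ℝ) + 1)⌋₊ ↔ h ^ 2 ≤ p + 1 := fun h => by
    rw [Nat.le_floor_iff (Real.sqrt_nonneg _), Real.le_sqrt (Nat.cast_nonneg h) (by positivity)]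
    exact_mod_cast Iff.rfl
  have hsq : ∀ h : ℕ, (2 * h) ^ 2 / 4 = h ^ 2 := fun h => by
    rw [show (2 * h) ^ 2 = 4 * h ^ 2 by ring, Nat.mul_div_cancel_left _ (by norm_num)]
  unfold kEven
  generalize ⌊√((p : ℝ) + 1)⌋₊ = m at hiff
  have h1 : 1 ≤ m := (hiff 1).2 (by omega)
  obtain ⟨h, rfl⟩ := Nat.exists_eq_add_of_le h1
  rw [show 2 * (1 + h) - 2 = 2 * h by omega]
  refine ⟨⟨even_two_mul h, ?_⟩, ?_⟩
  · have := (hiff (1 + h)).1 le_rfl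
    rw [hsq]
    nlinarith
  · rintro k ⟨⟨g, rfl⟩, hk⟩
    rw [← two_mul, hsq] at hk
    have := (hiff (g + 1)).2 (by nlinarith)
    omega

/-- For k = 2g + 1 the left side is g² + 3g + 1, so the condition reads (2g + 3)² ≤ 4p + 5. -/
theorem isGreatest_kOdd {p : ℕ} (hp : 1 ≤ p) :
    IsGreatest {k : ℕ | Odd k ∧ k + k ^ 2 / 4 ≤ p} (kOdd p) := by
  have h5 : (1 : ℝ) ≤ √(4 * (p : ℝ) + 5) := by
    rw [Real.one_le_sqrt]
    have : (0 : ℝ) ≤ p := Nat.cast_nonneg p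
    linarith
  have hiff : ∀ h : ℕ, h ≤ ⌊(√(4 * (p : ℝ) + 5) - 1) / 2⌋₊ ↔ (2 * h + 1) ^ 2 ≤ 4 * p + 5 :=
    fun h => by
      rw [Nat.le_floor_iff (by linarith), le_div_iff₀ two_pos, le_sub_iff_add_le, mul_comm,
        Real.le_sqrt (by positivity) (by positivity)]
      exact_mod_cast Iff.rfl
  have hsq : ∀ h : ℕ, (2 * h + 1) ^ 2 / 4 = h ^ 2 + h := fun h => by
    rw [show (2 * h + 1) ^ 2 = 1 + 4 * (h ^ 2 + h) by ring, Nat.add_mul_div_left _ _ (by norm_num)]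
    simp
  unfold kOdd
  generalize ⌊(√(4 * (p : ℝ) + 5) - 1) / 2⌋₊ = m at hiff
  have h1 : 1 ≤ m := (hiff 1).2 (by omega)
  obtain ⟨h, rfl⟩ := Nat.exists_eq_add_of_le h1
  rw [show 2 * (1 + h) - 1 = 2 * h + 1 by omega]
  refine ⟨⟨odd_two_mul_add_one h, ?_⟩, ?_⟩
  · have := (hiff (1 + h)).1 le_rfl
    rw [hsq]
    nlinarith
  · rintro k ⟨⟨g, rfl⟩, hk⟩
    rw [hsq] at hk
    have := (hiff (g + 1)).2 (by nlinarith)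
    omega

/-! ### The lower bound -/

theorem tendsto_dagSize {k p : ℕ} (hk : 1 ≤ k) :
    Filter.Tendsto (dagSize k p) Filter.atTop Filter.atTop := by
  refine Filter.tendsto_atTop_mono (fun n => ?_) Filter.tendsto_id
  have h1 : n ≤ n * blockLen k := Nat.le_mul_of_pos_right _ (blockLen_pos k)
  have h2 : n * blockLen k + 2 ≤ 2 * k * (n * blockLen k + 2) :=
    Nat.le_mul_of_pos_left _ (by omega)
  simp only [dagSize, id]
  omega

theorem dagSize_le (k p : ℕ) : ∃ D, ∀ n, 1 ≤ n → dagSize k p n ≤ D * n := by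
  refine ⟨k * k + 2 * k * (blockLen k + 2) + k * k + p, fun n hn => ?_⟩
  have h1 : k * k ≤ k * k * n := Nat.le_mul_of_pos_right _ hn
  have h2 : p ≤ p * n := Nat.le_mul_of_pos_right _ hn
  have h3 : 2 * k ≤ 2 * k * n := Nat.le_mul_of_pos_right _ hn
  unfold dagSize
  nlinarith

-- The instance has at most D * n vertices, so a running time n^β becomes O(n^β) again; β ≥ 0 lets
-- it absorb the additive constant of the simulation.
open Asymptotics Filter in
theorem requiresTime_of_cliqueProblem {F : Type*} [Field F] {mode : AlgMode} {k p : ℕ}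
    (hk : 3 ≤ k) (hp : k + k ^ 2 / 4 ≤ p)
    (hreq : RequiresTime mode (cliqueProblem k) fun n => cliqueTime F n k) {f : ℕ → ℝ}
    (hf : ∀ n, 1 ≤ n → f n = cliqueTime F n k) {Q : DecisionProblem}
    (hQ : Q = disjointPathsProblem p ∨ Q = disjointShortestPathsProblem p) :
    RequiresTime mode Q f := by
  rintro ε hε ⟨P, T, hP, hT, hO⟩
  obtain ⟨P', a, b, hP', hT'⟩ := exists_solves_cliqueProblem (by omega) hp hQ hP hT
  -- Cutting ε off at 1 keeps the exponent α * (1 - ε) nonnegative.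
  refine hreq (min ε 1) (lt_min hε one_pos) ⟨P', _, hP', hT', ?_⟩
  have hα : 0 ≤ matMulExponent F (k / 3) ((k - 1) ⌈/⌉ 3) (k ⌈/⌉ 3) := matMulExponent_nonneg _ _ _
  unfold cliqueTime at hf ⊢
  generalize matMulExponent F (k / 3) ((k - 1) ⌈/⌉ 3) (k ⌈/⌉ 3) = α at hα hf
  have hβ : 0 ≤ α * (1 - min ε 1) := mul_nonneg hα (by linarith [min_le_right ε 1])
  have hpow : ∀ n : ℕ, ((n : ℝ) ^ α) ^ (1 - min ε 1) = (n : ℝ) ^ (α * (1 - min ε 1)) := fun n =>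
    (Real.rpow_mul (Nat.cast_nonneg n) _ _).symm
  simp only [hpow]
  have hT1 : (fun n => (T n : ℝ)) =O[atTop] fun n : ℕ => (n : ℝ) ^ (α * (1 - min ε 1)) := by
    refine hO.trans (IsBigO.of_bound 1 ?_)
    filter_upwards [eventually_ge_atTop 1] with n hn
    have h1 : (1 : ℝ) ≤ (n : ℝ) ^ α := Real.one_le_rpow (by exact_mod_cast hn) hα
    rw [hf n hn, ← hpow, one_mul, Real.norm_of_nonneg (Real.rpow_nonneg (by linarith) _),
      Real.norm_of_nonneg (Real.rpow_nonneg (by linarith) _)]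
    exact Real.rpow_le_rpow_of_exponent_le h1 (by linarith [min_le_left ε 1])
  obtain ⟨D, hD⟩ := dagSize_le k p
  have hT2 : (fun n => (T (dagSize k p n) : ℝ)) =O[atTop]
      fun n : ℕ => (n : ℝ) ^ (α * (1 - min ε 1)) := by
    refine (hT1.comp_tendsto (tendsto_dagSize (k := k) (p := p) (by omega))).trans
      (IsBigO.of_bound ((D : ℝ) ^ (α * (1 - min ε 1))) ?_)
    filter_upwards [eventually_ge_atTop 1] with n hn
    rw [Function.comp_apply, Real.norm_of_nonneg (Real.rpow_nonneg (Nat.cast_nonneg _) _),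
      Real.norm_of_nonneg (Real.rpow_nonneg (Nat.cast_nonneg _) _),
      ← Real.mul_rpow (Nat.cast_nonneg _) (Nat.cast_nonneg _)]
    exact Real.rpow_le_rpow (Nat.cast_nonneg _) (by exact_mod_cast hD n hn) hβ
  have hconst : (fun _ : ℕ => (a : ℝ)) =O[atTop] fun n : ℕ => (n : ℝ) ^ (α * (1 - min ε 1)) := by
    refine IsBigO.of_bound a ?_
    filter_upwards [eventually_ge_atTop 1] with n hn
    have h1 : (1 : ℝ) ≤ (n : ℝ) ^ (α * (1 - min ε 1)) :=
      Real.one_le_rpow (by exact_mod_cast hn) hβ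
    rw [Real.norm_of_nonneg (Nat.cast_nonneg a), Real.norm_of_nonneg (by linarith)]
    exact le_mul_of_one_le_right (Nat.cast_nonneg a) h1
  simpa using hconst.add (hT2.const_mul_left (b : ℝ))

theorem corollary9 (F : Type*) [Field F] (p : ℕ) (hp : 5 ≤ p) :
    IsGreatest {k : ℕ | Even k ∧ k + k ^ 2 / 4 ≤ p} (kEven p) ∧
    IsGreatest {k : ℕ | Odd k ∧ k + k ^ 2 / 4 ≤ p} (kOdd p) ∧
    ∀ mode : AlgMode, KCliqueHypothesis F mode →
      RequiresTime mode (disjointShortestPathsProblem p)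
        (fun n => max (cliqueTime F n (kEven p)) (cliqueTime F n (kOdd p))) ∧
      RequiresTime mode (disjointPathsProblem p)
        (fun n => max (cliqueTime F n (kEven p)) (cliqueTime F n (kOdd p))) := by
  have hE := isGreatest_kEven (p := p)
  have hO := isGreatest_kOdd (p := p) (by omega)
  refine ⟨hE, hO, fun mode hyp => ?_⟩
  -- This is where p ≥ 5 enters: 3 + ⌊9/4⌋ = 5.
  have hO3 : 3 ≤ kOdd p := hO.2 ⟨by decide, by omega⟩
  have hE2 : 2 ≤ kEven p := hE.2 ⟨by decide, by omega⟩
  have hmono : ∀ {k l n : ℕ}, 1 ≤ n → matMulExponent F (k / 3) ((k - 1) ⌈/⌉ 3) (k ⌈/⌉ 3) ≤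
      matMulExponent F (l / 3) ((l - 1) ⌈/⌉ 3) (l ⌈/⌉ 3) →
      cliqueTime F n k ≤ cliqueTime F n l := fun hn h =>
    Real.rpow_le_rpow_of_exponent_le (by exact_mod_cast hn) h
  obtain ⟨k, hk, hkp, hmax⟩ : ∃ k, 3 ≤ k ∧ k + k ^ 2 / 4 ≤ p ∧ ∀ n, 1 ≤ n →
      max (cliqueTime F n (kEven p)) (cliqueTime F n (kOdd p)) = cliqueTime F n k := by
    -- This case means p < 8, because 4 + 4 = 8; then also `kOdd p = 3`, and the term for k = 2 is
    -- dominated by that for k = 3.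
    by_cases h2 : kEven p = 2
    · have hO' : kOdd p = 3 := by
        have hp8 : p < 8 := by
          by_contra hp8
          have : 4 ≤ kEven p := hE.2 ⟨by decide, by omega⟩
          omega
        by_contra hne
        have h4 : 4 ≤ kOdd p := by omega
        have := Nat.div_le_div_right (c := 4) (Nat.pow_le_pow_left h4 2)
        have := hO.1.2
        omega
      refine ⟨3, le_rfl, by omega, fun n hn => ?_⟩
      rw [h2, hO']
      refine max_eq_right (hmono hn ?_)
      simpa [Nat.ceilDiv_eq_add_pred_div] using matMulExponent_vector_le (F := F)
    · have hE3 : 3 ≤ kEven p := by omega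
      rcases le_total
        (matMulExponent F (kEven p / 3) ((kEven p - 1) ⌈/⌉ 3) (kEven p ⌈/⌉ 3))
        (matMulExponent F (kOdd p / 3) ((kOdd p - 1) ⌈/⌉ 3) (kOdd p ⌈/⌉ 3)) with h | h
      · exact ⟨kOdd p, hO3, hO.1.2, fun n hn => max_eq_right (hmono hn h)⟩
      · exact ⟨kEven p, hE3, hE.1.2, fun n hn => max_eq_left (hmono hn h)⟩
  exact ⟨requiresTime_of_cliqueProblem hk hkp (hyp k hk) hmax (Or.inr rfl),
    requiresTime_of_cliqueProblem hk hkp (hyp k hk) hmax (Or.inl rfl)⟩
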